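/- **Theorem 2.2.** Let $n\ge 1$, $k\ge 2$, let $\lambda=(\lambda_1,\dots,\lambda_k)\in[0,1]^k$ with $\sum_{i=1}^k\lambda_i=1$, and let $T\in(0,\infty]$. Let $\Omega_1,\dots,\Omega_k\subset\mathbb R^n$ be bounded smooth domains, put $$\Omega_\lambda:=\Big\{\sum_{i=1}^k\lambda_i x_i : x_i\in\Omega_i\Big\},\qquad D_{i,T}:=\Omega_i\times(0,T)\quad (i\in\{1,\dots,k,\lambda\}),$$ and let $\mathbf S^n$ be the set of real symmetric $n\times n$ matrices. For each $i\in\{1,\dots,k,\lambda\}$ let $F_i\in C(D_{i,T}\times(0,\infty)\times\mathbb R^n\times\mathbf S^n)$ be elliptic, that is, $F_i(x,t,r,\eta,X)\le F_i(x,t,r,\eta,Y)$ whenever $X\ge Y$. A viscosity subsolution of $$\partial_t u+F_i(x,t,u,\nabla u,\nabla^2u)=0\quad\text{in } D_{i,T} \tag{1}$$ is a locally bounded, upper semicontinuous (here: positive) function $u$ on $D_{i,T}$ such that, whenever $\varphi\in C^2(D_{i,T})$ and $u-\varphi$ attains its maximum over $D_{i,T}$ at $(x_*,t_*)\in D_{i,T}$,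 $$\partial_t\varphi(x_*,t_*)+F_i\big(x_*,t_*,u(x_*,t_*),\nabla\varphi(x_*,t_*),\nabla^2\varphi(x_*,t_*)\big)\le 0 .$$ For $i=1,\dots,k$ let $u_i$ be a real-valued upper semicontinuous function on $\overline{D_{i,T}}$ which is positive in $D_{i,T}$, is a viscosity subsolution of (1), and satisfies $u_i=0$ on $\partial\Omega_i\times(0,T)$. Let $\alpha\in(-\infty,0]$, and for $i\in\{1,\dots,k,\lambda\}$ put $$\mathcal F^{\theta,t}_{i,\alpha}(x,r,A):=\begin{cases} r^{1-\frac1\alpha}F_i\big(x,t,r^{\frac1\alpha},r^{\frac1\alpha-1}\theta,r^{\frac1\alpha-3}A\big), & r>0,\ \text{if }\alpha<0,\\[4pt] e^{-r}F_i\big(x,t,e^r,e^r\theta,e^rA\big), & r\in\mathbb R,\ \text{if }\alpha=0.\end{cases}$$ Let $I_\alpha:=(0,\infty)$ if $\alpha<0$ and $I_0:=\mathbb R$. Assume **(F)** for all $\theta\in\mathbb R^n$, $t\in(0,T)$ and all $(x_i,r_i,A_i)\in\Omega_i\times I_\alpha\times\mathbf S^n$, $i=1,\dots,k$, $$\mathcal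 F^{\theta,t}_{\lambda,\alpha}\Big(\sum_{i=1}^k\lambda_ix_i,\sum_{i=1}^k\lambda_ir_i,\sum_{i=1}^k\lambda_iA_i\Big)\le\sum_{i=1}^k\lambda_i\,\mathcal F^{\theta,t}_{i,\alpha}(x_i,r_i,A_i).$$ For $a\in[0,\infty)^k$ let $M_\alpha(a;\lambda):=0$ if some $a_i=0$, and otherwise $M_\alpha(a;\lambda):=\big(\sum_i\lambda_ia_i^\alpha\big)^{1/\alpha}$ if $\alpha<0$ and $M_0(a;\lambda):=\prod_ia_i^{\lambda_i}$. Define, for $x\in\overline{\Omega_\lambda}$ and $t\in(0,T)$, $$U_{\alpha,\lambda}(x,t):=\sup\Big\{M_\alpha\big(u_1(y_1,t),\dots,u_k(y_k,t);\lambda\big) : y_i\in\overline{\Omega_i},\ x=\sum_{i=1}^k\lambda_iy_i\Big\}.$$ Then $U_{\alpha,\lambda}$ is positive in $D_{\lambda,T}$ and is a viscosity subsolution of (1) with $i=\lambda$ in $D_{\lambda,T}$; moreover $U_{\alpha,\lambda}$ is upper semicontinuous on $\overline{\Omega_\lambda}\times(0,T)$ and $U_{\alpha,\lambda}=0$ on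 $\partial\Omega_\lambda\times(0,T)$. -/

import Mathlib

open Set Filter Topology

namespace ParabolicMinkowski

noncomputable section

/-- `ℝⁿ` with its Euclidean structure. -/
abbrev Space (n : ℕ) : Type := EuclideanSpace ℝ (Fin n)

/-- Operators `F (x, t, r, η, X)`. Only positive `r` and symmetric `X` are ever relevant; the
values elsewhere are never used. -/
abbrev Operator (n : ℕ) : Type :=
  Space n → ℝ → ℝ → Space n → Matrix (Fin n) (Fin n) ℝ → ℝ

/-- A bounded smooth domain: bounded, open, connected (in particular nonempty), and near each
boundary point the sublevel set of a smooth function with nonvanishing differential. -/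
structure IsBoundedSmoothDomain {n : ℕ} (Ω : Set (Space n)) : Prop where
  isOpen : IsOpen Ω
  isConnected : IsConnected Ω
  isBounded : Bornology.IsBounded Ω
  smooth_boundary : ∀ p ∈ frontier Ω, ∃ ρ : Space n → ℝ,
    ContDiff ℝ (⊤ : ℕ∞) ρ ∧ fderiv ℝ ρ p ≠ 0 ∧ ∀ᶠ q in 𝓝 p, (q ∈ Ω ↔ ρ q < 0)

/-- The open time interval `(0, T)`, where `T = ∞` is allowed. -/
def timeInterval (T : EReal) : Set ℝ := {t | 0 < t ∧ (t : EReal) < T}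

/-- The space-time cylinder `Ω × (0, T)`. -/
def cylinder {n : ℕ} (Ω : Set (Space n)) (T : EReal) : Set (Space n × ℝ) :=
  Ω ×ˢ timeInterval T

/-- Continuity of `F` on `O × (0, ∞) × ℝⁿ × Sⁿ`. -/
def IsContinuousOperator {n : ℕ} (O : Set (Space n × ℝ)) (F : Operator n) : Prop :=
  ContinuousOn
    (fun q : Space n × ℝ × ℝ × Space n × Matrix (Fin n) (Fin n) ℝ =>
      F q.1 q.2.1 q.2.2.1 q.2.2.2.1 q.2.2.2.2)
    {q | (q.1, q.2.1) ∈ O ∧ 0 < q.2.2.1 ∧ q.2.2.2.2.IsSymm}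

/-- (Degenerate) ellipticity: `F (x, t, r, η, X) ≤ F (x, t, r, η, Y)` whenever `X ≥ Y`. -/
def IsElliptic {n : ℕ} (O : Set (Space n × ℝ)) (F : Operator n) : Prop :=
  ∀ (x : Space n) (t r : ℝ) (η : Space n) (X Y : Matrix (Fin n) (Fin n) ℝ),
    (x, t) ∈ O → 0 < r → X.IsSymm → Y.IsSymm → (X - Y).PosSemidef →
      F x t r η X ≤ F x t r η Y

/-- The time derivative `∂ₜ φ (x, t)`. -/
def timeDeriv {n : ℕ} (φ : Space n × ℝ → ℝ) (p : Space n × ℝ) : ℝ :=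
  deriv (fun s => φ (p.1, s)) p.2

/-- The spatial gradient `∇ φ (x, t)`. -/
def spatialGradient {n : ℕ} (φ : Space n × ℝ → ℝ) (p : Space n × ℝ) : Space n :=
  gradient (fun y => φ (y, p.2)) p.1

/-- The spatial Hessian matrix `∇² φ (x, t)`. -/
def spatialHessian {n : ℕ} (φ : Space n × ℝ → ℝ) (p : Space n × ℝ) :
    Matrix (Fin n) (Fin n) ℝ :=
  Matrix.of fun i j =>
    fderiv ℝ (fun y => fderiv ℝ (fun z => φ (z, p.2)) y) p.1
      (EuclideanSpace.single i 1) (EuclideanSpace.single j 1)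

/-- `u` is a viscosity subsolution of `∂ₜ u + F (x, t, u, ∇u, ∇²u) = 0` in the open set `O`. -/
structure IsViscositySubsolution {n : ℕ} (O : Set (Space n × ℝ)) (F : Operator n)
    (u : Space n × ℝ → ℝ) : Prop where
  upperSemicontinuousOn : UpperSemicontinuousOn u O
  locallyBounded : ∀ p ∈ O, ∃ C : ℝ, ∀ᶠ q in 𝓝[O] p, |u q| ≤ C
  test : ∀ φ : Space n × ℝ → ℝ, ContDiffOn ℝ 2 φ O →
    ∀ p ∈ O, IsMaxOn (fun q => u q - φ q) O p →
      timeDeriv φ p + F p.1 p.2 (u p) (spatialGradient φ p) (spatialHessian φ p) ≤ 0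

/-- The Minkowski combination `∑ i, wᵢ Ωᵢ`. -/
def minkowskiCombination {n k : ℕ} (w : Fin k → ℝ) (Ω : Fin k → Set (Space n)) :
    Set (Space n) :=
  {x | ∃ y : Fin k → Space n, (∀ i, y i ∈ Ω i) ∧ x = ∑ i, w i • y i}

/-- The weighted power mean `M_α (a; w)` of nonnegative numbers, for finite `α`; it vanishes as
soon as one of the numbers does. -/
def powerMean {k : ℕ} (α : ℝ) (a w : Fin k → ℝ) : ℝ :=
  open Classical in
  if ∀ i, 0 < a i then
    if α = 0 then ∏ i, a i ^ w i else (∑ i, w i * a i ^ α) ^ (1 / α)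
  else 0

/-- The spatial `α`-Minkowski convolution of `u₁, …, u_k`. -/
def minkowskiConvolution {n k : ℕ} (α : ℝ) (w : Fin k → ℝ) (Ω : Fin k → Set (Space n))
    (u : Fin k → Space n × ℝ → ℝ) (p : Space n × ℝ) : ℝ :=
  sSup {m | ∃ y : Fin k → Space n, (∀ i, y i ∈ closure (Ω i)) ∧ p.1 = ∑ i, w i • y i ∧
    m = powerMean α (fun i => u i (y i, p.2)) w}

/-- The transformed operator `𝓕^{θ,t}_α (x, r, A)` associated with `F`. -/
def transformedOperator {n : ℕ} (α : ℝ) (F : Operator n) (θ : Space n) (t : ℝ)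
    (x : Space n) (r : ℝ) (A : Matrix (Fin n) (Fin n) ℝ) : ℝ :=
  open Classical in
  if α = 0 then
    Real.exp (-r) * F x t (Real.exp r) (Real.exp r • θ) (Real.exp r • A)
  else
    r ^ (1 - 1 / α) *
      F x t (r ^ (1 / α)) (r ^ (1 / α - 1) • θ) (r ^ (1 / α - 3) • A)

/-- The joint convexity inequality between `𝓕_λ` (built from `Fl`) and the `𝓕_i` (built from the
`F i`). The variables `r i` stand for values of `u i ^ α`, which are positive, if `α ≠ 0`, and
for values of `log (u i)`, which are arbitrary real numbers, if `α = 0`. -/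
def StructureCondition {n k : ℕ} (α : ℝ) (w : Fin k → ℝ) (Ω : Fin k → Set (Space n))
    (T : EReal) (F : Fin k → Operator n) (Fl : Operator n) : Prop :=
  ∀ (θ : Space n), ∀ t ∈ timeInterval T,
    ∀ (x : Fin k → Space n) (r : Fin k → ℝ) (A : Fin k → Matrix (Fin n) (Fin n) ℝ),
      (∀ i, x i ∈ Ω i) → (α ≠ 0 → ∀ i, 0 < r i) → (∀ i, (A i).IsSymm) →
        transformedOperator α Fl θ t (∑ i, w i • x i) (∑ i, w i * r i) (∑ i, w i • A i) ≤
          ∑ i, w i * transformedOperator α (F i) θ t (x i) (r i) (A i)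

end

end ParabolicMinkowski

/-! The substitution `v = powTransform α u` (that is, `log u` or `u ^ α / α`, both increasing) turns
power means into arithmetic means. For `V = powTransform α U` this gives `∑ wᵢ vᵢ(yᵢ, t) ≤ V(∑ wᵢ
yᵢ, t)` for all interior `yᵢ`, with equality at an optimal decomposition. The zero lateral boundary
values keep the optimal `yᵢ` inside `Ωᵢ`, because a mean with a vanishing entry is zero while `U` is
positive inside.

Let a test function touch `U` from above at such a point, and let `(θ, a, B)` be the resulting jet
of `V`. Then `∑ wᵢ vᵢ(yᵢ + hᵢ, t + s)` lies below a quadratic function of `∑ wᵢ hᵢ` and `s`, with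
equality at zero. If the `vᵢ` were smooth, all their gradients would equal `θ`, their time
derivatives `aᵢ` would satisfy `∑ wᵢ aᵢ = a`, and their Hessians would satisfy `∑ wᵢ ⟪Mᵢ hᵢ, hᵢ⟫ ≤
⟪B h̄, h̄⟫` with `h̄ = ∑ wᵢ hᵢ`. In the variable `r = u ^ α` the equation for `v` reads `aᵢ + 𝓕ᵢ(xᵢ,
rᵢ, Aᵢ) ≤ 0`, where `Aᵢ = rᵢ² Mᵢ + (1 - α) rᵢ θ ⊗ θ` (with `rᵢ` replaced by `1` in this formula when
`α = 0`). Testing the Hessian inequality with `hᵢ = rᵢ x` yields `∑ wᵢ Aᵢ ≤ A`, where `A` is the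
corresponding matrix for `V` (`jetMatrix_sum_le`). Ellipticity, the structure condition and the `k`
equations then give the inequality for `U` (`viscosity_le_of_attained`).

The functions are only upper semicontinuous, so this needs a theorem on sums with a shared time
variable, `exists_superjets_common_time`. Only the weighted sum of the time derivatives is
controlled there, which is enough because the transformed equations are affine in the time
derivative with coefficient one. To prove it, time is decoupled by a strong penalty
(`exists_time_penalty`), and the functions are replaced by sup-convolutions in rescaled time, then
by the `C^{1,1}` hulls of `exists_semiconcave_hull`. The hulls still obey the quadratic upper bound
(`sum_hull_le`). Rademacher's theorem makes their gradients differentiable almost everywhere, and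
Jensen's lemma, `exists_isLocalMax_notMem_null`, finds a slightly perturbed maximum at such a point.
Away from contact a hull has second derivative `M` in some direction, which the Hessian bound at a
maximum forbids. So hull and sup-convolution agree there, and the jets pass to the original
functions by translation.

Semicontinuity and boundary values of the convolution follow from compactness of the set of
decompositions and the behaviour of power means as an entry tends to zero. The latter needs positive
weights, so indices of zero weight are removed beforehand. -/

namespace ParabolicMinkowski

noncomputable section

/-! ### Pointwise second-order Taylor expansion -/

/-- Second-order Taylor expansion at a point where the derivative is differentiable. -/
theorem taylor_second_order {E : Type*} [NormedAddCommGroup E] [NormedSpace ℝ E] {f : E → ℝ}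
    {f' : E → E →L[ℝ] ℝ} {x : E} {f'' : E →L[ℝ] E →L[ℝ] ℝ}
    (hf : ∀ᶠ y in 𝓝 x, HasFDerivAt f (f' y) y) (hx : HasFDerivAt f' f'' x) {ε : ℝ} (hε : 0 < ε) :
    ∀ᶠ h in 𝓝 (0 : E), |f (x + h) - f x - f' x h - 1 / 2 * f'' h h| ≤ ε * ‖h‖ ^ 2 := by
  have hsym := second_derivative_symmetric_of_eventually hf hx
  have h1 : ∀ᶠ h in 𝓝 (0 : E), ‖f' (x + h) - f' x - f'' h‖ ≤ ε * ‖h‖ :=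
    (hasFDerivAt_iff_isLittleO_nhds_zero.1 hx).def hε
  have h2 : ∀ᶠ h in 𝓝 (0 : E), HasFDerivAt f (f' (x + h)) (x + h) := by
    have : Tendsto (fun h : E => x + h) (𝓝 0) (𝓝 x) := by
      have : Continuous (fun h : E => x + h) := by fun_prop
      simpa using this.tendsto 0
    exact this.eventually hf
  obtain ⟨r, hr, hball⟩ := Metric.eventually_nhds_iff_ball.1 (h1.and h2)
  filter_upwards [Metric.ball_mem_nhds (0 : E) hr] with h hh
  have hmem : ∀ k ∈ Metric.closedBall (0 : E) ‖h‖, k ∈ Metric.ball (0 : E) r := by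
    intro k hk
    rw [mem_closedBall_zero_iff] at hk
    rw [mem_ball_zero_iff] at hh ⊢
    exact hk.trans_lt hh
  -- The Taylor remainder has derivative `f'(x + k) - f'(x) - f'' k`, by symmetry of `f''`. This is
  -- at most `ε ‖h‖` on the ball of radius `‖h‖`, so the mean value inequality finishes.
  have hderiv : ∀ k ∈ Metric.closedBall (0 : E) ‖h‖,
      HasFDerivWithinAt (fun k => f (x + k) - f' x k - 1 / 2 * f'' k k)
        (f' (x + k) - f' x - f'' k) (Metric.closedBall (0 : E) ‖h‖) k := by
    intro k hk
    have hk' := (hball k (hmem k hk)).2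
    have a1 : HasFDerivAt (fun k => f (x + k)) (f' (x + k)) k := by
      exact (hk'.comp k ((hasFDerivAt_id k).const_add x)).congr_fderiv (by ext; simp)
    have a2 : HasFDerivAt (fun k => f'' k k) (f'' k + f''.flip k) k := by
      exact (f''.hasFDerivAt.clm_apply (hasFDerivAt_id k)).congr_fderiv (by ext; simp)
    have a3 := (a1.sub (f' x).hasFDerivAt).sub (a2.const_mul (1 / 2))
    refine (a3.congr_fderiv ?_).hasFDerivWithinAt
    ext v
    simp [hsym k v]
    ring
  have key := (convex_closedBall (0 : E) ‖h‖).norm_image_sub_le_of_norm_hasFDerivWithin_le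
    (C := ε * ‖h‖) hderiv
    (fun k hk => ((hball k (hmem k hk)).1).trans
      (mul_le_mul_of_nonneg_left (mem_closedBall_zero_iff.1 hk) hε.le))
    (x := 0) (y := h) (by simp) (by simp)
  simp only [Real.norm_eq_abs, add_zero, map_zero, sub_zero, mul_zero] at key
  calc _ = |f (x + h) - f' x h - 1 / 2 * f'' h h - f x| := by congr 1; ring
    _ ≤ ε * ‖h‖ * ‖h‖ := key
    _ = _ := by ring

/-! ### Functions with Lipschitz gradient and Jensen's lemma -/

section C11

variable {E : Type*} [NormedAddCommGroup E] [InnerProductSpace ℝ E]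

/-- A function squeezed between paraboloids is differentiable. -/
theorem hasFDerivAt_of_paraboloids {g : E → ℝ} {q y : E} {C : ℝ}
    (h : ∀ e, |g (y + e) - g y - inner ℝ q e| ≤ C * ‖e‖ ^ 2) :
    HasFDerivAt g (innerSL ℝ q) y := by
  rw [hasFDerivAt_iff_isLittleO_nhds_zero]
  have h1 : (fun e => g (y + e) - g y - innerSL ℝ q e) =O[𝓝 0] fun e => ‖e‖ ^ 2 := by
    refine Asymptotics.IsBigO.of_bound C (Eventually.of_forall fun e => ?_)
    simpa using h e
  refine h1.trans_isLittleO ?_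
  exact Asymptotics.isLittleO_norm_pow_id one_lt_two

/-- The gradient of a function squeezed between paraboloids at every point is Lipschitz. -/
theorem lipschitzWith_of_paraboloids {g : E → ℝ} {p : E → E} {C : ℝ} (hC : 0 ≤ C)
    (h : ∀ y e, |g (y + e) - g y - inner ℝ (p y) e| ≤ C * ‖e‖ ^ 2) :
    LipschitzWith (Real.toNNReal (6 * C)) p := by
  refine LipschitzWith.of_dist_le_mul fun z y => ?_
  rw [Real.coe_toNNReal _ (by positivity), dist_eq_norm, dist_eq_norm]
  by_cases hD : p z - p y = 0
  · rw [hD]; simp; positivity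
  have hDn : 0 < ‖p z - p y‖ := norm_pos_iff.2 hD
  set a := z - y with ha
  have hz : z = y + a := by simp [ha]
  -- A vector as long as `a` in the direction of the gradient difference. Comparing the expansions
  -- at `z` along `k` and at `y` along `a` and `a + k` bounds `⟪p z - p y, k⟫` by `C (1 + 1 + 4)
  -- ‖a‖²`.
  set k := (‖a‖ / ‖p z - p y‖) • (p z - p y) with hk
  have hkn : ‖k‖ = ‖a‖ := by
    rw [hk, norm_smul, Real.norm_eq_abs, abs_of_nonneg (by positivity)]
    field_simp
  have e1 := abs_le.1 (h z k)
  have e2 := abs_le.1 (h y a)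
  have e3 := abs_le.1 (h y (a + k))
  have hn : ‖a + k‖ ^ 2 ≤ 4 * ‖a‖ ^ 2 := by
    have := norm_add_le a k
    rw [hkn] at this
    nlinarith [norm_nonneg (a + k), norm_nonneg a]
  have hin : inner ℝ (p z - p y) k = ‖a‖ * ‖p z - p y‖ := by
    rw [hk, real_inner_smul_right, real_inner_self_eq_norm_sq]
    field_simp
  rw [inner_sub_left] at hin
  rw [inner_add_right] at e3
  rw [← add_assoc, ← hz] at e3
  rw [← hz] at e2
  rw [hkn] at e1
  have h4 : C * ‖a + k‖ ^ 2 ≤ C * (4 * ‖a‖ ^ 2) := mul_le_mul_of_nonneg_left hn hC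
  have h5 : ‖a‖ * ‖p z - p y‖ ≤ ‖a‖ * (6 * C * ‖a‖) := by nlinarith
  rcases eq_or_lt_of_le (norm_nonneg a) with h0 | h0
  · have : a = 0 := norm_eq_zero.1 h0.symm
    rw [hz, this] at hD
    simp at hD
  · exact le_of_mul_le_mul_left h5 h0

open MeasureTheory in
/-- Jensen's lemma for functions with Lipschitz gradient: small linear perturbations of a function
with a strict interior maximum attain a maximum outside a given null set. -/
theorem exists_isLocalMax_notMem_null [FiniteDimensional ℝ E] [MeasurableSpace E] [BorelSpace E]
    {h : E → ℝ} {P : E → E} {L : NNReal} (hd : ∀ z, HasFDerivAt h (innerSL ℝ (P z)) z)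
    (hP : LipschitzWith L P) {R β ε : ℝ} (hR : 0 < R) (hβ : 0 < β) (hε : 0 < ε)
    (hs : ∀ z, ‖z‖ = R → h z ≤ h 0 - β) {N : Set E}
    (hN : Measure.hausdorffMeasure (Module.finrank ℝ E) N = 0) :
    ∃ z, z ∉ N ∧ ‖z‖ < R ∧ ∃ q, ‖q‖ ≤ ε ∧ IsLocalMax (fun z' => h z' - inner ℝ q z') z ∧
      h 0 ≤ h z - inner ℝ q z := by
  by_contra hcon
  have hcont : Continuous h := continuous_iff_continuousAt.2 fun z => (hd z).continuousAt
  -- A slope below `β / (2R)` changes the function by at most `β / 2` on the sphere, so the maximum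
  -- over the ball stays interior.
  set ε' := min ε (β / (2 * R)) with hε'
  have hε'0 : 0 < ε' := lt_min hε (by positivity)
  -- Every small slope `q` is the gradient of `h` at the maximum point it produces. If all these
  -- points lay in `N`, a ball would be contained in the Lipschitz image of a null set.
  have hsub : Metric.ball (0 : E) ε' ⊆ P '' N := by
    intro q hq
    rw [mem_ball_zero_iff] at hq
    obtain ⟨z, hz, hmax⟩ := (isCompact_closedBall (0 : E) R).exists_isMaxOn
      ⟨0, by simp [hR.le]⟩ (f := fun z' => h z' - inner ℝ q z') (by fun_prop)
    rw [mem_closedBall_zero_iff] at hz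
    have h0 : h 0 ≤ h z - inner ℝ q z := by
      have := hmax (show (0 : E) ∈ Metric.closedBall (0 : E) R by simp [hR.le])
      simpa using this
    have hlt : ‖z‖ < R := by
      refine lt_of_le_of_ne hz fun hzR => ?_
      have h1 := hs z hzR
      have h2 : |inner ℝ q z| ≤ ‖q‖ * ‖z‖ := abs_real_inner_le_norm q z
      have h3 : ‖q‖ * ‖z‖ ≤ β / (2 * R) * R := by
        rw [hzR]
        exact mul_le_mul_of_nonneg_right (hq.le.trans (min_le_right _ _)) hR.le
      have h4 : β / (2 * R) * R = β / 2 := by field_simp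
      have := (abs_le.1 h2).1
      linarith
    have hloc : IsLocalMax (fun z' => h z' - inner ℝ q z') z :=
      hmax.isLocalMax (Metric.closedBall_mem_nhds_of_mem (by simpa using hlt))
    have hPz : P z = q := by
      have hfd : HasFDerivAt (fun z' => h z' - inner ℝ q z') (innerSL ℝ (P z) - innerSL ℝ q) z :=
        (hd z).sub (innerSL ℝ q).hasFDerivAt
      have := hloc.hasFDerivAt_eq_zero hfd
      rw [← map_sub] at this
      have h5 := congrArg (fun l : E →L[ℝ] ℝ => l (P z - q)) this
      simp only [innerSL_apply_apply, real_inner_self_eq_norm_sq,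
        zero_apply] at h5
      exact sub_eq_zero.1 (norm_eq_zero.1 (pow_eq_zero_iff two_ne_zero |>.1 h5))
    refine ⟨z, ?_, hPz⟩
    by_contra hzN
    exact hcon ⟨z, hzN, hlt, q, hq.le.trans (min_le_left _ _), hloc, h0⟩
  have hnull : Measure.hausdorffMeasure (Module.finrank ℝ E) (P '' N) = 0 := by
    refine le_antisymm ((hP.hausdorffMeasure_image_le (Nat.cast_nonneg _) N).trans ?_) zero_le
    rw [hN, mul_zero]
  have hpos : 0 < (Measure.hausdorffMeasure (Module.finrank ℝ E) : Measure E)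
      (Metric.ball (0 : E) ε') := by
    have := isAddHaarMeasure_hausdorffMeasure (E := E)
    exact Metric.measure_ball_pos _ _ hε'0
  exact (hpos.trans_le (measure_mono hsub)).ne' hnull

end C11

/-! ### Sup-convolutions and their semiconcave hulls -/

section SupConvolution

variable {E : Type*} [NormedAddCommGroup E] [InnerProductSpace ℝ E]

/-- The sup-convolution of `u`, restricted to `K`, with the quadratic kernel of opening `l`. -/
def supConv (K : Set E) (u : E → ℝ) (l : ℝ) (x : E) : ℝ :=
  sSup ((fun w => u w - l / 2 * ‖x - w‖ ^ 2) '' K)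

omit [InnerProductSpace ℝ E] in
theorem exists_supConv_eq_and_le {K : Set E} {u : E → ℝ} (hK : IsCompact K) (hne : K.Nonempty)
    (hu : UpperSemicontinuousOn u K) (l : ℝ) (x : E) :
    (∃ w ∈ K, supConv K u l x = u w - l / 2 * ‖x - w‖ ^ 2) ∧
      ∀ w ∈ K, u w - l / 2 * ‖x - w‖ ^ 2 ≤ supConv K u l x := by
  have husc : UpperSemicontinuousOn (fun w => u w + -(l / 2 * ‖x - w‖ ^ 2)) K := by
    have hc : Continuous fun w => -(l / 2 * ‖x - w‖ ^ 2) := by fun_prop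
    exact hu.add (hc.upperSemicontinuous.upperSemicontinuousOn K)
  obtain ⟨w, hw, hmax⟩ := husc.exists_isMaxOn hne hK
  have hgr : IsGreatest ((fun w => u w - l / 2 * ‖x - w‖ ^ 2) '' K)
      (u w - l / 2 * ‖x - w‖ ^ 2) := by
    refine ⟨mem_image_of_mem _ hw, ?_⟩
    rintro _ ⟨w', hw', rfl⟩
    have := hmax hw'
    simp only [mem_ofPred_eq] at this
    simp only
    linarith
  refine ⟨⟨w, hw, hgr.csSup_eq⟩, fun w' hw' => ?_⟩
  rw [supConv, hgr.csSup_eq]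
  exact hgr.2 (mem_image_of_mem _ hw')

variable {K : Set E} {u : E → ℝ}

theorem le_supConv (hK : IsCompact K) (hu : UpperSemicontinuousOn u K) (l : ℝ) (x : E) {w : E}
    (hw : w ∈ K) : u w - l / 2 * ‖x - w‖ ^ 2 ≤ supConv K u l x :=
  (exists_supConv_eq_and_le hK ⟨w, hw⟩ hu l x).2 w hw

theorem exists_supConv_eq (hK : IsCompact K) (hne : K.Nonempty)
    (hu : UpperSemicontinuousOn u K) (l : ℝ) (x : E) :
    ∃ w ∈ K, supConv K u l x = u w - l / 2 * ‖x - w‖ ^ 2 :=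
  (exists_supConv_eq_and_le hK hne hu l x).1

/-- The difference of the two sides is `‖l a - M b‖² / (l + M)`. This is the composition law of
quadratic kernels, and equality holds exactly when `l a = M b`. -/
theorem harmonic_mul_norm_add_sq_le {l M : ℝ} (hl : 0 < l) (hM : 0 < M) (a b : E) :
    l * M / (l + M) * ‖a + b‖ ^ 2 ≤ l * ‖a‖ ^ 2 + M * ‖b‖ ^ 2 := by
  rw [div_mul_eq_mul_div, div_le_iff₀ (by positivity)]
  have h1 := norm_add_sq_real a b
  have h2 := norm_sub_sq_real (l • a) (M • b)
  rw [norm_smul, norm_smul, real_inner_smul_left, real_inner_smul_right, Real.norm_eq_abs,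
    Real.norm_eq_abs, abs_of_pos hl, abs_of_pos hM] at h2
  have h3 := sq_nonneg ‖l • a - M • b‖
  rw [h2] at h3
  rw [h1]
  linarith

theorem norm_lineMap_sq (a d : E) (t : ℝ) :
    ‖a + t • d‖ ^ 2 = (1 - t) * ‖a‖ ^ 2 + t * ‖a + d‖ ^ 2 - t * (1 - t) * ‖d‖ ^ 2 := by
  rw [norm_add_sq_real, norm_add_sq_real, norm_smul, real_inner_smul_right, Real.norm_eq_abs,
    mul_pow, sq_abs]
  ring

theorem norm_add_sub_sq (y e z : E) :
    ‖y + e - z‖ ^ 2 = ‖y - z‖ ^ 2 + 2 * inner ℝ (y - z) e + ‖e‖ ^ 2 := by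
  rw [show y + e - z = (y - z) + e by abel, norm_add_sq_real]

theorem nonneg_of_forall_add_mul_nonneg {a b : ℝ} (h : ∀ t, 0 < t → t < 1 → 0 ≤ a + t * b) :
    0 ≤ a := by
  by_contra! ha
  have hb : 0 < |b| + 1 := by positivity
  have ht : 0 < min (1 / 2) (-a / (2 * (|b| + 1))) := lt_min (by norm_num) (by
    apply div_pos <;> linarith)
  have h1 := h _ ht ((min_le_left _ _).trans_lt (by norm_num))
  have h2 : min (1 / 2) (-a / (2 * (|b| + 1))) * b ≤ -a / (2 * (|b| + 1)) * (|b| + 1) :=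
    (mul_le_mul_of_nonneg_left (by linarith [le_abs_self b]) ht.le).trans
      (mul_le_mul_of_nonneg_right (min_le_right _ _) hb.le)
  have h3 : -a / (2 * (|b| + 1)) * (|b| + 1) = -a / 2 := by field_simp
  linarith

/-- Semiconvexity: for a fixed competitor `w` the function is quadratic with second derivative `-l`,
and the maximiser at the intermediate point competes at both endpoints. -/
theorem supConv_lineMap_le (hK : IsCompact K) (hne : K.Nonempty)
    (hu : UpperSemicontinuousOn u K) (l : ℝ) (z d : E) {t : ℝ} (ht0 : 0 ≤ t) (ht1 : t ≤ 1) :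
    supConv K u l (z + t • d) ≤ (1 - t) * supConv K u l z + t * supConv K u l (z + d) +
      l / 2 * (t * (1 - t)) * ‖d‖ ^ 2 := by
  obtain ⟨w, hw, he⟩ := exists_supConv_eq hK hne hu l (z + t • d)
  have h1 := mul_le_mul_of_nonneg_left (le_supConv hK hu l z hw) (sub_nonneg.2 ht1)
  have h2 := mul_le_mul_of_nonneg_left (le_supConv hK hu l (z + d) hw) ht0
  have h3 := norm_lineMap_sq (z - w) d t
  rw [show z - w + t • d = z + t • d - w by abel, show z - w + d = z + d - w by abel] at h3
  rw [he, h3]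
  linarith

/-- A single competitor bounds the sup-convolution below by a paraboloid of opening `-l`, so adding
a paraboloid of opening `M > l` gives a coercive function. Lower semicontinuity also comes from
freezing the competitor. -/
theorem exists_isMin_supConv_add [FiniteDimensional ℝ E] (hK : IsCompact K) (hne : K.Nonempty)
    (hu : UpperSemicontinuousOn u K) {l M : ℝ} (hl : 0 ≤ l) (hlM : l < M) (y : E) :
    ∃ z, ∀ z', supConv K u l z + M / 2 * ‖y - z‖ ^ 2 ≤
      supConv K u l z' + M / 2 * ‖y - z'‖ ^ 2 := by
  obtain ⟨w, hw⟩ := hne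
  set D := ‖y - w‖
  set A := 2 * l * D + l * D ^ 2 + 2 * |supConv K u l y - u w| with hA
  have hA0 : 0 ≤ A := by positivity
  have ha : 0 < M - l := sub_pos.2 hlM
  set r := max 1 (A / (M - l))
  have hr0 : 0 ≤ r := zero_le_one.trans (le_max_left _ _)
  have hlsc : LowerSemicontinuousOn (fun z => supConv K u l z + M / 2 * ‖y - z‖ ^ 2)
      (Metric.closedBall y r) := by
    intro z _ c hc
    obtain ⟨w', hw', he⟩ := exists_supConv_eq hK ⟨w, hw⟩ hu l z
    have hcont : ContinuousAt (fun z => u w' - l / 2 * ‖z - w'‖ ^ 2 + M / 2 * ‖y - z‖ ^ 2) z := by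
      fun_prop
    have := hcont.eventually (lt_mem_nhds (show c < _ by simpa only [← he] using hc))
    refine nhdsWithin_le_nhds (this.mono fun z' hz' => hz'.trans_le ?_)
    have := le_supConv hK hu l z' hw'
    linarith
  obtain ⟨z, -, hz⟩ := hlsc.exists_isMinOn ⟨y, by simpa using hr0⟩ (isCompact_closedBall y r)
  refine ⟨z, fun z' => ?_⟩
  by_cases hz' : z' ∈ Metric.closedBall y r
  · exact hz hz'
  · have hy := hz (show y ∈ Metric.closedBall y r by simpa using hr0)
    simp only [mem_ofPred_eq, sub_self, norm_zero] at hy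
    refine hy.trans ?_
    rw [Metric.mem_closedBall, not_le, dist_comm, dist_eq_norm] at hz'
    set d := ‖y - z'‖
    have hd1 : 1 ≤ d := (le_max_left _ _).trans hz'.le
    have hd2 : A ≤ (M - l) * d := by
      have := (le_max_right 1 (A / (M - l))).trans hz'.le
      rwa [div_le_iff₀ ha, mul_comm] at this
    have h1 := le_supConv hK hu l z' hw
    have h2 : ‖z' - w‖ ≤ d + D := by
      have := norm_add_le (z' - y) (y - w)
      rw [norm_sub_rev z' y] at this
      simpa using this
    have h3 : l * ‖z' - w‖ ^ 2 ≤ l * (d + D) ^ 2 :=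
      mul_le_mul_of_nonneg_left (pow_le_pow_left₀ (norm_nonneg _) h2 2) hl
    have h4 : A * d ≤ (M - l) * d * d := mul_le_mul_of_nonneg_right hd2 (by linarith)
    have h5 : (l * D ^ 2 + 2 * |supConv K u l y - u w|) * 1 ≤
        (l * D ^ 2 + 2 * |supConv K u l y - u w|) * d :=
      mul_le_mul_of_nonneg_left hd1 (by positivity)
    have h6 := le_abs_self (supConv K u l y - u w)
    nlinarith

/-- The `C^{1,1}` hull of a sup-convolution: the smallest majorant with second derivative at most
`M` is squeezed between paraboloids at every point, and has second derivative `M` in some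
direction wherever it differs from the given function. -/
theorem exists_semiconcave_hull [FiniteDimensional ℝ E] (hK : IsCompact K) (hne : K.Nonempty)
    (hu : UpperSemicontinuousOn u K) {l M : ℝ} (hl : 0 < l) (hM : 0 < M) :
    ∃ (g : E → ℝ) (p : E → E), (∀ x, supConv K u l x ≤ g x) ∧
      (∀ y e, g (y + e) ≤ g y + inner ℝ (p y) e + M / 2 * ‖e‖ ^ 2) ∧
      (∀ y e, g y + inner ℝ (p y) e - l / 2 * ‖e‖ ^ 2 ≤ g (y + e)) ∧
      (∀ y, supConv K u l y = g y ∨ ∃ e, e ≠ 0 ∧ ∀ t, 0 ≤ t → t ≤ 1 →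
        g (y + t • e) = g y + t * inner ℝ (p y) e + M / 2 * t ^ 2 * ‖e‖ ^ 2) ∧
      (∀ c z, (∀ x, supConv K u l x ≤ c + M / 2 * ‖x - z‖ ^ 2) →
        ∀ x, g x ≤ c + M / 2 * ‖x - z‖ ^ 2) := by
  -- The parameter with `1/m = 1/l + 1/M`. By the composition law, `v` is the sup-convolution of `f`
  -- with opening `M`, that is, `v z` is the least height at which the paraboloid of opening `M`
  -- centred at `z` lies above `f`.
  set m := l * M / (l + M) with hm
  have hm0 : 0 ≤ m := by positivity
  have hmM : m < M := by
    rw [hm, div_lt_iff₀ (by positivity)]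
    nlinarith
  set v := supConv K u m with hv
  set f := supConv K u l with hf
  have hfv : ∀ x z, f x ≤ v z + M / 2 * ‖x - z‖ ^ 2 := by
    intro x z
    obtain ⟨w, hw, he⟩ := exists_supConv_eq hK hne hu l x
    have h1 := le_supConv hK hu m z hw
    have h2 := harmonic_mul_norm_add_sq_le hl hM (x - w) (z - x)
    rw [show x - w + (z - x) = z - w by abel, norm_sub_rev z x, ← hm] at h2
    simp only [hf, hv] at *
    linarith
  have hvf : ∀ z, ∃ x, v z + M / 2 * ‖x - z‖ ^ 2 ≤ f x := by
    intro z
    obtain ⟨w, hw, he⟩ := exists_supConv_eq hK hne hu m z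
    -- The point between `w` and `z` for which the harmonic inequality is an equality.
    refine ⟨w + (M / (l + M)) • (z - w), ?_⟩
    have h1 := le_supConv hK hu l (w + (M / (l + M)) • (z - w)) hw
    have h2 : w + (M / (l + M)) • (z - w) - z = -(l / (l + M)) • (z - w) := by
      have : l / (l + M) = 1 - M / (l + M) := by field_simp; ring
      rw [this]
      module
    rw [add_sub_cancel_left, norm_smul, Real.norm_eq_abs, mul_pow, sq_abs] at h1
    rw [h2, norm_smul, Real.norm_eq_abs, mul_pow, sq_abs, hv, he]
    refine le_trans (le_of_eq ?_) h1
    rw [hm]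
    field_simp
    ring
  choose ζ hζ using fun y => exists_isMin_supConv_add hK hne hu hm0 hmM y
  -- The hull is the infimum of all these majorising paraboloids; `ζ y` is the centre of an optimal
  -- one at `y`.
  set g : E → ℝ := fun y => v (ζ y) + M / 2 * ‖y - ζ y‖ ^ 2 with hg
  have hgv : ∀ y z, g y ≤ v z + M / 2 * ‖y - z‖ ^ 2 := fun y z => hζ y z
  have hfg : ∀ x, f x ≤ g x := fun x => hfv x _
  set p : E → E := fun y => M • (y - ζ y) with hp
  have hup : ∀ y e, g (y + e) ≤ g y + inner ℝ (p y) e + M / 2 * ‖e‖ ^ 2 := by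
    intro y e
    have h1 := hgv (y + e) (ζ y)
    rw [norm_add_sub_sq] at h1
    simp only [hg, hp, real_inner_smul_left] at *
    linarith
  -- Optimality of `ζ y` against `ζ y + t d`, combined with semiconvexity of `v`, is divided by `t`;
  -- letting `t → 0` leaves a supporting paraboloid of opening `-m`.
  have hvlow : ∀ y d, v (ζ y) + inner ℝ (p y) d - m / 2 * ‖d‖ ^ 2 ≤ v (ζ y + d) := by
    intro y d
    have key : 0 ≤ (v (ζ y + d) - v (ζ y) + m / 2 * ‖d‖ ^ 2 - inner ℝ (p y) d) := by
      refine nonneg_of_forall_add_mul_nonneg (b := (M - m) / 2 * ‖d‖ ^ 2) fun t ht0 ht1 => ?_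
      have h1 := supConv_lineMap_le hK hne hu m (ζ y) d ht0.le ht1.le
      have h2 := hζ y (ζ y + t • d)
      have h3 := norm_add_sub_sq (ζ y) (t • d) y
      rw [norm_sub_rev _ y, norm_sub_rev _ y, norm_smul, real_inner_smul_right, Real.norm_eq_abs,
        mul_pow, sq_abs, ← neg_sub y, inner_neg_left] at h3
      rw [h3] at h2
      simp only [hp, real_inner_smul_left]
      refine nonneg_of_mul_nonneg_right (b := _) ?_ ht0
      simp only [← hv] at *
      nlinarith
    linarith
  refine ⟨g, p, hfg, hup, fun y e => ?_, fun y => ?_, fun c z hc x => ?_⟩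
  · have h1 := hvlow y (ζ (y + e) - ζ y)
    rw [add_sub_cancel] at h1
    have h2 := harmonic_mul_norm_add_sq_le hl hM e (ζ (y + e) - ζ y - e)
    rw [add_sub_cancel, ← hm] at h2
    have h3 := norm_add_sq_real (y - ζ y) (-(ζ (y + e) - ζ y - e))
    rw [norm_neg, show y - ζ y + -(ζ (y + e) - ζ y - e) = y + e - ζ (y + e) by abel,
      inner_neg_right, inner_sub_right] at h3
    simp only [hg, hp, real_inner_smul_left] at *
    rw [h3]
    nlinarith
  -- The optimal paraboloid at `y` touches `f` at some `x`. If `x ≠ y`, then `g` agrees with this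
  -- paraboloid at both `x` and `y`. Since `g - M/2 ‖·‖²` is concave, as an infimum of affine
  -- functions, agreement extends to the whole segment.
  · obtain ⟨x, hx⟩ := hvf (ζ y)
    have hgx : g x = v (ζ y) + M / 2 * ‖x - ζ y‖ ^ 2 :=
      le_antisymm (hgv _ _) (hx.trans (hfg x))
    by_cases hxy : x = y
    · left
      rw [hxy] at hx
      exact le_antisymm (hfg y) hx
    · right
      refine ⟨x - y, sub_ne_zero.2 hxy, fun t ht0 ht1 => le_antisymm ?_ ?_⟩
      · have := hup y (t • (x - y))
        rw [norm_smul, real_inner_smul_right, Real.norm_eq_abs, mul_pow, sq_abs] at this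
        linarith
      · set z' := ζ (y + t • (x - y)) with hz'
        have h1 := mul_le_mul_of_nonneg_left (hgv y z') (sub_nonneg.2 ht1)
        have h2 := mul_le_mul_of_nonneg_left (hgv x z') ht0
        have h3 := norm_lineMap_sq (y - z') (x - y) t
        rw [show y - z' + t • (x - y) = y + t • (x - y) - z' by abel,
          show y - z' + (x - y) = x - z' by abel] at h3
        have h4 : g (y + t • (x - y)) = v z' + M / 2 * ‖y + t • (x - y) - z'‖ ^ 2 := rfl
        have h5 : g x = g y + inner ℝ (p y) (x - y) + M / 2 * ‖x - y‖ ^ 2 := by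
          have := norm_add_sub_sq y (x - y) (ζ y)
          rw [add_sub_cancel] at this
          rw [hgx, this]
          simp only [hg, hp, real_inner_smul_left]
          ring
        rw [h4, h3]
        rw [h5] at h2
        nlinarith
  · obtain ⟨x', hx'⟩ := hvf z
    have h1 := hc x'
    have h2 := hgv x z
    linarith

end SupConvolution

/-! ### Replacing one summand by its hull -/

section Sums

variable {E Z : Type*} [NormedAddCommGroup E] [InnerProductSpace ℝ E]
  [NormedAddCommGroup Z] [InnerProductSpace ℝ Z]

/-- The maximiser at `y` is a competitor at `y + e`, which yields a supporting paraboloid. -/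
theorem supConv_paraboloid_le {K : Set E} {u : E → ℝ} (hK : IsCompact K) (hne : K.Nonempty)
    (hu : UpperSemicontinuousOn u K) (l : ℝ) (y : E) :
    ∃ p : E, ∀ e, supConv K u l y + inner ℝ p e - l / 2 * ‖e‖ ^ 2 ≤ supConv K u l (y + e) := by
  obtain ⟨w, hw, he⟩ := exists_supConv_eq hK hne hu l y
  refine ⟨-(l • (y - w)), fun e => ?_⟩
  have h1 := le_supConv hK hu l (y + e) hw
  rw [norm_add_sub_sq] at h1
  rw [he, inner_neg_left, real_inner_smul_left]
  linarith

theorem le_of_forall_pos_le_add_mul {a b c : ℝ} (h : ∀ ε, 0 < ε → a ≤ b + ε * c) : a ≤ b := by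
  refine le_of_forall_pos_le_add fun ε hε => ?_
  have h1 := h (ε / (|c| + 1)) (by positivity)
  have h2 : ε / (|c| + 1) * c ≤ ε / (|c| + 1) * (|c| + 1) :=
    mul_le_mul_of_nonneg_left (by linarith [le_abs_self c]) (by positivity)
  rw [div_mul_cancel₀ _ (by positivity)] at h2
  linarith

/-- Second-order expansion along a line. -/
theorem taylor_second_order_line {g : E → ℝ} {p : E → E} {X : E →L[ℝ] E} {y : E}
    (hg : ∀ y, HasFDerivAt g (innerSL ℝ (p y)) y) (hp : HasFDerivAt p X y) {ε : ℝ} (hε : 0 < ε) :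
    ∀ᶠ d in 𝓝 (0 : E),
      |g (y + d) - g y - inner ℝ (p y) d - 1 / 2 * inner ℝ (X d) d| ≤ ε * ‖d‖ ^ 2 := by
  have h1 : HasFDerivAt (fun y => innerSL ℝ (p y))
      ((innerSL ℝ : E →L[ℝ] E →L[ℝ] ℝ).comp X) y :=
    (innerSL ℝ : E →L[ℝ] E →L[ℝ] ℝ).hasFDerivAt.comp y hp
  exact taylor_second_order (Eventually.of_forall hg) h1 hε

theorem inner_hessian_symm {g : E → ℝ} {p : E → E} {X : E →L[ℝ] E} {y : E}
    (hg : ∀ y, HasFDerivAt g (innerSL ℝ (p y)) y) (hp : HasFDerivAt p X y) (v w : E) :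
    inner ℝ (X v) w = inner ℝ (X w) v := by
  have h1 : HasFDerivAt (fun y => innerSL ℝ (p y))
      ((innerSL ℝ : E →L[ℝ] E →L[ℝ] ℝ).comp X) y :=
    (innerSL ℝ : E →L[ℝ] E →L[ℝ] ℝ).hasFDerivAt.comp y hp
  exact second_derivative_symmetric_of_eventually (Eventually.of_forall hg) h1 v w

theorem tendsto_smul_nhdsGT_zero (d : E) : Tendsto (fun t : ℝ => t • d) (𝓝[>] 0) (𝓝 0) := by
  have : Continuous fun t : ℝ => t • d := by fun_prop
  have h := this.tendsto 0
  rw [zero_smul] at h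
  exact h.mono_left nhdsWithin_le_nhds

/-- A uniform bound for the quadratic forms appearing when one variable is moved and the others
are frozen. -/
theorem exists_section_bound {ι : Type*} [Fintype ι] {w : ι → ℝ} (hw : ∀ i, 0 < w i)
    (π : ι → Z →L[ℝ] E) (σ : ι → E →L[ℝ] Z) (Q : Z →L[ℝ] Z) {l η : ℝ} (hl : 0 < l) (hη : 0 < η) :
    ∃ M, 0 < M ∧ ∀ i e, inner ℝ (Q (σ i e)) (σ i e) + η * ‖σ i e‖ ^ 2 +
      ∑ j, w j * (l * ‖π j (σ i e)‖ ^ 2) ≤ w i * (M * ‖e‖ ^ 2) := by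
  set B : ι → ℝ := fun i => (‖Q‖ * ‖σ i‖ ^ 2 + η * ‖σ i‖ ^ 2 +
    ∑ j, w j * (l * (‖π j‖ * ‖σ i‖) ^ 2)) / w i with hB
  have hw' : ∀ j, 0 ≤ w j := fun j => (hw j).le
  have hB0 : ∀ i, 0 ≤ B i := fun i => by
    have : 0 ≤ ∑ j, w j * (l * (‖π j‖ * ‖σ i‖) ^ 2) :=
      Finset.sum_nonneg fun j _ => by have := hw' j; positivity
    exact div_nonneg (by positivity) (hw' i)
  refine ⟨1 + ∑ i, B i, by have := Finset.sum_nonneg fun i (_ : i ∈ Finset.univ) => hB0 i; linarith,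
    fun i e => ?_⟩
  have h1 : ‖σ i e‖ ≤ ‖σ i‖ * ‖e‖ := (σ i).le_opNorm e
  have h1' : ‖σ i e‖ ^ 2 ≤ ‖σ i‖ ^ 2 * ‖e‖ ^ 2 := by
    rw [← mul_pow]; exact pow_le_pow_left₀ (norm_nonneg _) h1 2
  have h2 : inner ℝ (Q (σ i e)) (σ i e) ≤ ‖Q‖ * ‖σ i e‖ ^ 2 := by
    refine (real_inner_le_norm _ _).trans ?_
    rw [pow_two, ← mul_assoc]
    exact mul_le_mul_of_nonneg_right (Q.le_opNorm _) (norm_nonneg _)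
  have h3 : ‖Q‖ * ‖σ i e‖ ^ 2 ≤ ‖Q‖ * (‖σ i‖ ^ 2 * ‖e‖ ^ 2) :=
    mul_le_mul_of_nonneg_left h1' (norm_nonneg _)
  have h4 : η * ‖σ i e‖ ^ 2 ≤ η * (‖σ i‖ ^ 2 * ‖e‖ ^ 2) := mul_le_mul_of_nonneg_left h1' hη.le
  have h5 : ∑ j, w j * (l * ‖π j (σ i e)‖ ^ 2) ≤
      (∑ j, w j * (l * (‖π j‖ * ‖σ i‖) ^ 2)) * ‖e‖ ^ 2 := by
    rw [Finset.sum_mul]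
    refine Finset.sum_le_sum fun j _ => ?_
    rw [mul_assoc, mul_assoc, ← mul_pow]
    refine mul_le_mul_of_nonneg_left (mul_le_mul_of_nonneg_left
      (pow_le_pow_left₀ (norm_nonneg _) ?_ 2) hl.le) (hw' j)
    refine ((π j).le_opNorm _).trans ?_
    rw [mul_assoc]
    exact mul_le_mul_of_nonneg_left h1 (norm_nonneg _)
  have h6 : w i * B i = ‖Q‖ * ‖σ i‖ ^ 2 + η * ‖σ i‖ ^ 2 +
      ∑ j, w j * (l * (‖π j‖ * ‖σ i‖) ^ 2) := mul_div_cancel₀ _ (hw i).ne'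
  have h7 : B i ≤ 1 + ∑ i, B i := by
    have := Finset.single_le_sum (fun i _ => hB0 i) (Finset.mem_univ i)
    linarith
  have h8 : w i * (B i * ‖e‖ ^ 2) ≤ w i * ((1 + ∑ i, B i) * ‖e‖ ^ 2) :=
    mul_le_mul_of_nonneg_left (mul_le_mul_of_nonneg_right h7 (sq_nonneg _)) (hw' i)
  rw [← mul_assoc, h6] at h8
  linarith

/-- Replacing one summand by its semiconcave hull preserves an upper bound by a quadratic form. -/
theorem hull_le_of_sum_le [FiniteDimensional ℝ E] {ι : Type*} [Fintype ι] [DecidableEq ι]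
    {w : ι → ℝ} (hw : ∀ i, 0 < w i) (π : ι → Z →L[ℝ] E) (σ : ι → E →L[ℝ] Z)
    (hσ : ∀ i e, π i (σ i e) = e) (Q : Z →L[ℝ] Z)
    (hQ : ∀ x y, inner ℝ (Q x) y = inner ℝ x (Q y)) {l M ε : ℝ} (hM : 0 < M)
    {φ : ι → E → ℝ} (hφ : ∀ i y, ∃ p : E, ∀ e, φ i y + inner ℝ p e - l / 2 * ‖e‖ ^ 2 ≤ φ i (y + e))
    (i : ι) (hbound : ∀ e, inner ℝ (Q (σ i e)) (σ i e) +
      ∑ j ∈ Finset.univ.erase i, w j * (l * ‖π j (σ i e)‖ ^ 2) ≤ w i * (M * ‖e‖ ^ 2))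
    (hle : ∀ z, ∑ j, w j * φ j (π j z) ≤ 1 / 2 * inner ℝ (Q z) z + ε)
    {g : E → ℝ} (hg : ∀ c z, (∀ x, φ i x ≤ c + M / 2 * ‖x - z‖ ^ 2) →
        ∀ x, g x ≤ c + M / 2 * ‖x - z‖ ^ 2) (z : Z) :
    w i * g (π i z) + ∑ j ∈ Finset.univ.erase i, w j * φ j (π j z) ≤
      1 / 2 * inner ℝ (Q z) z + ε := by
  have hwi := hw i
  choose p hp using hφ
  set rest := ∑ j ∈ Finset.univ.erase i, w j * φ j (π j z) with hrest
  -- The linear part of the slack when `z` moves along the section by `e`: the gradient of the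
  -- quadratic form minus the slopes of the paraboloids supporting the frozen summands. Riesz
  -- representation writes it as `w i ⟪b, e⟫`.
  set L : E →L[ℝ] ℝ := (innerSL ℝ (Q z)).comp (σ i) -
    ∑ j ∈ Finset.univ.erase i, w j • (innerSL ℝ (p j (π j z))).comp ((π j).comp (σ i)) with hL
  have hLe : ∀ e, L e = inner ℝ (Q z) (σ i e) -
      ∑ j ∈ Finset.univ.erase i, w j * inner ℝ (p j (π j z)) (π j (σ i e)) := by
    intro e
    simp [hL]
  have := FiniteDimensional.complete ℝ E
  obtain ⟨b, hb⟩ : ∃ b, ∀ e, L e = w i * inner ℝ b e := by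
    refine ⟨(w i)⁻¹ • (InnerProductSpace.toDual ℝ E).symm L, fun e => ?_⟩
    rw [real_inner_smul_left, ← mul_assoc, mul_inv_cancel₀ hwi.ne', one_mul]
    simp
  -- With the other summands bounded below by their supporting paraboloids, the bound on the sum
  -- becomes a bound on `φ i` by one paraboloid of opening `M`. Completing the square gives its
  -- centre and height, and the hull inherits the bound.
  have key : ∀ x, φ i x ≤ ((1 / 2 * inner ℝ (Q z) z + ε - rest) / w i - 1 / (2 * M) * ‖b‖ ^ 2) +
      M / 2 * ‖x - (π i z - M⁻¹ • b)‖ ^ 2 := by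
    intro x
    set e := x - π i z with he
    have h1 := hle (z + σ i e)
    rw [← Finset.add_sum_erase _ _ (Finset.mem_univ i), map_add, hσ, he, add_sub_cancel, ← he] at h1
    have h2 : rest + ∑ j ∈ Finset.univ.erase i, w j * inner ℝ (p j (π j z)) (π j (σ i e)) -
        1 / 2 * ∑ j ∈ Finset.univ.erase i, w j * (l * ‖π j (σ i e)‖ ^ 2) ≤
        ∑ j ∈ Finset.univ.erase i, w j * φ j (π j (z + σ i e)) := by
      rw [hrest, Finset.mul_sum, ← Finset.sum_add_distrib, ← Finset.sum_sub_distrib]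
      refine Finset.sum_le_sum fun j _ => ?_
      have := mul_le_mul_of_nonneg_left (hp j (π j z) (π j (σ i e))) (hw j).le
      rw [map_add]
      linarith
    have h3 : inner ℝ (Q (z + σ i e)) (z + σ i e) = inner ℝ (Q z) z + 2 * inner ℝ (Q z) (σ i e) +
        inner ℝ (Q (σ i e)) (σ i e) := by
      rw [map_add, inner_add_left, inner_add_right, inner_add_right, hQ (σ i e) z,
        real_inner_comm (Q z) (σ i e)]
      ring
    have h4 := hbound e
    have h5 := hLe e
    rw [hb] at h5
    have h6 : ‖x - (π i z - M⁻¹ • b)‖ ^ 2 = ‖e‖ ^ 2 + 2 * (M⁻¹ * inner ℝ b e) +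
        (M⁻¹) ^ 2 * ‖b‖ ^ 2 := by
      rw [show x - (π i z - M⁻¹ • b) = e + M⁻¹ • b by rw [he]; abel, norm_add_sq_real,
        real_inner_smul_right, norm_smul, mul_pow, Real.norm_eq_abs, sq_abs, real_inner_comm]
    have h7 : w i * φ i x ≤ (1 / 2 * inner ℝ (Q z) z + ε - rest) + w i * inner ℝ b e +
        w i * (M / 2 * ‖e‖ ^ 2) := by linarith
    have h8 : φ i x ≤ ((1 / 2 * inner ℝ (Q z) z + ε - rest) + w i * inner ℝ b e +
        w i * (M / 2 * ‖e‖ ^ 2)) / w i := by rwa [le_div_iff₀ hwi, mul_comm]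
    refine h8.trans (le_of_eq ?_)
    rw [h6]
    field_simp
    ring
  have h1 := hg _ _ key (π i z)
  rw [sub_sub_cancel, norm_smul, mul_pow, Real.norm_eq_abs, sq_abs] at h1
  have h2 : (1 / 2 * inner ℝ (Q z) z + ε - rest) / w i - 1 / (2 * M) * ‖b‖ ^ 2 +
      M / 2 * (M⁻¹ ^ 2 * ‖b‖ ^ 2) = (1 / 2 * inner ℝ (Q z) z + ε - rest) / w i := by
    field_simp
    ring
  rw [h2, le_div_iff₀ hwi] at h1
  linarith

end Sums

/-! ### The theorem on sums along linear projections -/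

section Sums

variable {E Z : Type*} [NormedAddCommGroup E] [InnerProductSpace ℝ E]
  [NormedAddCommGroup Z] [InnerProductSpace ℝ Z]

/-- Induction on the set of summands already replaced. The step is `hull_le_of_sum_le`, which needs
only supporting paraboloids of opening `-l` for the other summands; both the sup-convolutions and
their hulls have these. -/
theorem sum_hull_le [FiniteDimensional ℝ E] {ι : Type*} [Fintype ι]
    {w : ι → ℝ} (hw : ∀ i, 0 < w i) (π : ι → Z →L[ℝ] E) (σ : ι → E →L[ℝ] Z)
    (hσ : ∀ i e, π i (σ i e) = e) (Q : Z →L[ℝ] Z)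
    (hQ : ∀ x y, inner ℝ (Q x) y = inner ℝ x (Q y)) {l M ε : ℝ} (hl : 0 < l) (hM : 0 < M)
    (hbound : ∀ i e, inner ℝ (Q (σ i e)) (σ i e) +
      ∑ j, w j * (l * ‖π j (σ i e)‖ ^ 2) ≤ w i * (M * ‖e‖ ^ 2))
    {f g : ι → E → ℝ}
    (hf : ∀ i y, ∃ p : E, ∀ e, f i y + inner ℝ p e - l / 2 * ‖e‖ ^ 2 ≤ f i (y + e))
    (hg : ∀ i y, ∃ p : E, ∀ e, g i y + inner ℝ p e - l / 2 * ‖e‖ ^ 2 ≤ g i (y + e))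
    (hfg : ∀ i c z, (∀ x, f i x ≤ c + M / 2 * ‖x - z‖ ^ 2) →
        ∀ x, g i x ≤ c + M / 2 * ‖x - z‖ ^ 2)
    (hle : ∀ z, ∑ j, w j * f j (π j z) ≤ 1 / 2 * inner ℝ (Q z) z + ε) (z : Z) :
    ∑ j, w j * g j (π j z) ≤ 1 / 2 * inner ℝ (Q z) z + ε := by
  classical
  have key : ∀ S : Finset ι, ∀ z, ∑ j, w j * (if j ∈ S then g j else f j) (π j z) ≤
      1 / 2 * inner ℝ (Q z) z + ε := by
    intro S
    induction S using Finset.induction_on with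
    | empty => simpa using hle
    | insert i S hi ih =>
      intro z
      have h1 := hull_le_of_sum_le hw π σ hσ Q hQ hM (l := l)
        (φ := fun j => if j ∈ S then g j else f j)
        (fun j y => by
          by_cases hj : j ∈ S
          · simpa only [if_pos hj] using hg j y
          · simpa only [if_neg hj] using hf j y) i
        (fun e => by
          refine le_trans ?_ (hbound i e)
          have : ∑ j ∈ Finset.univ.erase i, w j * (l * ‖π j (σ i e)‖ ^ 2) ≤
              ∑ j, w j * (l * ‖π j (σ i e)‖ ^ 2) :=
            Finset.sum_le_sum_of_subset_of_nonneg (Finset.erase_subset _ _) fun j _ _ => by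
              have := (hw j).le
              positivity
          linarith) ih (g := g i) (by simpa only [if_neg hi] using hfg i) z
      refine le_trans (le_of_eq ?_) h1
      rw [← Finset.add_sum_erase _ _ (Finset.mem_univ i)]
      congr 1
      · simp
      · refine Finset.sum_congr rfl fun j hj => ?_
        simp [Finset.mem_insert, Finset.ne_of_mem_erase hj]
  simpa using key Finset.univ z

/-- Quantitative theorem on sums for functions composed with linear projections. If the weighted
sum of sup-convolutions lies below a quadratic form up to a small error, then near the origin there
are second-order superjets of the original functions whose gradients and Hessians are compatible
with that quadratic form. -/
theorem exists_superjets_of_sum_supConv_le [FiniteDimensional ℝ E] [FiniteDimensional ℝ Z]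
    {ι : Type*} [Fintype ι]
    {w : ι → ℝ} (hw : ∀ i, 0 < w i) (π : ι → Z →L[ℝ] E) (σ : ι → E →L[ℝ] Z)
    (hσ : ∀ i e, π i (σ i e) = e) (Q : Z →L[ℝ] Z)
    (hQ : ∀ x y, inner ℝ (Q x) y = inner ℝ x (Q y)) {K : ι → Set E} {u : ι → E → ℝ}
    (hK : ∀ i, IsCompact (K i)) (hne : ∀ i, (K i).Nonempty)
    (hu : ∀ i, UpperSemicontinuousOn (u i) (K i))
    {l η R ε δ : ℝ} (hl : 0 < l) (hη : 0 < η) (hR : 0 < R) (hδ : 0 < δ) (hε : ε < η / 2 * R ^ 2)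
    (hle : ∀ z, ∑ j, w j * supConv (K j) (u j) l (π j z) ≤ 1 / 2 * inner ℝ (Q z) z + ε)
    (h0 : 0 ≤ ∑ j, w j * supConv (K j) (u j) l 0) :
    ∃ (z : Z) (h P : ι → E) (X : ι → E →L[ℝ] E), ‖z‖ < R ∧
      1 / 2 * inner ℝ (Q z) z - δ ≤ ∑ j, w j * supConv (K j) (u j) l (π j z) ∧
      (∀ i, h i ∈ K i ∧
        supConv (K i) (u i) l (π i z) = u i (h i) - l / 2 * ‖π i z - h i‖ ^ 2) ∧
      (∀ i c, 0 < c → ∀ᶠ d in 𝓝 (0 : E), h i + d ∈ K i →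
        u i (h i + d) ≤ u i (h i) + inner ℝ (P i) d + 1 / 2 * inner ℝ (X i d) d + c * ‖d‖ ^ 2) ∧
      (∀ i d e, inner ℝ (X i d) e = inner ℝ (X i e) d) ∧
      (∀ d, |∑ j, w j * inner ℝ (P j) (π j d) - inner ℝ (Q z) d - η * inner ℝ z d| ≤ δ * ‖d‖) ∧
      (∀ d, ∑ j, w j * inner ℝ (X j (π j d)) (π j d) ≤ inner ℝ (Q d) d + η * ‖d‖ ^ 2) ∧
      ∀ i d, -(l * ‖d‖ ^ 2) ≤ inner ℝ (X i d) d := by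
  have := FiniteDimensional.complete ℝ E
  have := FiniteDimensional.complete ℝ Z
  have hw' : ∀ j, 0 ≤ w j := fun j => (hw j).le
  obtain ⟨M₀, hM₀, hbound⟩ := exists_section_bound hw π σ Q hl hη
  -- Strictly larger than the bound available along sections, so that a second derivative equal to
  -- `M` contradicts the Hessian inequality.
  set M := M₀ + 1 with hM
  have hMpos : 0 < M := by positivity
  choose g p hfg hup hlow hcontact hhull using
    fun i => exists_semiconcave_hull (hK i) (hne i) (hu i) hl hMpos
  have hgz : ∀ z, ∑ j, w j * g j (π j z) ≤ 1 / 2 * inner ℝ (Q z) z + ε := by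
    refine sum_hull_le hw π σ hσ Q hQ hl hMpos (fun i e => ?_)
      (fun i y => supConv_paraboloid_le (hK i) (hne i) (hu i) l y)
      (fun i y => ⟨p i y, hlow i y⟩) hhull hle
    have h1 := hbound i e
    have h2 : w i * (M * ‖e‖ ^ 2) = w i * (M₀ * ‖e‖ ^ 2) + w i * ‖e‖ ^ 2 := by rw [hM]; ring
    have h3 : 0 ≤ w i * ‖e‖ ^ 2 := mul_nonneg (hw' i) (sq_nonneg _)
    have h4 : 0 ≤ η * ‖σ i e‖ ^ 2 := by positivity
    linarith
  have hgp : ∀ i y e, |g i (y + e) - g i y - inner ℝ (p i y) e| ≤ (M + l) / 2 * ‖e‖ ^ 2 := by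
    intro i y e
    have h1 := hup i y e
    have h2 := hlow i y e
    have h3 : 0 ≤ l * ‖e‖ ^ 2 := by positivity
    have h4 : 0 ≤ M * ‖e‖ ^ 2 := by positivity
    rw [abs_le]
    constructor <;> linarith
  have hgd : ∀ i y, HasFDerivAt (g i) (innerSL ℝ (p i y)) y := fun i y =>
    hasFDerivAt_of_paraboloids (hgp i y)
  have hpl : ∀ i, LipschitzWith (Real.toNNReal (6 * ((M + l) / 2))) (p i) := fun i =>
    lipschitzWith_of_paraboloids (by positivity) (hgp i)
  set H : Z → ℝ := fun z => ∑ j, w j * g j (π j z) - 1 / 2 * inner ℝ (Q z) z - η / 2 * ‖z‖ ^ 2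
    with hH
  set G : Z → Z := fun z => ∑ j, w j • (π j).adjoint (p j (π j z)) - Q z - η • z with hG
  have hGin : ∀ z d, inner ℝ (G z) d =
      ∑ j, w j * inner ℝ (p j (π j z)) (π j d) - inner ℝ (Q z) d - η * inner ℝ z d := by
    intro z d
    simp only [hG, inner_sub_left, sum_inner, real_inner_smul_left,
      ContinuousLinearMap.adjoint_inner_left]
  have hexp : ∀ z d, H (z + d) - H z - inner ℝ (G z) d =
      ∑ j, w j * (g j (π j z + π j d) - g j (π j z) - inner ℝ (p j (π j z)) (π j d)) -
        1 / 2 * inner ℝ (Q d) d - η / 2 * ‖d‖ ^ 2 := by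
    intro z d
    have h1 : inner ℝ (Q (z + d)) (z + d) = inner ℝ (Q z) z + 2 * inner ℝ (Q z) d +
        inner ℝ (Q d) d := by
      rw [map_add, inner_add_left, inner_add_right, inner_add_right, hQ d z,
        real_inner_comm (Q z) d]
      ring
    simp only [hGin, hH]
    rw [h1]
    simp only [norm_add_sq_real, map_add, mul_sub, Finset.sum_sub_distrib]
    ring
  set C : ℝ := ∑ j, w j * ((M + l) / 2 * ‖π j‖ ^ 2) + 1 / 2 * ‖Q‖ + η / 2 with hC
  have hC0 : 0 ≤ C := by
    have : 0 ≤ ∑ j, w j * ((M + l) / 2 * ‖π j‖ ^ 2) :=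
      Finset.sum_nonneg fun j _ => by have := hw' j; positivity
    positivity
  have hHp : ∀ z d, |H (z + d) - H z - inner ℝ (G z) d| ≤ C * ‖d‖ ^ 2 := by
    intro z d
    rw [hexp]
    have h1 : |∑ j, w j * (g j (π j z + π j d) - g j (π j z) - inner ℝ (p j (π j z)) (π j d))| ≤
        (∑ j, w j * ((M + l) / 2 * ‖π j‖ ^ 2)) * ‖d‖ ^ 2 := by
      rw [Finset.sum_mul]
      refine (Finset.abs_sum_le_sum_abs _ _).trans (Finset.sum_le_sum fun j _ => ?_)
      rw [abs_mul, abs_of_pos (hw j), mul_assoc, mul_assoc, ← mul_pow]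
      refine mul_le_mul_of_nonneg_left ((hgp j _ _).trans ?_) (hw' j)
      exact mul_le_mul_of_nonneg_left
        (pow_le_pow_left₀ (norm_nonneg _) ((π j).le_opNorm d) 2) (by positivity)
    have h2 : |inner ℝ (Q d) d| ≤ ‖Q‖ * ‖d‖ ^ 2 := by
      refine (abs_real_inner_le_norm _ _).trans ?_
      rw [pow_two, ← mul_assoc]
      exact mul_le_mul_of_nonneg_right (Q.le_opNorm _) (norm_nonneg _)
    have h3 : 0 ≤ η * ‖d‖ ^ 2 := by positivity
    rw [abs_le] at h1 h2 ⊢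
    rw [hC]
    constructor <;> nlinarith
  borelize Z
  set N : Set Z := {z | ∃ i, ¬ DifferentiableAt ℝ (fun z => p i (π i z)) z} with hN
  have hN0 : MeasureTheory.Measure.hausdorffMeasure (Module.finrank ℝ Z) N = 0 := by
    have := MeasureTheory.isAddHaarMeasure_hausdorffMeasure (E := Z)
    have h1 : ∀ i, ∀ᵐ z ∂(MeasureTheory.Measure.hausdorffMeasure (Module.finrank ℝ Z) :
        MeasureTheory.Measure Z), DifferentiableAt ℝ (fun z => p i (π i z)) z := fun i =>
      ((hpl i).comp (π i).lipschitz).ae_differentiableAt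
    have h2 := MeasureTheory.ae_all_iff.2 h1
    rw [MeasureTheory.ae_iff] at h2
    simpa only [not_forall] using h2
  have hH0 : 0 ≤ H 0 := by
    have : ∑ j, w j * supConv (K j) (u j) l 0 ≤ ∑ j, w j * g j 0 :=
      Finset.sum_le_sum fun j _ => mul_le_mul_of_nonneg_left (hfg j 0) (hw' j)
    simp only [hH, map_zero, inner_zero_left, norm_zero]
    linarith
  -- The term `-η/2 ‖z‖²` makes `H` smaller on the sphere of radius `R` than at the origin. The
  -- slope bound `δ` controls the gradient error, and `δ / R` controls the value error `⟪q, z⟫`.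
  obtain ⟨z, hzN, hzR, q, hq, hmax, hHz⟩ := exists_isLocalMax_notMem_null
    (fun z => hasFDerivAt_of_paraboloids (hHp z)) (lipschitzWith_of_paraboloids hC0 hHp) hR
    (β := η / 2 * R ^ 2 - ε) (sub_pos.2 hε) (ε := min δ (δ / R)) (by positivity)
    (fun z hz => by
      have := hgz z
      simp only [hH] at hH0 ⊢
      rw [hz]
      linarith) hN0
  have hGq : G z = q := by
    have hfd : HasFDerivAt (fun z' => H z' - inner ℝ q z') (innerSL ℝ (G z) - innerSL ℝ q) z :=
      (hasFDerivAt_of_paraboloids (hHp z)).sub (innerSL ℝ q).hasFDerivAt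
    have := hmax.hasFDerivAt_eq_zero hfd
    rw [← map_sub] at this
    have h5 := congrArg (fun l : Z →L[ℝ] ℝ => l (G z - q)) this
    simp only [innerSL_apply_apply, real_inner_self_eq_norm_sq, zero_apply] at h5
    exact sub_eq_zero.1 (norm_eq_zero.1 (pow_eq_zero_iff two_ne_zero |>.1 h5))
  -- The null set was taken in the product space for `p i ∘ π i`. Restricting to the affine section
  -- through `z` recovers differentiability of `p i` itself at `π i z`.
  have hdiff : ∀ i, ∃ X : E →L[ℝ] E, HasFDerivAt (p i) X (π i z) := by
    intro i
    have h1 : DifferentiableAt ℝ (fun z => p i (π i z)) z := by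
      by_contra h
      exact hzN ⟨i, h⟩
    have h2 : HasFDerivAt (fun e => z + σ i (e - π i z)) (σ i) (π i z) := by
      have := ((σ i).hasFDerivAt.comp (π i z) ((hasFDerivAt_id _).sub_const (π i z))).const_add z
      exact this.congr_fderiv (by ext; simp)
    have h3 : HasFDerivAt (fun z => p i (π i z)) (fderiv ℝ (fun z => p i (π i z)) z)
        (z + σ i (π i z - π i z)) := by simpa using h1.hasFDerivAt
    refine ⟨_, (h3.comp (π i z) h2).congr_of_eventuallyEq (Eventually.of_forall fun e => ?_)⟩
    simp [hσ]
  choose X hX using hdiff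
  have hline : ∀ i e c, 0 < c → ∀ᶠ t in 𝓝[>] (0 : ℝ),
      |g i (π i z + t • e) - g i (π i z) - t * inner ℝ (p i (π i z)) e -
        t ^ 2 * (1 / 2 * inner ℝ (X i e) e)| ≤ t ^ 2 * (c * ‖e‖ ^ 2) := by
    intro i e c hc
    filter_upwards [(tendsto_smul_nhdsGT_zero e).eventually
      (taylor_second_order_line (hgd i) (hX i) hc)] with t ht
    rw [map_smul, norm_smul, real_inner_smul_left, real_inner_smul_right, real_inner_smul_right,
      mul_pow, Real.norm_eq_abs, sq_abs] at ht
    rw [show t ^ 2 * (1 / 2 * inner ℝ (X i e) e) = 1 / 2 * (t * (t * inner ℝ (X i e) e)) by ring,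
      show t ^ 2 * (c * ‖e‖ ^ 2) = c * (t ^ 2 * ‖e‖ ^ 2) by ring]
    exact ht
  have hXlow : ∀ i d, -(l * ‖d‖ ^ 2) ≤ inner ℝ (X i d) d := by
    intro i d
    refine le_of_forall_pos_le_add_mul (c := 2 * ‖d‖ ^ 2) fun c hc => ?_
    obtain ⟨t, ht, ht0⟩ := ((hline i d c hc).and self_mem_nhdsWithin).exists
    have h1 := (abs_le.1 ht).2
    have h2 := hlow i (π i z) (t • d)
    rw [norm_smul, real_inner_smul_right, mul_pow, Real.norm_eq_abs, sq_abs] at h2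
    have h3 : 0 < t ^ 2 := pow_pos ht0 2
    have h4 : t ^ 2 * (-(l * ‖d‖ ^ 2)) ≤ t ^ 2 * (inner ℝ (X i d) d + c * (2 * ‖d‖ ^ 2)) := by
      linarith
    exact le_of_mul_le_mul_left h4 h3
  have hXup : ∀ d, ∑ j, w j * inner ℝ (X j (π j d)) (π j d) ≤ inner ℝ (Q d) d + η * ‖d‖ ^ 2 := by
    intro d
    refine le_of_forall_pos_le_add_mul (c := 2 * ∑ j, w j * ‖π j d‖ ^ 2) fun c hc => ?_
    have hmax' : ∀ᶠ t in 𝓝[>] (0 : ℝ), H (z + t • d) - inner ℝ q (z + t • d) ≤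
        H z - inner ℝ q z := by
      have h1 : Tendsto (fun t : ℝ => z + t • d) (𝓝[>] 0) (𝓝 z) := by
        simpa using (tendsto_smul_nhdsGT_zero d).const_add z
      exact h1.eventually hmax
    obtain ⟨t, ⟨ht2, ht1⟩, ht0⟩ := ((hmax'.and (eventually_all.2 fun i =>
      hline i (π i d) c hc)).and self_mem_nhdsWithin).exists
    have h1 := hexp z (t • d)
    simp only [map_smul, norm_smul, real_inner_smul_left, real_inner_smul_right, mul_pow,
      Real.norm_eq_abs, sq_abs] at h1
    rw [inner_add_right, real_inner_smul_right, ← hGq] at ht2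
    have h2 : ∑ j, w j * (t ^ 2 * (1 / 2 * inner ℝ (X j (π j d)) (π j d)) -
        t ^ 2 * (c * ‖π j d‖ ^ 2)) ≤ ∑ j, w j * (g j (π j z + t • π j d) - g j (π j z) -
          t * inner ℝ (p j (π j z)) (π j d)) := by
      refine Finset.sum_le_sum fun j _ => mul_le_mul_of_nonneg_left ?_ (hw' j)
      have := (abs_le.1 (ht1 j)).1
      linarith
    have h3 : ∑ j, w j * (t ^ 2 * (1 / 2 * inner ℝ (X j (π j d)) (π j d)) -
        t ^ 2 * (c * ‖π j d‖ ^ 2)) = t ^ 2 * (1 / 2 * ∑ j, w j * inner ℝ (X j (π j d)) (π j d) -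
          c * ∑ j, w j * ‖π j d‖ ^ 2) := by
      simp only [Finset.mul_sum, mul_sub, Finset.sum_sub_distrib]
      congr 1 <;> exact Finset.sum_congr rfl fun j _ => by ring
    rw [h3] at h2
    have h4 : 0 < t ^ 2 := pow_pos ht0 2
    refine le_of_mul_le_mul_left ?_ h4
    linarith
  -- Without contact, `X i` has quadratic form at least `M ‖e‖²` for some `e ≠ 0`. The Hessian
  -- inequality on `σ i e`, with the other blocks bounded below by `-l`, allows at most `M₀ ‖e‖²`.
  have hcon : ∀ i, supConv (K i) (u i) l (π i z) = g i (π i z) := by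
    intro i
    refine (hcontact i (π i z)).resolve_right ?_
    rintro ⟨e, he, hpar⟩
    have he0 : 0 < ‖e‖ ^ 2 := by positivity
    have h1 : M * ‖e‖ ^ 2 ≤ inner ℝ (X i e) e := by
      refine le_of_forall_pos_le_add_mul (c := 2 * ‖e‖ ^ 2) fun c hc => ?_
      have hlt : ∀ᶠ t in 𝓝[>] (0 : ℝ), t ≤ 1 :=
        nhdsWithin_le_nhds (eventually_le_nhds one_pos)
      obtain ⟨t, ⟨ht, ht1⟩, ht0⟩ :=
        (((hline i e c hc).and hlt).and self_mem_nhdsWithin).exists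
      rw [hpar t (le_of_lt ht0) ht1] at ht
      have h2 := (abs_le.1 ht).2
      refine le_of_mul_le_mul_left ?_ (pow_pos ht0 2)
      linarith
    have h2 := hXup (σ i e)
    have h3 := hbound i e
    classical
    rw [← Finset.add_sum_erase _ _ (Finset.mem_univ i), hσ] at h2
    have h4 : -∑ j, w j * (l * ‖π j (σ i e)‖ ^ 2) ≤
        ∑ j ∈ Finset.univ.erase i, w j * inner ℝ (X j (π j (σ i e))) (π j (σ i e)) := by
      have h5 : ∑ j ∈ Finset.univ.erase i, w j * (l * ‖π j (σ i e)‖ ^ 2) ≤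
          ∑ j, w j * (l * ‖π j (σ i e)‖ ^ 2) :=
        Finset.sum_le_sum_of_subset_of_nonneg (Finset.erase_subset _ _) fun j _ _ => by
          have := hw' j
          positivity
      have h6 : -∑ j ∈ Finset.univ.erase i, w j * (l * ‖π j (σ i e)‖ ^ 2) ≤
          ∑ j ∈ Finset.univ.erase i, w j * inner ℝ (X j (π j (σ i e))) (π j (σ i e)) := by
        rw [← Finset.sum_neg_distrib]
        refine Finset.sum_le_sum fun j _ => ?_
        have := mul_le_mul_of_nonneg_left (hXlow j (π j (σ i e))) (hw' j)
        linarith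
      linarith
    have h5 : w i * inner ℝ (X i e) e ≤ w i * (M₀ * ‖e‖ ^ 2) := by linarith
    have h6 := le_of_mul_le_mul_left h5 (hw i)
    rw [hM] at h1
    linarith
  choose h hhK hhe using fun i => exists_supConv_eq (hK i) (hne i) (hu i) l (π i z)
  refine ⟨z, h, fun i => p i (π i z), X, hzR, ?_, fun i => ⟨hhK i, hhe i⟩, fun i c hc => ?_,
    fun i d e => inner_hessian_symm (hgd i) (hX i) d e, fun d => ?_, hXup, hXlow⟩
  · have h1 : |inner ℝ q z| ≤ δ := by
      refine (abs_real_inner_le_norm _ _).trans ?_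
      calc ‖q‖ * ‖z‖ ≤ (δ / R) * R := mul_le_mul (hq.trans (min_le_right _ _)) hzR.le
            (norm_nonneg _) (by positivity)
        _ = δ := by field_simp
    have h2 := (abs_le.1 h1).1
    simp only [hcon]
    simp only [hH] at hHz hH0
    have h3 : 0 ≤ η / 2 * ‖z‖ ^ 2 := by positivity
    linarith
  -- The maximiser `h i`, translated by `d`, competes in the sup-convolution at `π i z + d` with
  -- unchanged kernel. Hence the jet of the hull at `π i z` is a superjet of `u i` at `h i`.
  · filter_upwards [taylor_second_order_line (hgd i) (hX i) hc] with d hd hdK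
    have h1 := (abs_le.1 hd).2
    have h2 := le_supConv (hK i) (hu i) l (π i z + d) hdK
    rw [add_sub_add_right_eq_sub] at h2
    have h3 := hfg i (π i z + d)
    have h4 := hhe i
    rw [hcon] at h4
    linarith
  · rw [← hGin, hGq]
    refine (abs_real_inner_le_norm _ _).trans ?_
    exact mul_le_mul_of_nonneg_right (hq.trans (min_le_left _ _)) (norm_nonneg _)

end Sums

/-! ### Linear algebra of a shared time variable and the time penalty -/

section CommonTime

variable {S : Type*} [NormedAddCommGroup S] [InnerProductSpace ℝ S] [FiniteDimensional ℝ S]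
  {ι : Type*} [Fintype ι]

/-- The map `(k, s) ↦ (kᵢ, c s)`. -/
def projCLM (i : ι) (c : ℝ) :
    WithLp 2 (PiLp 2 (fun _ : ι => S) × ℝ) →L[ℝ] WithLp 2 (S × ℝ) :=
  LinearMap.toContinuousLinearMap
    { toFun := fun z => WithLp.toLp 2 (z.fst i, c * z.snd)
      map_add' := fun x y => by
        apply (WithLp.equiv 2 _).injective
        simp [mul_add]
      map_smul' := fun a x => by
        apply (WithLp.equiv 2 _).injective
        simp
        ring }

theorem projCLM_apply (i : ι) (c : ℝ) (z : WithLp 2 (PiLp 2 (fun _ : ι => S) × ℝ)) :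
    projCLM i c z = WithLp.toLp 2 (z.fst i, c * z.snd) := rfl

/-- The map `(h, s) ↦ (h eᵢ, c s)`. -/
def sectionCLM [DecidableEq ι] (i : ι) (c : ℝ) :
    WithLp 2 (S × ℝ) →L[ℝ] WithLp 2 (PiLp 2 (fun _ : ι => S) × ℝ) :=
  LinearMap.toContinuousLinearMap
    { toFun := fun e => WithLp.toLp 2 (WithLp.toLp 2 (Pi.single i e.fst), c * e.snd)
      map_add' := fun x y => by
        apply (WithLp.equiv 2 _).injective
        simp [mul_add, Pi.single_add]
      map_smul' := fun a x => by
        apply (WithLp.equiv 2 _).injective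
        simp [Pi.single_smul]
        ring }

theorem projCLM_sectionCLM [DecidableEq ι] (i : ι) {c : ℝ} (hc : c ≠ 0) (e : WithLp 2 (S × ℝ)) :
    projCLM i c⁻¹ (sectionCLM i c e) = e := by
  simp [projCLM_apply, sectionCLM, hc]
  rfl

/-- The operator of the quadratic form `⟪B k̄, k̄⟫ + C s²` with `k̄ = ∑ wⱼ kⱼ`. -/
def meanFormCLM (w : ι → ℝ) (B : S →L[ℝ] S) (C : ℝ) :
    WithLp 2 (PiLp 2 (fun _ : ι => S) × ℝ) →L[ℝ] WithLp 2 (PiLp 2 (fun _ : ι => S) × ℝ) :=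
  LinearMap.toContinuousLinearMap
    { toFun := fun z => WithLp.toLp 2 (WithLp.toLp 2 (fun i => w i • B (∑ j, w j • z.fst j)),
        C * z.snd)
      map_add' := fun x y => by
        apply (WithLp.equiv 2 _).injective
        simp [mul_add, Finset.sum_add_distrib]
        ext
        simp
      map_smul' := fun a x => by
        have h : ∑ j, w j • (a • x).fst j = a • ∑ j, w j • x.fst j := by
          rw [Finset.smul_sum]
          exact Finset.sum_congr rfl fun j _ => smul_comm _ _ _
        apply (WithLp.equiv 2 _).injective
        rw [h]
        refine Prod.ext ?_ ?_
        · ext i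
          rw [map_smul]
          exact smul_comm (w i) a _
        · simp
          ring }

theorem inner_meanFormCLM (w : ι → ℝ) (B : S →L[ℝ] S) (C : ℝ)
    (x y : WithLp 2 (PiLp 2 (fun _ : ι => S) × ℝ)) :
    inner ℝ (meanFormCLM w B C x) y =
      inner ℝ (B (∑ j, w j • x.fst j)) (∑ j, w j • y.fst j) + C * (x.snd * y.snd) := by
  simp [meanFormCLM, WithLp.prod_inner_apply, PiLp.inner_apply, inner_sum, real_inner_smul_left,
    real_inner_smul_right]
  ring

omit [FiniteDimensional ℝ S] in
theorem norm_sum_smul_sq_le {w : ι → ℝ} (hw : ∀ i, 0 ≤ w i) (hsum : ∑ i, w i = 1) (d : ι → S) :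
    ‖∑ i, w i • d i‖ ^ 2 ≤ ∑ i, w i * ‖d i‖ ^ 2 := by
  have h1 : ‖∑ i, w i • d i‖ ≤ ∑ i, w i * ‖d i‖ := by
    refine (norm_sum_le _ _).trans (Finset.sum_le_sum fun i _ => ?_)
    rw [norm_smul, Real.norm_eq_abs, abs_of_nonneg (hw i)]
  exact (pow_le_pow_left₀ (norm_nonneg _) h1 2).trans
    (Real.pow_arith_mean_le_arith_mean_pow _ _ _ (fun i _ => hw i) hsum
      (fun i _ => norm_nonneg _) 2)

omit [FiniteDimensional ℝ S] in
theorem abs_inner_apply_self_le (B : S →L[ℝ] S) (x : S) : |inner ℝ (B x) x| ≤ ‖B‖ * ‖x‖ ^ 2 := by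
  refine (abs_real_inner_le_norm _ _).trans ?_
  rw [pow_two, ← mul_assoc]
  exact mul_le_mul_of_nonneg_right (B.le_opNorm _) (norm_nonneg _)

omit [FiniteDimensional ℝ S] in
-- Writing the mean of the `hᵢ` as the mean of the `kᵢ` plus an error, the cross term is absorbed by
-- Young's inequality. The summand `2` in the constant leaves the extra `∑ wᵢ ‖kᵢ - hᵢ‖²` on the
-- left, which later forces the maximisers to be near their centres.
theorem mean_form_split {w : ι → ℝ} (hw : ∀ i, 0 ≤ w i) (hsum : ∑ i, w i = 1) {B : S →L[ℝ] S}
    (hB : ∀ x y, inner ℝ (B x) y = inner ℝ x (B y)) {η : ℝ} (hη : 0 < η) (h k : ι → S) :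
    1 / 2 * inner ℝ (B (∑ i, w i • h i)) (∑ i, w i • h i) + ∑ i, w i * ‖k i - h i‖ ^ 2 ≤
      1 / 2 * (inner ℝ (B (∑ i, w i • k i)) (∑ i, w i • k i) + η * ‖∑ i, w i • k i‖ ^ 2) +
        (‖B‖ + ‖B‖ ^ 2 / η + 2) / 2 * ∑ i, w i * ‖k i - h i‖ ^ 2 := by
  set x := ∑ i, w i • k i
  set d := ∑ i, w i • (h i - k i) with hd
  have hx : ∑ i, w i • h i = x + d := by
    simp only [hd, x, smul_sub, Finset.sum_sub_distrib]
    abel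
  have h1 : ‖d‖ ^ 2 ≤ ∑ i, w i * ‖k i - h i‖ ^ 2 := by
    refine (norm_sum_smul_sq_le hw hsum _).trans (le_of_eq ?_)
    exact Finset.sum_congr rfl fun i _ => by rw [norm_sub_rev]
  have h2 : inner ℝ (B (x + d)) (x + d) = inner ℝ (B x) x + 2 * inner ℝ (B x) d +
      inner ℝ (B d) d := by
    rw [map_add, inner_add_left, inner_add_right, inner_add_right, hB d x,
      real_inner_comm (B x) d]
    ring
  have h3 : inner ℝ (B x) d ≤ ‖B‖ * ‖x‖ * ‖d‖ :=
    (real_inner_le_norm _ _).trans (mul_le_mul_of_nonneg_right (B.le_opNorm _) (norm_nonneg _))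
  have h4 : 2 * (‖B‖ * ‖x‖ * ‖d‖) ≤ η * ‖x‖ ^ 2 + ‖B‖ ^ 2 / η * ‖d‖ ^ 2 := by
    have h5 : η * ‖x‖ ^ 2 + ‖B‖ ^ 2 / η * ‖d‖ ^ 2 - 2 * (‖B‖ * ‖x‖ * ‖d‖) =
        (η * ‖x‖ - ‖B‖ * ‖d‖) ^ 2 / η := by
      field_simp
      ring
    have : 0 ≤ (η * ‖x‖ - ‖B‖ * ‖d‖) ^ 2 / η := by positivity
    linarith
  have h5 := (abs_le.1 (abs_inner_apply_self_le B d)).2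
  have h6 : 0 ≤ ‖B‖ + ‖B‖ ^ 2 / η := by positivity
  have h7 := mul_le_mul_of_nonneg_left h1 h6
  rw [hx, h2]
  linarith

/-- A strong penalisation of differences of the time variables restores, up to a small error, an
inequality known for equal time variables. -/
theorem exists_time_penalty {w : ι → ℝ} (hw : ∀ i, 0 < w i) (hsum : ∑ i, w i = 1)
    (B : S →L[ℝ] S) {C l r ε : ℝ} (hC : 0 ≤ C) (hl : 0 < l) (hr : 0 < r) (hε : 0 < ε)
    {v : ι → S × ℝ → ℝ}
    (hv : ∀ i, UpperSemicontinuousOn (v i) (Metric.closedBall 0 r ×ˢ Icc (-r) r))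
    (hle : ∀ (h : ι → S) (s : ℝ), (∀ i, ‖h i‖ ≤ r) → |s| ≤ r → ∑ i, w i * v i (h i, s) ≤
      1 / 2 * inner ℝ (B (∑ i, w i • h i)) (∑ i, w i • h i) + C * s ^ 2) :
    ∃ m₀, 0 < m₀ ∧ ∀ m, 0 < m → m ≤ m₀ → ∀ (h : ι → S) (σ : ι → ℝ) (s : ℝ), (∀ i, ‖h i‖ ≤ r) →
      (∀ i, |σ i| ≤ r) → ∑ i, w i * (v i (h i, σ i) - l / 2 * ((s - σ i) / m) ^ 2) ≤
        1 / 2 * inner ℝ (B (∑ i, w i • h i)) (∑ i, w i • h i) + C * s ^ 2 + ε := by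
  have hw' : ∀ i, 0 ≤ w i := fun i => (hw i).le
  have hKc : IsCompact (Metric.closedBall (0 : S) r ×ˢ Icc (-r) r) :=
    (isCompact_closedBall _ _).prod isCompact_Icc
  have hmem : ∀ {x : S} {t : ℝ}, ‖x‖ ≤ r → |t| ≤ r →
      (x, t) ∈ Metric.closedBall (0 : S) r ×ˢ Icc (-r) r := fun hx ht =>
    ⟨by simpa using hx, abs_le.1 ht⟩
  obtain ⟨i₀⟩ : Nonempty ι := by
    by_contra hne
    rw [not_nonempty_iff] at hne
    simp at hsum
  by_contra! hcon
  choose m hm0 hm1 h σ s hh hσ hlt using fun j : ℕ => hcon (1 / ((j : ℝ) + 1)) (by positivity)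
  choose V hV using fun i => (hv i).bddAbove_of_isCompact hKc
  -- Each penalty term along a sequence of counterexamples is at most `D`. As `m → 0` the times
  -- therefore merge, and upper semicontinuity carries a contradiction to the equal-time inequality.
  set D := ∑ i, w i * V i + 1 / 2 * (‖B‖ * r ^ 2)
  have hD : ∀ j i, w i * (l / 2 * ((s j - σ j i) / m j) ^ 2) ≤ D := by
    intro j i
    have h1 : w i * (l / 2 * ((s j - σ j i) / m j) ^ 2) ≤
        ∑ i, w i * (l / 2 * ((s j - σ j i) / m j) ^ 2) :=
      Finset.single_le_sum (f := fun i => w i * (l / 2 * ((s j - σ j i) / m j) ^ 2))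
        (fun i _ => by have := hw' i; positivity) (Finset.mem_univ i)
    have h2 : ∑ i, w i * v i (h j i, σ j i) ≤ ∑ i, w i * V i :=
      Finset.sum_le_sum fun i _ => mul_le_mul_of_nonneg_left
        (hV i (mem_image_of_mem _ (hmem (hh j i) (hσ j i)))) (hw' i)
    have h3 := (abs_le.1 (abs_inner_apply_self_le B (∑ i, w i • h j i))).1
    have h4 : ‖∑ i, w i • h j i‖ ^ 2 ≤ r ^ 2 := by
      refine (norm_sum_smul_sq_le hw' hsum _).trans ?_
      calc ∑ i, w i * ‖h j i‖ ^ 2 ≤ ∑ i, w i * r ^ 2 := Finset.sum_le_sum fun i _ =>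
            mul_le_mul_of_nonneg_left (pow_le_pow_left₀ (norm_nonneg _) (hh j i) 2) (hw' i)
        _ = r ^ 2 := by rw [← Finset.sum_mul, hsum, one_mul]
    have h5 := mul_le_mul_of_nonneg_left h4 (norm_nonneg B)
    have h6 := hlt j
    simp only [mul_sub, Finset.sum_sub_distrib] at h6
    have h7 : 0 ≤ C * s j ^ 2 := by positivity
    simp only [D]
    linarith
  have hdiff : ∀ i, Tendsto (fun j => s j - σ j i) atTop (𝓝 0) := by
    intro i
    have h1 : ∀ j, (s j - σ j i) ^ 2 ≤ (2 * D / (w i * l)) * (1 / ((j : ℝ) + 1)) ^ 2 := by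
      intro j
      have h2 := hD j i
      have hwi := hw i
      have hmj := hm0 j
      have hD0 : 0 ≤ D := le_trans (by positivity) h2
      have h3 : (s j - σ j i) ^ 2 = (2 / (w i * l)) *
          (w i * (l / 2 * ((s j - σ j i) / m j) ^ 2)) * m j ^ 2 := by
        field_simp
      rw [h3, mul_div_right_comm]
      refine mul_le_mul (mul_le_mul_of_nonneg_left h2 (by positivity))
        (pow_le_pow_left₀ (hm0 j).le (hm1 j) 2) (by positivity) (by positivity)
    have h2 : Tendsto (fun j : ℕ => (2 * D / (w i * l)) * (1 / ((j : ℝ) + 1)) ^ 2) atTop (𝓝 0) := by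
      have := (tendsto_one_div_add_atTop_nhds_zero_nat (𝕜 := ℝ)).pow 2
      simpa using this.const_mul (2 * D / (w i * l))
    have h3 : Tendsto (fun j => (s j - σ j i) ^ 2) atTop (𝓝 0) :=
      squeeze_zero (fun j => sq_nonneg _) h1 h2
    have h4 := h3.sqrt
    simp only [Real.sqrt_sq_eq_abs, Real.sqrt_zero] at h4
    exact (tendsto_zero_iff_abs_tendsto_zero _).2 h4
  obtain ⟨⟨H, τ⟩, hHmem, φ, hφ, hlim⟩ := ((isCompact_closedBall (0 : ι → S) r).prod
    (isCompact_closedBall (0 : ι → ℝ) r)).tendsto_subseq (x := fun j => (h j, σ j)) (fun j => by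
      refine ⟨?_, ?_⟩
      · simpa using (pi_norm_le_iff_of_nonneg hr.le).2 (hh j)
      · simpa using (pi_norm_le_iff_of_nonneg hr.le).2 (hσ j))
  have hHlim : ∀ i, Tendsto (fun j => h (φ j) i) atTop (𝓝 (H i)) := fun i =>
    (tendsto_pi_nhds.1 ((continuous_fst.tendsto _).comp hlim)) i
  have hSlim : ∀ i, Tendsto (fun j => σ (φ j) i) atTop (𝓝 (τ i)) := fun i =>
    (tendsto_pi_nhds.1 ((continuous_snd.tendsto _).comp hlim)) i
  have hslim : ∀ i, Tendsto (fun j => s (φ j)) atTop (𝓝 (τ i)) := by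
    intro i
    have := ((hdiff i).comp hφ.tendsto_atTop).add (hSlim i)
    simpa using this
  set t := τ i₀
  have hSt : ∀ i, τ i = t := fun i => tendsto_nhds_unique (hslim i) (hslim i₀)
  have hHr : ∀ i, ‖H i‖ ≤ r := fun i =>
    le_of_tendsto' (hHlim i).norm fun j => hh (φ j) i
  have htr : |t| ≤ r := le_of_tendsto' (hSlim i₀).abs fun j => hσ (φ j) i₀
  have hev : ∀ i, ∀ᶠ j in atTop, v i (h (φ j) i, σ (φ j) i) < v i (H i, t) + ε / 4 := by
    intro i
    have h1 := hv i (H i, t) (hmem (hHr i) htr) (v i (H i, t) + ε / 4) (by linarith)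
    have h2 : Tendsto (fun j => (h (φ j) i, σ (φ j) i)) atTop
        (𝓝[Metric.closedBall (0 : S) r ×ˢ Icc (-r) r] (H i, t)) := by
      refine tendsto_nhdsWithin_iff.2 ⟨(hHlim i).prodMk_nhds (hSt i ▸ hSlim i), ?_⟩
      exact Eventually.of_forall fun j => hmem (hh _ _) (hσ _ _)
    exact h2.eventually h1
  have hrhs : Tendsto (fun j => 1 / 2 * inner ℝ (B (∑ i, w i • h (φ j) i)) (∑ i, w i • h (φ j) i) +
      C * s (φ j) ^ 2) atTop
      (𝓝 (1 / 2 * inner ℝ (B (∑ i, w i • H i)) (∑ i, w i • H i) + C * t ^ 2)) := by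
    have h1 : Tendsto (fun j => ∑ i, w i • h (φ j) i) atTop (𝓝 (∑ i, w i • H i)) :=
      tendsto_finsetSum _ fun i _ => (hHlim i).const_smul (w i)
    have h2 := ((B.continuous.tendsto _).comp h1).inner (𝕜 := ℝ) h1
    exact (h2.const_mul _).add (((hslim i₀).pow 2).const_mul C)
  obtain ⟨j, hj1, hj2⟩ := ((eventually_all.2 hev).and
    (hrhs.eventually (lt_mem_nhds (sub_lt_self _ (show 0 < ε / 4 by positivity))))).exists
  have h1 := hlt (φ j)
  have h2 : ∑ i, w i * (v i (h (φ j) i, σ (φ j) i) - l / 2 * ((s (φ j) - σ (φ j) i) / m (φ j)) ^ 2)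
      ≤ ∑ i, w i * (v i (H i, t) + ε / 4) := by
    refine Finset.sum_le_sum fun i _ => mul_le_mul_of_nonneg_left ?_ (hw' i)
    have : 0 ≤ l / 2 * ((s (φ j) - σ (φ j) i) / m (φ j)) ^ 2 := by positivity
    linarith [hj1 i]
  simp only [mul_add, Finset.sum_add_distrib, ← Finset.sum_mul, hsum, one_mul] at h2
  have h3 := hle H t hHr htr
  linarith

end CommonTime

/-! ### Parabolic superjets and the theorem on sums with common time -/

section CommonTime

variable {S : Type*} [NormedAddCommGroup S] [InnerProductSpace ℝ S]

/-- Second-order spatial and first-order temporal superjets `(θ, a, X)` of `v` at `p`. -/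
def IsSuperjet (v : S × ℝ → ℝ) (p : S × ℝ) (θ : S) (a : ℝ) (X : S →L[ℝ] S) : Prop :=
  ∀ ε, 0 < ε → ∃ C : ℝ, ∀ᶠ z in 𝓝 (0 : S × ℝ),
    v (p + z) ≤ v p + inner ℝ θ z.1 + a * z.2 + 1 / 2 * inner ℝ (X z.1) z.1 + ε * ‖z.1‖ ^ 2 +
      C * z.2 ^ 2

theorem two_mul_le_add_sq_div {a b ε : ℝ} (hε : 0 < ε) :
    2 * (a * b) ≤ ε * a ^ 2 + 1 / ε * b ^ 2 := by
  have h : ε * a ^ 2 + 1 / ε * b ^ 2 - 2 * (a * b) = (ε * a - b) ^ 2 / ε := by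
    field_simp
    ring
  have : 0 ≤ (ε * a - b) ^ 2 / ε := by positivity
  linarith

variable [FiniteDimensional ℝ S]

/-- The map `(h, s) ↦ (h, c s)` into the Euclidean product. -/
def scaleCLM (c : ℝ) : S × ℝ →L[ℝ] WithLp 2 (S × ℝ) :=
  LinearMap.toContinuousLinearMap
    { toFun := fun z => WithLp.toLp 2 (z.1, c * z.2)
      map_add' := fun x y => by
        apply (WithLp.equiv 2 _).injective
        simp [mul_add]
      map_smul' := fun a x => by
        apply (WithLp.equiv 2 _).injective
        simp
        ring }

theorem scaleCLM_apply (c : ℝ) (z : S × ℝ) : scaleCLM c z = WithLp.toLp 2 (z.1, c * z.2) := rfl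

/-- The spatial block of an operator on space-time. -/
def spatialBlock (X : WithLp 2 (S × ℝ) →L[ℝ] WithLp 2 (S × ℝ)) : S →L[ℝ] S :=
  LinearMap.toContinuousLinearMap
    { toFun := fun x => (X (scaleCLM 0 (x, 0))).fst
      map_add' := fun x y => by
        have : ((x + y, 0) : S × ℝ) = (x, 0) + (y, 0) := by simp
        rw [this, map_add, map_add, WithLp.add_fst]
      map_smul' := fun a x => by
        have : ((a • x, 0) : S × ℝ) = a • (x, 0) := by simp
        rw [this, map_smul, map_smul, WithLp.smul_fst]
        rfl }

theorem inner_spatialBlock (X : WithLp 2 (S × ℝ) →L[ℝ] WithLp 2 (S × ℝ)) (x y : S) :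
    inner ℝ (spatialBlock X x) y = inner ℝ (X (WithLp.toLp 2 (x, 0))) (WithLp.toLp 2 (y, 0)) := by
  simp [spatialBlock, WithLp.prod_inner_apply, scaleCLM_apply]

/-- Undoes the time scaling and discards second-order time information. The mixed space-time term is
split by Young's inequality into `ε ‖x‖²` and a multiple of `s²`, which is why the constant in
`IsSuperjet` may depend on `ε`. -/
theorem isSuperjet_of_rescaled {v : S × ℝ → ℝ} {μ r : ℝ} (hμ : 0 < μ)
    {e P : WithLp 2 (S × ℝ)} {X : WithLp 2 (S × ℝ) →L[ℝ] WithLp 2 (S × ℝ)}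
    (hX : ∀ d e, inner ℝ (X d) e = inner ℝ (X e) d)
    (hjet : ∀ c, 0 < c → ∀ᶠ d in 𝓝 (0 : WithLp 2 (S × ℝ)),
      ‖(e + d).fst‖ ≤ r ∧ |μ * (e + d).snd| ≤ r →
      v ((e + d).fst, μ * (e + d).snd) ≤ v (e.fst, μ * e.snd) + inner ℝ P d +
        1 / 2 * inner ℝ (X d) d + c * ‖d‖ ^ 2)
    (h1 : ‖e.fst‖ < r) (h2 : |μ * e.snd| < r) :
    IsSuperjet v (e.fst, μ * e.snd) P.fst (P.snd / μ) (spatialBlock X) := by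
  intro ε hε
  set x₁ : WithLp 2 (S × ℝ) := WithLp.toLp 2 (0, 1) with hx₁
  -- The three terms come from the mixed derivatives, the pure time second derivative, and the time
  -- part of the Taylor remainder.
  refine ⟨1 / 2 * (1 / ε * (‖X‖ * ‖x₁‖ / μ) ^ 2) + 1 / 2 * (inner ℝ (X x₁) x₁ / μ ^ 2) +
    ε / 2 / μ ^ 2, ?_⟩
  have ht : Tendsto (fun z : S × ℝ => scaleCLM μ⁻¹ z) (𝓝 0) (𝓝 0) := by
    have := (scaleCLM (S := S) μ⁻¹).continuous.tendsto 0
    rwa [map_zero] at this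
  have hn1 : ∀ᶠ z in 𝓝 (0 : S × ℝ), ‖e.fst + z.1‖ < r := by
    have : Continuous fun z : S × ℝ => ‖e.fst + z.1‖ := by fun_prop
    exact this.continuousAt.eventually_lt continuousAt_const (by simpa using h1)
  have hn2 : ∀ᶠ z in 𝓝 (0 : S × ℝ), |μ * e.snd + z.2| < r := by
    have : Continuous fun z : S × ℝ => |μ * e.snd + z.2| := by fun_prop
    exact this.continuousAt.eventually_lt continuousAt_const (by simpa using h2)
  filter_upwards [ht.eventually (hjet (ε / 2) (by positivity)), hn1, hn2] with z hz hz1 hz2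
  have hfst : (e + scaleCLM μ⁻¹ z).fst = e.fst + z.1 := rfl
  have hsnd : μ * (e + scaleCLM μ⁻¹ z).snd = μ * e.snd + z.2 := by
    rw [WithLp.add_snd, mul_add, scaleCLM_apply]
    change μ * e.snd + μ * (μ⁻¹ * z.2) = _
    field_simp
  rw [hfst, hsnd] at hz
  have h3 := hz ⟨hz1.le, hz2.le⟩
  have hdec : scaleCLM μ⁻¹ z = WithLp.toLp 2 (z.1, 0) + (z.2 / μ) • x₁ := by
    apply (WithLp.equiv 2 _).injective
    simp [scaleCLM_apply, hx₁, div_eq_inv_mul]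
  have hP : inner ℝ P (scaleCLM μ⁻¹ z) = inner ℝ P.fst z.1 + P.snd / μ * z.2 := by
    rw [WithLp.prod_inner_apply, scaleCLM_apply]
    simp
    ring
  have hnorm : ‖scaleCLM μ⁻¹ z‖ ^ 2 = ‖z.1‖ ^ 2 + z.2 ^ 2 / μ ^ 2 := by
    rw [scaleCLM_apply, WithLp.prod_norm_sq_eq_of_L2]
    simp [mul_pow]
    field_simp
  have hXX : inner ℝ (X (scaleCLM μ⁻¹ z)) (scaleCLM μ⁻¹ z) = inner ℝ (spatialBlock X z.1) z.1 +
      2 * (z.2 / μ * inner ℝ (X (WithLp.toLp 2 (z.1, 0))) x₁) +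
      (z.2 / μ) ^ 2 * inner ℝ (X x₁) x₁ := by
    rw [hdec, inner_spatialBlock, map_add, inner_add_left, inner_add_right, inner_add_right,
      map_smul, real_inner_smul_left, real_inner_smul_left, real_inner_smul_right,
      real_inner_smul_right, hX x₁]
    ring
  have hcross : 2 * (z.2 / μ * inner ℝ (X (WithLp.toLp 2 (z.1, 0))) x₁) ≤
      ε * ‖z.1‖ ^ 2 + 1 / ε * (‖X‖ * ‖x₁‖ / μ) ^ 2 * z.2 ^ 2 := by
    have h4 : ‖(WithLp.toLp 2 (z.1, (0 : ℝ)) : WithLp 2 (S × ℝ))‖ = ‖z.1‖ := by simp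
    have h5 : |inner ℝ (X (WithLp.toLp 2 (z.1, 0))) x₁| ≤ ‖X‖ * ‖z.1‖ * ‖x₁‖ := by
      refine (abs_real_inner_le_norm _ _).trans (mul_le_mul_of_nonneg_right ?_ (norm_nonneg _))
      exact (X.le_opNorm _).trans (by rw [h4])
    have h6 : z.2 / μ * inner ℝ (X (WithLp.toLp 2 (z.1, 0))) x₁ ≤
        |z.2| / μ * (‖X‖ * ‖z.1‖ * ‖x₁‖) := by
      refine (le_abs_self _).trans ?_
      rw [abs_mul, abs_div, abs_of_pos hμ]
      exact mul_le_mul_of_nonneg_left h5 (by positivity)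
    have h7 := two_mul_le_add_sq_div (a := ‖z.1‖) (b := ‖X‖ * ‖x₁‖ / μ * |z.2|) hε
    rw [mul_pow, sq_abs] at h7
    calc _ ≤ 2 * (|z.2| / μ * (‖X‖ * ‖z.1‖ * ‖x₁‖)) := by linarith
      _ = 2 * (‖z.1‖ * (‖X‖ * ‖x₁‖ / μ * |z.2|)) := by ring
      _ ≤ _ := by rw [mul_assoc]; exact h7
  rw [hP, hnorm, hXX] at h3
  change v (e.fst + z.1, μ * e.snd + z.2) ≤ _
  refine h3.trans ?_
  have e1 : (z.2 / μ) ^ 2 * inner ℝ (X x₁) x₁ = inner ℝ (X x₁) x₁ / μ ^ 2 * z.2 ^ 2 := by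
    field_simp
  rw [e1]
  have e2 : ε / 2 * (z.2 ^ 2 / μ ^ 2) = ε / 2 / μ ^ 2 * z.2 ^ 2 := by field_simp
  rw [mul_add (ε / 2), e2]
  generalize 1 / ε * (‖X‖ * ‖x₁‖ / μ) ^ 2 = c₁ at *
  generalize inner ℝ (X x₁) x₁ / μ ^ 2 = c₂ at *
  generalize ε / 2 / μ ^ 2 = c₃ at *
  linarith

/-- The box `{‖h‖ ≤ r, |s| ≤ r}` in the time variable `s / μ`. -/
def rescaledBox (S : Type*) [NormedAddCommGroup S] (μ r : ℝ) : Set (WithLp 2 (S × ℝ)) :=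
  {e | ‖e.fst‖ ≤ r ∧ |μ * e.snd| ≤ r}

theorem isCompact_rescaledBox {μ : ℝ} (hμ : 0 < μ) (r : ℝ) : IsCompact (rescaledBox S μ r) := by
  have h1 : IsCompact (Metric.closedBall (0 : S) r ×ˢ Icc (-r) r) :=
    (isCompact_closedBall _ _).prod isCompact_Icc
  have h2 := h1.image (scaleCLM (S := S) μ⁻¹).continuous
  convert h2 using 1
  ext e
  constructor
  · rintro ⟨he1, he2⟩
    refine ⟨(e.fst, μ * e.snd), ⟨by simpa using he1, abs_le.1 he2⟩, ?_⟩
    simp only [scaleCLM_apply, inv_mul_cancel_left₀ hμ.ne']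
    rfl
  · rintro ⟨p, ⟨hp1, hp2⟩, rfl⟩
    refine ⟨?_, ?_⟩
    · change ‖p.1‖ ≤ r
      simpa using hp1
    · change |μ * (μ⁻¹ * p.2)| ≤ r
      rw [mul_inv_cancel_left₀ hμ.ne']
      exact abs_le.2 hp2

omit [InnerProductSpace ℝ S] [FiniteDimensional ℝ S] in
theorem upperSemicontinuousOn_rescaledBox {v : S × ℝ → ℝ} {r : ℝ}
    (hv : UpperSemicontinuousOn v (Metric.closedBall 0 r ×ˢ Icc (-r) r)) (μ : ℝ) :
    UpperSemicontinuousOn (fun e : WithLp 2 (S × ℝ) => v (e.fst, μ * e.snd))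
      (rescaledBox S μ r) := by
  have hc : Continuous fun e : WithLp 2 (S × ℝ) => (e.fst, μ * e.snd) := by
    have := WithLp.prod_continuous_ofLp 2 S ℝ
    exact (continuous_fst.comp this).prodMk (continuous_const.mul (continuous_snd.comp this))
  exact hv.comp hc.continuousOn fun e he => ⟨by simpa using he.1, abs_le.1 he.2⟩

omit [InnerProductSpace ℝ S] [FiniteDimensional ℝ S] in
-- In rescaled time the isotropic kernel penalises time differences with weight `1 / μ²`, which
-- turns the sup-convolution into the penalty of `exists_time_penalty`.
theorem norm_toLp_sub_sq {μ : ℝ} (hμ : 0 < μ) (k : S) (s : ℝ) (e : WithLp 2 (S × ℝ)) :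
    ‖WithLp.toLp 2 (k, μ⁻¹ * s) - e‖ ^ 2 = ‖k - e.fst‖ ^ 2 + ((s - μ * e.snd) / μ) ^ 2 := by
  rw [WithLp.prod_norm_sq_eq_of_L2]
  have h1 : (WithLp.toLp 2 (k, μ⁻¹ * s) - e).snd = (s - μ * e.snd) / μ := by
    rw [WithLp.sub_snd]
    change μ⁻¹ * s - e.snd = _
    field_simp
  rw [h1, Real.norm_eq_abs, sq_abs]
  rfl

theorem exists_radius_mul_sq_le {a b ρ : ℝ} (ha : 0 ≤ a) (hb : 0 < b) (hρ : 0 < ρ) :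
    ∃ x, 0 < x ∧ x ≤ ρ ∧ a * x ^ 2 ≤ b := by
  refine ⟨min ρ (min 1 (b / (a + 1))), by positivity, min_le_left _ _, ?_⟩
  set x := min ρ (min 1 (b / (a + 1)))
  have hx0 : 0 ≤ x := by positivity
  have hx1 : x ≤ 1 := (min_le_right _ _).trans (min_le_left _ _)
  have hx2 : x ≤ b / (a + 1) := (min_le_right _ _).trans (min_le_right _ _)
  rw [le_div_iff₀ (by positivity)] at hx2
  have h1 : x ^ 2 ≤ x := by nlinarith
  have h2 := mul_le_mul_of_nonneg_left h1 ha
  linarith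

set_option maxHeartbeats 1000000 in
/-- Theorem on sums for functions of space and a common time variable. -/
theorem exists_superjets_common_time {ι : Type*} [Fintype ι] {w : ι → ℝ} (hw : ∀ i, 0 < w i)
    (hsum : ∑ i, w i = 1) {B : S →L[ℝ] S} (hB : ∀ x y, inner ℝ (B x) y = inner ℝ x (B y))
    {C r η : ℝ} (hC : 0 ≤ C) (hr : 0 < r) (hη : 0 < η) {v : ι → S × ℝ → ℝ}
    (hv : ∀ i, UpperSemicontinuousOn (v i) (Metric.closedBall 0 r ×ˢ Icc (-r) r))
    (hv0 : ∀ i, v i 0 = 0)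
    (hle : ∀ (h : ι → S) (s : ℝ), (∀ i, ‖h i‖ ≤ r) → |s| ≤ r → ∑ i, w i * v i (h i, s) ≤
      1 / 2 * inner ℝ (B (∑ i, w i • h i)) (∑ i, w i • h i) + C * s ^ 2) :
    ∃ L : ℝ, ∀ ρ, 0 < ρ → ∃ (q : ι → S × ℝ) (θ : ι → S) (a : ι → ℝ) (X : ι → S →L[ℝ] S),
      (∀ i, ‖(q i).1‖ < ρ ∧ |(q i).2| < ρ ∧ |v i (q i)| < ρ ∧ ‖θ i‖ < ρ) ∧
      |∑ i, w i * a i| < ρ ∧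
      (∀ i x y, inner ℝ (X i x) y = inner ℝ (X i y) x) ∧
      (∀ i x, |inner ℝ (X i x) x| ≤ L * ‖x‖ ^ 2) ∧
      (∀ h : ι → S, ∑ i, w i * inner ℝ (X i (h i)) (h i) ≤
        inner ℝ (B (∑ i, w i • h i)) (∑ i, w i • h i) + η * ∑ i, ‖h i‖ ^ 2) ∧
      ∀ i, IsSuperjet (v i) (q i) (θ i) (a i) (X i) := by
  classical
  have hw' : ∀ i, 0 ≤ w i := fun i => (hw i).le
  have hw1 : ∀ i, w i ≤ 1 := fun i =>
    (Finset.single_le_sum (fun i _ => hw' i) (Finset.mem_univ i)).trans hsum.le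
  obtain ⟨i₀⟩ : Nonempty ι := by
    by_contra hne
    rw [not_nonempty_iff] at hne
    simp at hsum
  obtain ⟨m, hm0, hmw⟩ : ∃ m, 0 < m ∧ ∀ i, m ≤ w i := by
    obtain ⟨j, -, hj⟩ := Finset.exists_min_image Finset.univ w ⟨i₀, Finset.mem_univ _⟩
    exact ⟨w j, hw j, fun i => hj i (Finset.mem_univ i)⟩
  have hm1 : m ≤ 1 := (hmw i₀).trans (hw1 i₀)
  -- Half of `η` is spent in `mean_form_split`, through `B' = B + η₁`, and half on strictness of the
  -- maximum in the theorem on sums.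
  set η₁ := η / 2 with hη₁
  have hη₁0 : 0 < η₁ := by positivity
  set l := ‖B‖ + ‖B‖ ^ 2 / η₁ + 2 with hl
  have hl2 : 2 ≤ l := by
    have : 0 ≤ ‖B‖ + ‖B‖ ^ 2 / η₁ := by positivity
    linarith
  have hl0 : 0 < l := by linarith
  set B' : S →L[ℝ] S := B + η₁ • ContinuousLinearMap.id ℝ S with hB'
  have hB'in : ∀ x y, inner ℝ (B' x) y = inner ℝ (B x) y + η₁ * inner ℝ x y := fun x y => by
    simp [hB', inner_add_left, real_inner_smul_left]
  set Q := meanFormCLM w B' (2 * C) with hQ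
  have hQin := fun x y => inner_meanFormCLM w B' (2 * C) x y
  -- The Hessian bound is independent of `ρ`: semiconvexity gives the lower bound `-l`, and testing
  -- the joint inequality in a single slot gives the upper bound.
  refine ⟨l + (‖B‖ + η) / m, fun ρ hρ => ?_⟩
  have husc0 : ∀ i, ∀ᶠ p in 𝓝[Metric.closedBall 0 r ×ˢ Icc (-r) r] (0 : S × ℝ),
      v i p < m * ρ / 4 := fun i => by
    refine hv i 0 ⟨by simpa using hr.le, by simpa using hr.le⟩ (m * ρ / 4) ?_
    change v i 0 < _
    rw [hv0 i]
    positivity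
  obtain ⟨ρ₁, hρ₁, hball⟩ : ∃ ρ₁, 0 < ρ₁ ∧ ∀ i, ∀ p : S × ℝ, ‖p.1‖ < ρ₁ → |p.2| < ρ₁ →
      p ∈ Metric.closedBall (0 : S) r ×ˢ Icc (-r) r → v i p < m * ρ / 4 := by
    obtain ⟨ρ₁, hρ₁, h⟩ := Metric.eventually_nhds_iff_ball.1
      (eventually_nhdsWithin_iff.1 (eventually_all.2 husc0))
    exact ⟨ρ₁, hρ₁, fun i p h1 h2 hp => h p (by
      rw [mem_ball_zero_iff, Prod.norm_def]
      exact max_lt h1 (by simpa using h2)) hp i⟩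
  obtain ⟨ρ₀, hρ₀, hρ₀ρ, hρ₀r, hρ₀1, hρ₀B⟩ : ∃ ρ₀, 0 < ρ₀ ∧ ρ₀ ≤ ρ ∧ ρ₀ ≤ r ∧ ρ₀ ≤ ρ₁ ∧
      ‖B‖ * ρ₀ ^ 2 ≤ m * ρ / 2 := by
    obtain ⟨x, hx0, hx1, hx2⟩ := exists_radius_mul_sq_le (norm_nonneg B)
      (show 0 < m * ρ / 2 by positivity) (show 0 < min (min ρ r) ρ₁ by positivity)
    exact ⟨x, hx0, hx1.trans ((min_le_left _ _).trans (min_le_left _ _)),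
      hx1.trans ((min_le_left _ _).trans (min_le_right _ _)), hx1.trans (min_le_right _ _), hx2⟩
  set R := min (ρ₀ / 2) (m * ρ / (4 * (‖Q‖ + η₁))) with hR
  have hR0 : 0 < R := lt_min (by positivity) (by positivity)
  have hR1 : R ≤ ρ₀ / 2 := min_le_left _ _
  have hR2 : (‖Q‖ + η₁) * R ≤ m * ρ / 4 := by
    have := min_le_right (ρ₀ / 2) (m * ρ / (4 * (‖Q‖ + η₁)))
    rw [← hR, le_div_iff₀ (by positivity)] at this
    linarith
  set ε := min (η₁ * R ^ 2 / 4) (m * ρ₀ ^ 2 / 20) with hε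
  have hε0 : 0 < ε := lt_min (by positivity) (by positivity)
  have hε1 : ε < η₁ / 2 * R ^ 2 := by
    have : 0 < η₁ * R ^ 2 := by positivity
    have := min_le_left (η₁ * R ^ 2 / 4) (m * ρ₀ ^ 2 / 20)
    linarith
  have hε2 : ε ≤ m * ρ₀ ^ 2 / 20 := min_le_right _ _
  set δ := min (m * ρ₀ ^ 2 / 20) (m * ρ / 4) with hδ
  have hδ0 : 0 < δ := lt_min (by positivity) (by positivity)
  have hδ1 : δ ≤ m * ρ₀ ^ 2 / 20 := min_le_left _ _
  have hδ2 : δ ≤ m * ρ / 4 := min_le_right _ _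
  obtain ⟨μ₀, hμ₀, hpen⟩ := exists_time_penalty hw hsum B hC hl0 hr hε0 hv hle
  -- The penalty inequality must be available at both `μ` and `2μ`; the two are compared below.
  set μ := min (μ₀ / 2) 1 with hμ
  have hμ0 : 0 < μ := lt_min (by positivity) one_pos
  have hμ1 : μ ≤ 1 := min_le_right _ _
  have hμ2 : 2 * μ ≤ μ₀ := by
    have := min_le_left (μ₀ / 2) 1
    linarith
  set K := rescaledBox S μ r with hK
  have hKc : IsCompact K := isCompact_rescaledBox hμ0 r
  have hK0 : (0 : WithLp 2 (S × ℝ)) ∈ K := by simp [hK, rescaledBox, hr.le]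
  set u : ι → WithLp 2 (S × ℝ) → ℝ := fun i e => v i (e.fst, μ * e.snd) with hu
  have husc : ∀ i, UpperSemicontinuousOn (u i) K := fun i =>
    upperSemicontinuousOn_rescaledBox (hv i) μ
  have hQself : ∀ z : WithLp 2 (PiLp 2 (fun _ : ι => S) × ℝ), 1 / 2 * inner ℝ (Q z) z =
      1 / 2 * (inner ℝ (B (∑ i, w i • z.fst i)) (∑ i, w i • z.fst i) +
        η₁ * ‖∑ i, w i • z.fst i‖ ^ 2) + C * z.snd ^ 2 := by
    intro z
    rw [hQin, hB'in, real_inner_self_eq_norm_sq]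
    ring
  have hmain : ∀ (z : WithLp 2 (PiLp 2 (fun _ : ι => S) × ℝ)) (e : ι → WithLp 2 (S × ℝ)),
      ∑ i, w i * (u i (e i) - l / 2 * ‖projCLM i μ⁻¹ z - e i‖ ^ 2) +
        1 / 2 * inner ℝ (B (∑ i, w i • (e i).fst)) (∑ i, w i • (e i).fst) +
        ∑ i, w i * ‖z.fst i - (e i).fst‖ ^ 2 + C * z.snd ^ 2 ≤
      ∑ i, w i * (v i ((e i).fst, μ * (e i).snd) - l / 2 * ((z.snd - μ * (e i).snd) / μ) ^ 2) +
        1 / 2 * inner ℝ (Q z) z := by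
    intro z e
    have h1 := mean_form_split hw' hsum hB hη₁0 (fun i => (e i).fst) (fun i => z.fst i)
    rw [← hl] at h1
    simp only [projCLM_apply, norm_toLp_sub_sq hμ0, hQself, mul_add, mul_sub, Finset.sum_sub_distrib,
      Finset.sum_add_distrib, hu] at h1 ⊢
    have h2 : ∑ i, w i * (l / 2 * ‖z.fst i - (e i).fst‖ ^ 2) =
        l / 2 * ∑ i, w i * ‖z.fst i - (e i).fst‖ ^ 2 := by
      rw [Finset.mul_sum]
      exact Finset.sum_congr rfl fun i _ => by ring
    linarith
  have hquad : ∀ z, ∑ j, w j * supConv K (u j) l (projCLM j μ⁻¹ z) ≤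
      1 / 2 * inner ℝ (Q z) z + ε := by
    intro z
    choose e heK he using fun j => exists_supConv_eq hKc ⟨0, hK0⟩ (husc j) l (projCLM j μ⁻¹ z)
    simp only [he]
    have h1 := hmain z e
    have h2 := hpen μ hμ0 (by linarith) (fun i => (e i).fst) (fun i => μ * (e i).snd) z.snd
      (fun i => (heK i).1) (fun i => (heK i).2)
    have h3 : 0 ≤ ∑ i, w i * ‖z.fst i - (e i).fst‖ ^ 2 :=
      Finset.sum_nonneg fun i _ => by have := hw' i; positivity
    linarith
  have hzero : 0 ≤ ∑ j, w j * supConv K (u j) l 0 := by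
    refine Finset.sum_nonneg fun j _ => mul_nonneg (hw' j) ?_
    have := le_supConv hKc (husc j) l 0 hK0
    have h1 : u j 0 = 0 := by
      rw [← hv0 j, hu]
      simp only [WithLp.zero_fst, WithLp.zero_snd, mul_zero]
      rfl
    simpa [h1] using this
  have hQsym : ∀ x y, inner ℝ (Q x) y = inner ℝ x (Q y) := by
    intro x y
    rw [real_inner_comm (Q y) x, hQ, hQin, hQin, hB'in, hB'in, hB,
      real_inner_comm (B (∑ j, w j • y.fst j)), real_inner_comm (∑ j, w j • y.fst j)]
    ring
  have hsec : ∀ (i : ι) (e : WithLp 2 (S × ℝ)), projCLM i μ⁻¹ (sectionCLM i μ e) = e :=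
    fun i e => projCLM_sectionCLM i hμ0.ne' e
  obtain ⟨z, e, P, X, hzR, hnear, heK, hjet, hXs, hgrad, hhess, hXl⟩ :=
    exists_superjets_of_sum_supConv_le hw (fun i => projCLM (S := S) i μ⁻¹)
    (fun i => sectionCLM i μ) hsec Q hQsym (K := fun _ => K) (u := u) (fun _ => hKc)
    (fun _ => ⟨0, hK0⟩) husc hl0 hη₁0 hR0 hδ0 hε1 hquad hzero
  have hzfst : ∀ i, ‖z.fst i‖ < R := fun i => by
    refine lt_of_le_of_lt ((PiLp.norm_apply_le z.fst i).trans ?_) hzR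
    refine (pow_le_pow_iff_left₀ (norm_nonneg _) (norm_nonneg _) two_ne_zero).1 ?_
    rw [WithLp.prod_norm_sq_eq_of_L2 z]
    exact le_add_of_nonneg_right (sq_nonneg _)
  have hzsnd : |z.snd| < R := by
    refine lt_of_le_of_lt ?_ hzR
    rw [← Real.norm_eq_abs]
    refine (pow_le_pow_iff_left₀ (norm_nonneg _) (norm_nonneg _) two_ne_zero).1 ?_
    rw [WithLp.prod_norm_sq_eq_of_L2 z]
    exact le_add_of_nonneg_left (sq_nonneg _)
  have hG0 : ∀ i, 0 ≤ w i * ‖z.fst i - (e i).fst‖ ^ 2 := fun i =>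
    mul_nonneg (hw' i) (sq_nonneg _)
  have hT0 : ∀ i, 0 ≤ w i * ((z.snd - μ * (e i).snd) / μ) ^ 2 := fun i =>
    mul_nonneg (hw' i) (sq_nonneg _)
  set G := ∑ i, w i * ‖z.fst i - (e i).fst‖ ^ 2 with hG
  set T := ∑ i, w i * ((z.snd - μ * (e i).snd) / μ) ^ 2 with hT
  set V := ∑ i, w i * v i ((e i).fst, μ * (e i).snd) with hV
  set q := 1 / 2 * inner ℝ (B (∑ i, w i • (e i).fst)) (∑ i, w i • (e i).fst) with hq
  -- Near-maximality with parameter `μ` gives `q + G + C s² + (l/2) T ≤ V + δ`, and the penalty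
  -- inequality with `2μ` gives `V ≤ q + C s² + (l/8) T + ε`. Adding them bounds `G + (3/8) l T` by
  -- `ε + δ`.
  have hGT : G ≤ m * ρ₀ ^ 2 / 10 ∧ T ≤ 4 / 3 * (m * ρ₀ ^ 2 / 10) ∧ q - δ ≤ V := by
    have h1 := hmain z e
    have h2 : 1 / 2 * inner ℝ (Q z) z - δ ≤
        ∑ i, w i * (u i (e i) - l / 2 * ‖projCLM i μ⁻¹ z - e i‖ ^ 2) := by
      refine hnear.trans (le_of_eq (Finset.sum_congr rfl fun i _ => ?_))
      rw [(heK i).2]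
    have h3 : ∑ i, w i * (v i ((e i).fst, μ * (e i).snd) -
        l / 2 * ((z.snd - μ * (e i).snd) / μ) ^ 2) = V - l / 2 * T := by
      simp only [hV, hT, mul_sub, Finset.sum_sub_distrib, Finset.mul_sum]
      congr 1
      exact Finset.sum_congr rfl fun i _ => by ring
    have h4 := hpen (2 * μ) (by linarith) hμ2 (fun i => (e i).fst) (fun i => μ * (e i).snd) z.snd
      (fun i => (heK i).1.1) (fun i => (heK i).1.2)
    have h5 : ∑ i, w i * (v i ((e i).fst, μ * (e i).snd) -
        l / 2 * ((z.snd - μ * (e i).snd) / (2 * μ)) ^ 2) = V - l / 8 * T := by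
      simp only [hV, hT, mul_sub, Finset.sum_sub_distrib, Finset.mul_sum]
      congr 1
      refine Finset.sum_congr rfl fun i _ => ?_
      field_simp
      ring
    rw [h3] at h1
    rw [h5] at h4
    have hGn : 0 ≤ G := Finset.sum_nonneg fun i _ => hG0 i
    have hTn : 0 ≤ T := Finset.sum_nonneg fun i _ => hT0 i
    have hCs : 0 ≤ C * z.snd ^ 2 := by positivity
    have hlT : 2 * T ≤ l * T := mul_le_mul_of_nonneg_right hl2 hTn
    refine ⟨?_, ?_, ?_⟩ <;> linarith
  obtain ⟨hGle, hTle, hVle⟩ := hGT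
  have hsq : ∀ {i : ι} {x c : ℝ}, w i * x ^ 2 ≤ c * m → x ^ 2 ≤ c := fun {i x c} h => by
    have h1 : m * x ^ 2 ≤ w i * x ^ 2 := mul_le_mul_of_nonneg_right (hmw i) (sq_nonneg _)
    exact le_of_mul_le_mul_left (by linarith) hm0
  have hsmall1 : ∀ i, ‖(e i).fst‖ < ρ₀ := fun i => by
    have h1 : w i * ‖z.fst i - (e i).fst‖ ^ 2 ≤ G :=
      Finset.single_le_sum (fun i _ => hG0 i) (Finset.mem_univ i)
    have h2 : ‖z.fst i - (e i).fst‖ ^ 2 ≤ ρ₀ ^ 2 / 10 := hsq (i := i) (by linarith)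
    have h3 : ‖z.fst i - (e i).fst‖ ≤ ρ₀ / 2 := abs_le_of_sq_le_sq' (by nlinarith)
      (by positivity) |>.2
    have h4 : ‖(e i).fst‖ ≤ ‖z.fst i‖ + ‖z.fst i - (e i).fst‖ := norm_le_norm_add_norm_sub _ _
    linarith [hzfst i]
  have hsmall2 : ∀ i, |μ * (e i).snd| < ρ₀ := fun i => by
    have h1 : w i * ((z.snd - μ * (e i).snd) / μ) ^ 2 ≤ T :=
      Finset.single_le_sum (fun i _ => hT0 i) (Finset.mem_univ i)
    have h2 : ((z.snd - μ * (e i).snd) / μ) ^ 2 ≤ 4 / 3 * (ρ₀ ^ 2 / 10) :=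
      hsq (i := i) (by linarith)
    have h3 : |(z.snd - μ * (e i).snd) / μ| ≤ ρ₀ / 2 :=
      abs_le_of_sq_le_sq (by nlinarith) (by positivity)
    rw [abs_div, abs_of_pos hμ0, div_le_iff₀ hμ0] at h3
    have h4 : ρ₀ / 2 * μ ≤ ρ₀ / 2 * 1 := mul_le_mul_of_nonneg_left hμ1 (by positivity)
    have h5 := abs_sub_abs_le_abs_sub (μ * (e i).snd) z.snd
    rw [abs_sub_comm] at h5
    linarith
  have hvup : ∀ i, v i ((e i).fst, μ * (e i).snd) < m * ρ / 4 := fun i =>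
    hball i _ ((hsmall1 i).trans_le hρ₀1) ((hsmall2 i).trans_le hρ₀1)
      ⟨by simpa using (heK i).1.1, abs_le.1 (heK i).1.2⟩
  -- Upper semicontinuity gives only upper bounds on the values. The lower bound for one value
  -- follows from the lower bound on the weighted sum and the upper bounds on the others.
  have hvlow : ∀ i, -ρ < v i ((e i).fst, μ * (e i).snd) := fun i => by
    have h1 : ∑ j ∈ Finset.univ.erase i, w j * v j ((e j).fst, μ * (e j).snd) ≤
        ∑ j, w j * (m * ρ / 4) := by
      refine (Finset.sum_le_sum fun j _ =>
        mul_le_mul_of_nonneg_left (hvup j).le (hw' j)).trans ?_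
      exact Finset.sum_le_sum_of_subset_of_nonneg (Finset.erase_subset _ _) fun j _ _ => by
        have := hw' j
        positivity
    rw [← Finset.sum_mul, hsum, one_mul] at h1
    have h2 := Finset.add_sum_erase Finset.univ
      (fun j => w j * v j ((e j).fst, μ * (e j).snd)) (Finset.mem_univ i)
    have h3 := (abs_le.1 (abs_inner_apply_self_le B (∑ i, w i • (e i).fst))).1
    have h4 : ‖∑ i, w i • (e i).fst‖ ^ 2 ≤ ρ₀ ^ 2 := by
      refine (norm_sum_smul_sq_le hw' hsum _).trans ?_
      calc ∑ i, w i * ‖(e i).fst‖ ^ 2 ≤ ∑ i, w i * ρ₀ ^ 2 := Finset.sum_le_sum fun i _ =>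
            mul_le_mul_of_nonneg_left
              (pow_le_pow_left₀ (norm_nonneg _) (hsmall1 i).le 2) (hw' i)
        _ = ρ₀ ^ 2 := by rw [← Finset.sum_mul, hsum, one_mul]
    have h5 := mul_le_mul_of_nonneg_left h4 (norm_nonneg B)
    have hmρ : 0 < m * ρ := by positivity
    have h6 : -(m * ρ) < w i * v i ((e i).fst, μ * (e i).snd) := by
      linarith
    by_contra! hcon
    have h7 : m * ρ ≤ w i * ρ := mul_le_mul_of_nonneg_right (hmw i) hρ.le
    have h8 := mul_le_mul_of_nonneg_left hcon (hw' i)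
    linarith
  have hgr : ∀ d, |∑ j, w j * inner ℝ (P j) (projCLM j μ⁻¹ d)| ≤ m * ρ / 2 * ‖d‖ := by
    intro d
    have h1 : |inner ℝ (Q z) d + η₁ * inner ℝ z d| ≤ m * ρ / 4 * ‖d‖ := by
      have h2 : |inner ℝ (Q z) d| ≤ ‖Q‖ * R * ‖d‖ := by
        refine (abs_real_inner_le_norm _ _).trans
          (mul_le_mul_of_nonneg_right ((Q.le_opNorm z).trans ?_) (norm_nonneg _))
        exact mul_le_mul_of_nonneg_left hzR.le (norm_nonneg _)
      have h3 : |η₁ * inner ℝ z d| ≤ η₁ * R * ‖d‖ := by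
        rw [abs_mul, abs_of_pos hη₁0, mul_assoc]
        refine mul_le_mul_of_nonneg_left ((abs_real_inner_le_norm _ _).trans ?_) hη₁0.le
        exact mul_le_mul_of_nonneg_right hzR.le (norm_nonneg _)
      have h4 := mul_le_mul_of_nonneg_right hR2 (norm_nonneg d)
      refine (abs_add_le _ _).trans ?_
      linarith
    have h2 := hgrad d
    have h3 := mul_le_mul_of_nonneg_right hδ2 (norm_nonneg d)
    rw [abs_le] at h1 h2 ⊢
    constructor <;> linarith
  have hsingle : ∀ (i : ι) (x : S) (f : ι → S → ℝ), (∀ j, f j 0 = 0) →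
      ∑ j, w j * f j ((Pi.single i x : ι → S) j) = w i * f i x := by
    intro i x f hf
    rw [Finset.sum_eq_single i]
    · simp
    · intro j _ hj
      simp [hj, hf]
    · simp
  have hhessB : ∀ h : ι → S, ∑ i, w i * inner ℝ (spatialBlock (X i) (h i)) (h i) ≤
      inner ℝ (B (∑ i, w i • h i)) (∑ i, w i • h i) + η * ∑ i, ‖h i‖ ^ 2 := by
    intro h
    have h1 := hhess (WithLp.toLp 2 (WithLp.toLp 2 h, 0))
    simp only [projCLM_apply, hQ, hQin, hB'in] at h1
    change ∑ i, w i * inner ℝ (X i (WithLp.toLp 2 (h i, μ⁻¹ * 0))) (WithLp.toLp 2 (h i, μ⁻¹ * 0)) ≤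
      inner ℝ (B (∑ i, w i • h i)) (∑ i, w i • h i) +
        η₁ * inner ℝ (∑ i, w i • h i) (∑ i, w i • h i) + 2 * C * (0 * 0) + η₁ * _ at h1
    simp only [mul_zero, add_zero] at h1
    have h2 : ‖(WithLp.toLp 2 (WithLp.toLp 2 h, (0 : ℝ)) :
        WithLp 2 (PiLp 2 (fun _ : ι => S) × ℝ))‖ ^ 2 = ∑ i, ‖h i‖ ^ 2 := by
      rw [WithLp.prod_norm_sq_eq_of_L2]
      simp [PiLp.norm_sq_eq_of_L2]
    rw [h2, real_inner_self_eq_norm_sq] at h1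
    have h3 : ‖∑ i, w i • h i‖ ^ 2 ≤ ∑ i, ‖h i‖ ^ 2 := by
      refine (norm_sum_smul_sq_le hw' hsum _).trans (Finset.sum_le_sum fun i _ => ?_)
      exact mul_le_of_le_one_left (sq_nonneg _) (hw1 i)
    have h4 := mul_le_mul_of_nonneg_left h3 hη₁0.le
    simp only [inner_spatialBlock]
    have h5 : η = η₁ + η₁ := by rw [hη₁]; ring
    rw [h5, add_mul]
    linarith
  refine ⟨fun i => ((e i).fst, μ * (e i).snd), fun i => (P i).fst, fun i => (P i).snd / μ,
    fun i => spatialBlock (X i), fun i => ⟨(hsmall1 i).trans_le hρ₀ρ, (hsmall2 i).trans_le hρ₀ρ,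
      abs_lt.2 ⟨hvlow i, ?_⟩, ?_⟩, ?_, fun i x y => ?_, fun i x => ?_, hhessB, fun i => ?_⟩
  · have h1 : m * ρ ≤ 1 * ρ := mul_le_mul_of_nonneg_right hm1 hρ.le
    linarith [hvup i]
  -- Testing the joint gradient in the `i`-th slot along the spatial gradient itself isolates its
  -- norm.
  · have h1 := hgr (WithLp.toLp 2 (WithLp.toLp 2 (Pi.single i (P i).fst), 0))
    have h2 : ∑ j, w j * inner ℝ (P j) (projCLM j μ⁻¹
        (WithLp.toLp 2 (WithLp.toLp 2 (Pi.single i (P i).fst), 0))) =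
        w i * ‖(P i).fst‖ ^ 2 := by
      have h3 := hsingle i (P i).fst (fun j x => inner ℝ (P j).fst x) (by simp)
      rw [real_inner_self_eq_norm_sq] at h3
      rw [← h3]
      refine Finset.sum_congr rfl fun j _ => ?_
      rw [projCLM_apply, WithLp.prod_inner_apply]
      simp [Pi.single_apply]
    have h4 : ‖(WithLp.toLp 2 (WithLp.toLp 2 (Pi.single i (P i).fst), (0 : ℝ)) :
        WithLp 2 (PiLp 2 (fun _ : ι => S) × ℝ))‖ = ‖(P i).fst‖ := by
      simp
    rw [h2, h4, abs_of_nonneg (mul_nonneg (hw' i) (sq_nonneg _))] at h1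
    by_contra! hcon
    have h5 : 0 < ‖(P i).fst‖ := hρ.trans_le hcon
    have h6 : m * ρ * ‖(P i).fst‖ ≤ w i * ‖(P i).fst‖ ^ 2 := by
      rw [pow_two, ← mul_assoc]
      exact mul_le_mul_of_nonneg_right
        (mul_le_mul (hmw i) hcon hρ.le (hw' i)) (norm_nonneg _)
    have h7 : 0 < m * ρ * ‖(P i).fst‖ := by positivity
    linarith
  -- The time direction moves all summands together, so it sees only the weighted sum of the time
  -- derivatives.
  · have h1 := hgr (WithLp.toLp 2 (0, 1))
    have h2 : ∑ j, w j * inner ℝ (P j) (projCLM j μ⁻¹ (WithLp.toLp 2 (0, 1))) =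
        ∑ j, w j * ((P j).snd / μ) := by
      refine Finset.sum_congr rfl fun j _ => ?_
      rw [projCLM_apply, WithLp.prod_inner_apply]
      simp
      left
      ring
    have h4 : ‖(WithLp.toLp 2 (0, (1 : ℝ)) :
        WithLp 2 (PiLp 2 (fun _ : ι => S) × ℝ))‖ = 1 := by
      simp
    rw [h2, h4] at h1
    have h5 : m * ρ ≤ 1 * ρ := mul_le_mul_of_nonneg_right hm1 hρ.le
    linarith
  · rw [inner_spatialBlock, inner_spatialBlock, hXs]
  · have hlow : -(l * ‖x‖ ^ 2) ≤ inner ℝ (spatialBlock (X i) x) x := by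
      have h1 := hXl i (WithLp.toLp 2 (x, 0))
      rw [← inner_spatialBlock] at h1
      simpa using h1
    have hup : inner ℝ (spatialBlock (X i) x) x ≤ (‖B‖ + η) / m * ‖x‖ ^ 2 := by
      have h1 := hhessB (Pi.single i x)
      rw [hsingle i x (fun j x => inner ℝ (spatialBlock (X j) x) x) (by simp)] at h1
      have h2 : ∑ j, w j • (Pi.single i x : ι → S) j = w i • x := by
        rw [Finset.sum_eq_single i] <;> simp +contextual
      have h3 : ∑ j, ‖(Pi.single i x : ι → S) j‖ ^ 2 = ‖x‖ ^ 2 := by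
        rw [Finset.sum_eq_single i] <;> simp +contextual
      rw [h2, h3] at h1
      have h4 := (abs_le.1 (abs_inner_apply_self_le B (w i • x))).2
      have h5 : ‖w i • x‖ ^ 2 ≤ ‖x‖ ^ 2 := by
        refine pow_le_pow_left₀ (norm_nonneg _) ?_ 2
        rw [norm_smul, Real.norm_eq_abs, abs_of_pos (hw i)]
        exact mul_le_of_le_one_left (norm_nonneg _) (hw1 i)
      have h6 := mul_le_mul_of_nonneg_left h5 (norm_nonneg B)
      rcases le_total (inner ℝ (spatialBlock (X i) x) x) 0 with h0 | h0
      · exact h0.trans (by positivity)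
      · have h7 := mul_le_mul_of_nonneg_right (hmw i) h0
        rw [div_mul_eq_mul_div, le_div_iff₀ hm0]
        linarith
    have h1 : 0 ≤ (‖B‖ + η) / m * ‖x‖ ^ 2 := by positivity
    have h2 : 0 ≤ l * ‖x‖ ^ 2 := by positivity
    rw [abs_le, add_mul]
    constructor <;> linarith
  · refine isSuperjet_of_rescaled hμ0 (hXs i) (fun c hc => ?_)
      ((hsmall1 i).trans_le hρ₀r) ((hsmall2 i).trans_le hρ₀r)
    exact hjet i c hc

end CommonTime

/-! ### Second-order expansion of scalar functions -/

section ScalarCalculus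

theorem scalar_taylor {Φ Φ' : ℝ → ℝ} {m d : ℝ} (h1 : ∀ᶠ y in 𝓝 m, HasDerivAt Φ (Φ' y) y)
    (h2 : HasDerivAt Φ' d m) {ε : ℝ} (hε : 0 < ε) :
    ∀ᶠ x in 𝓝 (0 : ℝ), |Φ (m + x) - Φ m - Φ' m * x - 1 / 2 * d * x ^ 2| ≤ ε * x ^ 2 := by
  have h3 : HasFDerivAt (fun y => ContinuousLinearMap.toSpanSingleton ℝ (Φ' y))
      ((ContinuousLinearMap.toSpanSingletonCLE (𝕜 := ℝ) (E := ℝ) :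
        ℝ →L[ℝ] ℝ →L[ℝ] ℝ).comp (ContinuousLinearMap.toSpanSingleton ℝ d)) m :=
    (ContinuousLinearMap.toSpanSingletonCLE (𝕜 := ℝ) (E := ℝ) :
        ℝ →L[ℝ] ℝ →L[ℝ] ℝ).hasFDerivAt.comp m h2.hasFDerivAt
  have h4 := taylor_second_order (f := Φ) (f' := fun y => ContinuousLinearMap.toSpanSingleton ℝ (Φ' y))
    (h1.mono fun y hy => hy.hasFDerivAt) h3 hε
  filter_upwards [h4] with x hx
  simp at hx
  convert hx using 2
  ring

end ScalarCalculus

/-! ### Chain rule for superjets -/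

section Superjets

variable {S : Type*} [NormedAddCommGroup S] [InnerProductSpace ℝ S]

/-- The squared quadratic model differs from the square of its linear spatial part by a term
negligible for superjets. -/
theorem exists_abs_sq_sub_sq_le (θ : S) (X : S →L[ℝ] S) (a e c : ℝ) {ε : ℝ} (hε : 0 < ε) :
    ∃ C : ℝ, ∀ᶠ z in 𝓝 (0 : S × ℝ),
      |(inner ℝ θ z.1 + a * z.2 + 1 / 2 * inner ℝ (X z.1) z.1 + e * ‖z.1‖ ^ 2 + c * z.2 ^ 2) ^ 2 -
        inner ℝ θ z.1 ^ 2| ≤ ε * ‖z.1‖ ^ 2 + C * z.2 ^ 2 := by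
  set A := |a| + |c| with hA
  set K := 1 / 2 * ‖X‖ + |e| with hK
  have hA0 : 0 ≤ A := by positivity
  have hK0 : 0 ≤ K := by positivity
  set B := 2 * ‖θ‖ + K with hB
  have hB0 : 0 ≤ B := by positivity
  -- Within this radius the quadratic terms in `‖z.1‖` are at most `δ` times a linear one, which
  -- makes their product with the gradient term negligible.
  set δ := min 1 (ε / (2 * (K * B + 1))) with hδ
  have hδ0 : 0 < δ := by positivity
  have hδ1 : δ ≤ 1 := min_le_left _ _
  have hδ2 : K * B * δ ≤ ε / 2 := by
    have := min_le_right 1 (ε / (2 * (K * B + 1)))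
    rw [← hδ, le_div_iff₀ (by positivity)] at this
    nlinarith
  set G := A * B + K * A with hG
  have hG0 : 0 ≤ G := by positivity
  refine ⟨A ^ 2 + 1 / 2 * (1 / ε * G ^ 2), ?_⟩
  filter_upwards [Metric.ball_mem_nhds (0 : S × ℝ) hδ0] with z hz
  rw [mem_ball_zero_iff, Prod.norm_def, max_lt_iff, Real.norm_eq_abs] at hz
  set α := ‖z.1‖
  set β := |z.2|
  have hα0 : 0 ≤ α := norm_nonneg _
  have hβ0 : 0 ≤ β := abs_nonneg _
  have hβz : z.2 ^ 2 = β ^ 2 := (sq_abs _).symm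
  set L := inner ℝ θ z.1
  have hL : |L| ≤ ‖θ‖ * α := abs_real_inner_le_norm _ _
  set ρ := a * z.2 + 1 / 2 * inner ℝ (X z.1) z.1 + e * ‖z.1‖ ^ 2 + c * z.2 ^ 2 with hρ
  have hρle : |ρ| ≤ A * β + K * δ * α := by
    have h1 : |1 / 2 * inner ℝ (X z.1) z.1| ≤ 1 / 2 * ‖X‖ * α ^ 2 := by
      rw [abs_mul, abs_of_pos (by norm_num : (0 : ℝ) < 1 / 2), mul_assoc, pow_two, ← mul_assoc ‖X‖]
      refine mul_le_mul_of_nonneg_left ((abs_real_inner_le_norm _ _).trans ?_) (by norm_num)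
      exact mul_le_mul_of_nonneg_right (X.le_opNorm _) (norm_nonneg _)
    have h2 : |e * ‖z.1‖ ^ 2| = |e| * α ^ 2 := by rw [abs_mul, abs_of_nonneg (sq_nonneg ‖z.1‖)]
    have h3 : |c * z.2 ^ 2| = |c| * β ^ 2 := by rw [abs_mul, abs_of_nonneg (sq_nonneg z.2), hβz]
    have h4 : |a * z.2| = |a| * β := abs_mul _ _
    have h5 : |ρ| ≤ |a| * β + 1 / 2 * ‖X‖ * α ^ 2 + |e| * α ^ 2 + |c| * β ^ 2 := by
      rw [hρ]
      refine (abs_add_le _ _).trans ?_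
      rw [h3]
      gcongr
      refine (abs_add_le _ _).trans ?_
      rw [h2]
      gcongr
      refine (abs_add_le _ _).trans ?_
      rw [h4]
      gcongr
    have h6 : α ^ 2 ≤ δ * α := by
      rw [pow_two]
      exact mul_le_mul_of_nonneg_right hz.1.le hα0
    have h7 : β ^ 2 ≤ β := by
      rw [pow_two]
      exact mul_le_of_le_one_left hβ0 (hz.2.le.trans hδ1)
    have h8 := mul_le_mul_of_nonneg_left h6 hK0
    have h9 := mul_le_mul_of_nonneg_left h7 (abs_nonneg c)
    simp only [hA, hK] at h8 ⊢
    linarith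
  have hsum : |2 * L + ρ| ≤ B * α + A * β := by
    refine (abs_add_le _ _).trans ?_
    rw [abs_mul, abs_of_pos (by norm_num : (0 : ℝ) < 2)]
    have : K * δ * α ≤ K * 1 * α := by gcongr
    simp only [hB]
    linarith
  have heq : (L + a * z.2 + 1 / 2 * inner ℝ (X z.1) z.1 + e * ‖z.1‖ ^ 2 + c * z.2 ^ 2) ^ 2 -
      L ^ 2 = ρ * (2 * L + ρ) := by
    rw [hρ]
    ring
  rw [heq, abs_mul, hβz]
  have h1 : |ρ| * |2 * L + ρ| ≤ (A * β + K * δ * α) * (B * α + A * β) :=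
    mul_le_mul hρle hsum (abs_nonneg _) (by positivity)
  have h2 : (A * β + K * δ * α) * (B * α + A * β) =
      K * B * δ * α ^ 2 + A ^ 2 * β ^ 2 + (A * B + δ * (K * A)) * (α * β) := by ring
  have h3 : (A * B + δ * (K * A)) * (α * β) ≤ G * (α * β) := by
    refine mul_le_mul_of_nonneg_right ?_ (by positivity)
    have : δ * (K * A) ≤ 1 * (K * A) := mul_le_mul_of_nonneg_right hδ1 (by positivity)
    simp only [hG]
    linarith
  have h4 := two_mul_le_add_sq_div (a := α) (b := G * β) hε
  have h5 := mul_le_mul_of_nonneg_right hδ2 (sq_nonneg α)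
  rw [mul_pow] at h4
  rw [h2] at h1
  have h6 : (A ^ 2 + 1 / 2 * (1 / ε * G ^ 2)) * β ^ 2 =
      A ^ 2 * β ^ 2 + 1 / 2 * (1 / ε * (G ^ 2 * β ^ 2)) := by ring
  have h7 : G * (α * β) = α * (G * β) := by ring
  have h8 : ε / 2 * α ^ 2 = 1 / 2 * (ε * α ^ 2) := by ring
  rw [h6]
  rw [h7] at h3
  rw [h8] at h5
  linarith

/-- The rank-one operator `x ↦ ⟪θ, x⟫ θ`. -/
def rankOne (θ : S) : S →L[ℝ] S := (innerSL ℝ θ).smulRight θ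

theorem inner_rankOne (θ x y : S) : inner ℝ (rankOne θ x) y = inner ℝ θ x * inner ℝ θ y := by
  simp [rankOne, real_inner_smul_left]

/-- Superjets are transported by nondecreasing twice differentiable functions. -/
theorem IsSuperjet.comp {v : S × ℝ → ℝ} {p : S × ℝ} {θ : S} {a : ℝ} {X : S →L[ℝ] S}
    (hv : IsSuperjet v p θ a X) {Φ Φ' : ℝ → ℝ} {d : ℝ} {J : Set ℝ} (hmono : MonotoneOn Φ J)
    (hJ : J ∈ 𝓝 (v p)) (hvJ : ∀ᶠ q in 𝓝 p, v q ∈ J)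
    (h1 : ∀ᶠ y in 𝓝 (v p), HasDerivAt Φ (Φ' y) y) (h2 : HasDerivAt Φ' d (v p)) :
    IsSuperjet (fun q => Φ (v q)) p (Φ' (v p) • θ) (Φ' (v p) * a)
      (Φ' (v p) • X + d • rankOne θ) := by
  intro ε hε
  set m := v p
  set d₁ := Φ' m
  set ε₁ := ε / (4 * (|d₁| + 1)) with hε₁
  have hε₁0 : 0 < ε₁ := by positivity
  have hd₁ : d₁ * ε₁ ≤ ε / 4 := by
    have : ε₁ * (4 * (|d₁| + 1)) = ε := div_mul_cancel₀ _ (by positivity)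
    nlinarith [le_abs_self d₁]
  obtain ⟨C₁, hC₁⟩ := hv ε₁ hε₁0
  set ε₂ := min 1 (ε / (4 * (‖θ‖ ^ 2 + 1))) with hε₂
  have hε₂0 : 0 < ε₂ := by positivity
  have hε₂θ : ε₂ * ‖θ‖ ^ 2 ≤ ε / 4 := by
    have h := min_le_right 1 (ε / (4 * (‖θ‖ ^ 2 + 1)))
    rw [← hε₂, le_div_iff₀ (by positivity)] at h
    nlinarith
  set k := |1 / 2 * d| + 1 with hk
  have hk0 : 0 < k := by positivity
  have hk1 : |1 / 2 * d + ε₂| ≤ k := by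
    refine (abs_add_le _ _).trans ?_
    rw [abs_of_pos hε₂0, hk]
    linarith [min_le_left 1 (ε / (4 * (‖θ‖ ^ 2 + 1)))]
  obtain ⟨C₂, hC₂⟩ := exists_abs_sq_sub_sq_le θ X a ε₁ C₁ (ε := ε / (4 * k)) (by positivity)
  refine ⟨d₁ * C₁ + k * C₂, ?_⟩
  set x : S × ℝ → ℝ := fun z => inner ℝ θ z.1 + a * z.2 + 1 / 2 * inner ℝ (X z.1) z.1 +
    ε₁ * ‖z.1‖ ^ 2 + C₁ * z.2 ^ 2 with hx
  have hx0 : Tendsto x (𝓝 0) (𝓝 0) := by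
    have hc : Continuous x := by fun_prop
    have := hc.tendsto 0
    simpa [hx] using this
  have hmx : Tendsto (fun z => m + x z) (𝓝 0) (𝓝 m) := by simpa using hx0.const_add m
  have hpz : Tendsto (fun z : S × ℝ => p + z) (𝓝 0) (𝓝 p) := by
    have hc : Continuous fun z : S × ℝ => p + z := by fun_prop
    simpa using hc.tendsto 0
  filter_upwards [hC₁, hC₂, hx0.eventually (scalar_taylor h1 h2 hε₂0), hmx.eventually hJ,
    hpz.eventually hvJ] with z hz1 hz2 hz3 hz4 hz5
  have hz1' : v (p + z) ≤ m + x z := by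
    simp only [hx]
    linarith
  -- Only the upper bound on `v` is available, so monotonicity is what lets `Φ` be expanded on the
  -- quadratic model instead.
  have h3 : Φ (v (p + z)) ≤ Φ (m + x z) := hmono hz5 hz4 hz1'
  have h4 := (abs_le.1 hz3).2
  set L := inner ℝ θ z.1 with hL
  have h5 : |x z ^ 2 - L ^ 2| ≤ ε / (4 * k) * ‖z.1‖ ^ 2 + C₂ * z.2 ^ 2 := hz2
  have h6 : (1 / 2 * d + ε₂) * (x z ^ 2 - L ^ 2) ≤ k * (ε / (4 * k) * ‖z.1‖ ^ 2 + C₂ * z.2 ^ 2) := by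
    refine (le_abs_self _).trans ?_
    rw [abs_mul]
    exact mul_le_mul hk1 h5 (abs_nonneg _) hk0.le
  have h7 : k * (ε / (4 * k) * ‖z.1‖ ^ 2 + C₂ * z.2 ^ 2) =
      ε / 4 * ‖z.1‖ ^ 2 + k * C₂ * z.2 ^ 2 := by field_simp
  have h8 : L ^ 2 ≤ ‖θ‖ ^ 2 * ‖z.1‖ ^ 2 := by
    rw [← mul_pow, ← sq_abs]
    exact pow_le_pow_left₀ (abs_nonneg _) (abs_real_inner_le_norm _ _) 2
  have h9 := mul_le_mul_of_nonneg_left h8 hε₂0.le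
  have h10 := mul_le_mul_of_nonneg_right hε₂θ (sq_nonneg ‖z.1‖)
  have h11 := mul_le_mul_of_nonneg_right hd₁ (sq_nonneg ‖z.1‖)
  have h12 : inner ℝ ((d₁ • X + d • rankOne θ) z.1) z.1 = d₁ * inner ℝ (X z.1) z.1 + d * L ^ 2 := by
    rw [add_apply, smul_apply, smul_apply, inner_add_left, real_inner_smul_left, real_inner_smul_left,
      inner_rankOne]
    ring
  rw [h12, real_inner_smul_left]
  have h13 : d₁ * x z = d₁ * L + d₁ * a * z.2 + 1 / 2 * (d₁ * inner ℝ (X z.1) z.1) +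
      d₁ * ε₁ * ‖z.1‖ ^ 2 + d₁ * C₁ * z.2 ^ 2 := by
    simp only [hx, hL]
    ring
  have h14 : 0 ≤ ε * ‖z.1‖ ^ 2 := by positivity
  rw [h13] at h4
  rw [h7] at h6
  rw [← hL]
  linarith

end Superjets

/-! ### Test functions, superjets and the viscosity inequality -/

section Jets

variable {n : ℕ}

/-- The operator on Euclidean space with a given matrix. -/
abbrev matrixCLM (X : Matrix (Fin n) (Fin n) ℝ) : Space n →L[ℝ] Space n :=
  Matrix.toEuclideanCLM (n := Fin n) (𝕜 := ℝ) X

theorem inner_matrixCLM_single (X : Matrix (Fin n) (Fin n) ℝ) (i j : Fin n) :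
    inner ℝ (EuclideanSpace.single i (1 : ℝ)) (matrixCLM X (EuclideanSpace.single j 1)) =
      X i j := by
  rw [Matrix.inner_toEuclideanCLM]
  simp

theorem inner_matrixCLM_comm {X : Matrix (Fin n) (Fin n) ℝ} (hX : X.IsSymm) (x y : Space n) :
    inner ℝ (matrixCLM X x) y = inner ℝ (matrixCLM X y) x := by
  rw [real_inner_comm, Matrix.inner_toEuclideanCLM, real_inner_comm, Matrix.inner_toEuclideanCLM,
    Matrix.dotProduct_mulVec, ← Matrix.mulVec_transpose, hX, dotProduct_comm]

theorem inner_matrixCLM_of_bilin {X : Matrix (Fin n) (Fin n) ℝ} {B : Space n →L[ℝ] Space n →L[ℝ] ℝ}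
    (hB : ∀ i j, X i j = B (EuclideanSpace.single i 1) (EuclideanSpace.single j 1))
    (h k : Space n) : inner ℝ h (matrixCLM X k) = B h k := by
  have key : ∀ h : Space n, h = ∑ i, h i • EuclideanSpace.single i (1 : ℝ) := fun h => by
    ext j
    simp [Finset.sum_apply, Pi.single_apply]
  conv_lhs => rw [key h, key k]
  conv_rhs => rw [key h, key k]
  simp only [map_sum, map_smul, sum_inner, inner_sum, real_inner_smul_left, real_inner_smul_right,
    inner_matrixCLM_single, hB, sum_apply, smul_apply, smul_eq_mul]
  simp only [Finset.mul_sum]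

/-- Identifies the partial derivatives used in the definition of a subsolution with the blocks of
the full first and second derivatives, through the embedding `y ↦ (y, t)`. -/
theorem jet_eq_of_hasFDerivAt {φ : Space n × ℝ → ℝ} {p : Space n × ℝ}
    {φ' : Space n × ℝ → Space n × ℝ →L[ℝ] ℝ} {φ'' : Space n × ℝ →L[ℝ] Space n × ℝ →L[ℝ] ℝ}
    (h1 : ∀ᶠ q in 𝓝 p, HasFDerivAt φ (φ' q) q) (h2 : HasFDerivAt φ' φ'' p) :
    timeDeriv φ p = φ' p (0, 1) ∧ (∀ h, inner ℝ (spatialGradient φ p) h = φ' p (h, 0)) ∧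
      ∀ i j, spatialHessian φ p i j =
        φ'' (EuclideanSpace.single i 1, 0) (EuclideanSpace.single j 1, 0) := by
  have hin : ∀ y : Space n, HasFDerivAt (fun z : Space n => (z, p.2))
      (ContinuousLinearMap.inl ℝ (Space n) ℝ) y := fun y => hasFDerivAt_prodMk_left y p.2
  have hx : ∀ᶠ y in 𝓝 p.1, HasFDerivAt (fun z => φ (z, p.2))
      ((φ' (y, p.2)).comp (ContinuousLinearMap.inl ℝ (Space n) ℝ)) y := by
    have hc : Tendsto (fun y : Space n => (y, p.2)) (𝓝 p.1) (𝓝 p) :=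
      (hin p.1).continuousAt
    filter_upwards [hc.eventually h1] with y hy
    exact hy.comp y (hin y)
  refine ⟨?_, ?_, ?_⟩
  · have h3 : HasDerivAt (fun s : ℝ => (p.1, s)) ((0 : Space n), (1 : ℝ)) p.2 :=
      (hasDerivAt_const p.2 p.1).prodMk (hasDerivAt_id p.2)
    exact (h1.self_of_nhds.comp_hasDerivAt p.2 h3).deriv
  · intro h
    rw [spatialGradient, gradient, InnerProductSpace.toDual_symm_apply, hx.self_of_nhds.fderiv]
    simp
  · intro i j
    have h4 : (fun y => fderiv ℝ (fun z => φ (z, p.2)) y) =ᶠ[𝓝 p.1] fun y =>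
        (φ' (y, p.2)).comp (ContinuousLinearMap.inl ℝ (Space n) ℝ) := hx.mono fun y hy => hy.fderiv
    have h5 : HasFDerivAt (fun y : Space n => φ' (y, p.2))
        (φ''.comp (ContinuousLinearMap.inl ℝ (Space n) ℝ)) p.1 := h2.comp p.1 (hin p.1)
    have h6 : HasFDerivAt
        (fun y : Space n => (φ' (y, p.2)).comp (ContinuousLinearMap.inl ℝ (Space n) ℝ)) _ p.1 :=
      h5.clm_comp (hasFDerivAt_const _ _)
    rw [spatialHessian, Matrix.of_apply, h4.fderiv_eq, h6.fderiv]
    simp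

theorem spatialHessian_isSymm {φ : Space n × ℝ → ℝ} {p : Space n × ℝ}
    (hφ : ContDiffAt ℝ 2 φ p) : (spatialHessian φ p).IsSymm := by
  have h1 : ∀ᶠ q in 𝓝 p, HasFDerivAt φ (fderiv ℝ φ q) q :=
    (hφ.eventually (by simp)).mono fun q hq => (hq.differentiableAt (by simp)).hasFDerivAt
  have h2 : HasFDerivAt (fderiv ℝ φ) (fderiv ℝ (fderiv ℝ φ) p) p :=
    ((hφ.fderiv_right (m := 1) (by norm_num)).differentiableAt (by simp)).hasFDerivAt
  ext i j
  rw [Matrix.transpose_apply, (jet_eq_of_hasFDerivAt h1 h2).2.2, (jet_eq_of_hasFDerivAt h1 h2).2.2]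
  exact second_derivative_symmetric_of_eventually h1 h2 _ _

/-- A function touched from above by a twice differentiable one has its jet as a superjet. -/
theorem isSuperjet_of_test {U φ : Space n × ℝ → ℝ} {p : Space n × ℝ} (hφ : ContDiffAt ℝ 2 φ p)
    (hU : ∀ᶠ q in 𝓝 p, U q - φ q ≤ U p - φ p) :
    IsSuperjet U p (spatialGradient φ p) (timeDeriv φ p) (matrixCLM (spatialHessian φ p)) := by
  have h1 : ∀ᶠ q in 𝓝 p, HasFDerivAt φ (fderiv ℝ φ q) q :=
    (hφ.eventually (by simp)).mono fun q hq => (hq.differentiableAt (by simp)).hasFDerivAt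
  have h2 : HasFDerivAt (fderiv ℝ φ) (fderiv ℝ (fderiv ℝ φ) p) p :=
    ((hφ.fderiv_right (m := 1) (by norm_num)).differentiableAt (by simp)).hasFDerivAt
  obtain ⟨ht, hg, hH⟩ := jet_eq_of_hasFDerivAt h1 h2
  set l := fderiv ℝ φ p
  set B := fderiv ℝ (fderiv ℝ φ) p
  have hsymm : ∀ v w, B v w = B w v := second_derivative_symmetric_of_eventually h1 h2
  have hH' : ∀ h k : Space n, inner ℝ h (matrixCLM (spatialHessian φ p) k) = B (h, 0) (k, 0) := by
    have := inner_matrixCLM_of_bilin (X := spatialHessian φ p)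
      (B := B.bilinearComp (ContinuousLinearMap.inl ℝ (Space n) ℝ)
        (ContinuousLinearMap.inl ℝ (Space n) ℝ)) (by simpa using hH)
    simpa using this
  intro ε hε
  set b := ‖B‖
  refine ⟨1 / 2 * (2 * (1 / ε) * b ^ 2) + 1 / 2 * b + ε / 2, ?_⟩
  have hpz : Tendsto (fun z : Space n × ℝ => p + z) (𝓝 0) (𝓝 p) := by
    have hc : Continuous fun z : Space n × ℝ => p + z := by fun_prop
    simpa using hc.tendsto 0
  filter_upwards [taylor_second_order h1 h2 (half_pos hε), hpz.eventually hU] with z hz1 hz2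
  have hz : z = (z.1, 0) + z.2 • ((0 : Space n), (1 : ℝ)) := by
    ext <;> simp
  have hl : l z = inner ℝ (spatialGradient φ p) z.1 + timeDeriv φ p * z.2 := by
    conv_lhs => rw [hz]
    rw [map_add, map_smul, hg, ht, smul_eq_mul, mul_comm (z.2)]
  have hB : B z z = inner ℝ (matrixCLM (spatialHessian φ p) z.1) z.1 +
      2 * (z.2 * B (z.1, 0) (0, 1)) + z.2 ^ 2 * B (0, 1) (0, 1) := by
    rw [real_inner_comm, hH']
    conv_lhs => rw [hz]
    simp only [map_add, map_smul, add_apply, smul_apply, smul_eq_mul,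
      hsymm (0, 1) (z.1, 0)]
    ring
  have hn1 : ‖((0 : Space n), (1 : ℝ))‖ = 1 := by simp [Prod.norm_def]
  have hn2 : ‖(z.1, (0 : ℝ))‖ = ‖z.1‖ := by simp [Prod.norm_def]
  have hb1 : |B (z.1, 0) (0, 1)| ≤ b * ‖z.1‖ := by
    have := B.le_opNorm₂ (z.1, 0) (0, 1)
    rwa [hn1, hn2, mul_one] at this
  have hb2 : |B ((0 : Space n), (1 : ℝ)) (0, 1)| ≤ b := by
    have := B.le_opNorm₂ ((0 : Space n), (1 : ℝ)) (0, 1)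
    rwa [hn1, mul_one, mul_one] at this
  have hzn : ‖z‖ ^ 2 ≤ ‖z.1‖ ^ 2 + z.2 ^ 2 := by
    rw [Prod.norm_def, Real.norm_eq_abs]
    rcases max_choice ‖z.1‖ |z.2| with h | h <;> rw [h]
    · nlinarith [sq_nonneg z.2]
    · rw [sq_abs]
      nlinarith [sq_nonneg ‖z.1‖]
  have hcross : z.2 * B (z.1, 0) (0, 1) ≤ ‖z.1‖ * (b * |z.2|) := by
    refine (le_abs_self _).trans ?_
    rw [abs_mul]
    refine (mul_le_mul_of_nonneg_left hb1 (abs_nonneg _)).trans (le_of_eq (by ring))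
  have hcross' := two_mul_le_add_sq_div (a := ‖z.1‖) (b := b * |z.2|) (half_pos hε)
  have hε' : 1 / (ε / 2) * (b * |z.2|) ^ 2 = 2 * (1 / ε) * b ^ 2 * z.2 ^ 2 := by
    rw [mul_pow, sq_abs]
    field_simp
  have htt : z.2 ^ 2 * B ((0 : Space n), (1 : ℝ)) (0, 1) ≤ b * z.2 ^ 2 := by
    rw [mul_comm]
    exact mul_le_mul_of_nonneg_right ((le_abs_self _).trans hb2) (sq_nonneg _)
  have hz3 := (abs_le.1 hz1).2
  rw [hl, hB] at hz3
  rw [hε'] at hcross'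
  have h7 := mul_le_mul_of_nonneg_left hzn (half_pos hε).le
  have h8 : 0 ≤ ε * ‖z.1‖ ^ 2 := by positivity
  linarith

/-- An upper semicontinuous function on a closed set has a smooth majorant. -/
theorem exists_contDiff_majorant {E : Type*} [NormedAddCommGroup E] [NormedSpace ℝ E]
    [FiniteDimensional ℝ E] {K : Set E} (hK : IsClosed K) {u : E → ℝ}
    (hu : UpperSemicontinuousOn u K) : ∃ g : E → ℝ, ContDiff ℝ 2 g ∧ ∀ x ∈ K, u x ≤ g x := by
  obtain ⟨g, hg⟩ := exists_contMDiffMap_forall_mem_convex_of_local_const (n := 2)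
    (modelWithCornersSelf ℝ E) (t := fun x => {c : ℝ | x ∈ K → u x ≤ c}) (fun x => by
      intro a ha b hb s t hs ht hst hx
      calc u x = s * u x + t * u x := by rw [← add_mul, hst, one_mul]
        _ ≤ s • a + t • b := add_le_add (mul_le_mul_of_nonneg_left (ha hx) hs)
            (mul_le_mul_of_nonneg_left (hb hx) ht)) (fun x => by
      -- On `K` the constant `u x + 1` works nearby by upper semicontinuity. Off the closed set `K`
      -- the condition is locally void. A partition of unity glues these local choices.
      by_cases hx : x ∈ K
      · refine ⟨u x + 1, ?_⟩
        have := hu x hx (u x + 1) (by linarith)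
        rw [eventually_nhdsWithin_iff] at this
        exact this.mono fun y hy hyK => (hy hyK).le
      · exact ⟨0, (hK.isOpen_compl.eventually_mem hx).mono fun y hy hyK => absurd hyK hy⟩)
  exact ⟨g, g.contMDiff.contDiff, fun x hx => hg x hx⟩

theorem IsContinuousOperator.tendsto {O : Set (Space n × ℝ)} {F : Operator n}
    (hF : IsContinuousOperator O F) {ι : Type*} {l : Filter ι} {x : ι → Space n} {t r : ι → ℝ}
    {η : ι → Space n} {X : ι → Matrix (Fin n) (Fin n) ℝ} {x₀ : Space n} {t₀ r₀ : ℝ}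
    {η₀ : Space n} {X₀ : Matrix (Fin n) (Fin n) ℝ} (hO : IsOpen O) (h0 : (x₀, t₀) ∈ O)
    (hr0 : 0 < r₀) (hX0 : X₀.IsSymm) (hx : Tendsto x l (𝓝 x₀)) (ht : Tendsto t l (𝓝 t₀))
    (hr : Tendsto r l (𝓝 r₀)) (hη : Tendsto η l (𝓝 η₀)) (hX : Tendsto X l (𝓝 X₀))
    (hXs : ∀ᶠ i in l, (X i).IsSymm) :
    Tendsto (fun i => F (x i) (t i) (r i) (η i) (X i)) l (𝓝 (F x₀ t₀ r₀ η₀ X₀)) := by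
  have h1 := hF (x₀, t₀, r₀, η₀, X₀) ⟨h0, hr0, hX0⟩
  have h2 : Tendsto (fun i => (x i, t i, r i, η i, X i)) l (𝓝 (x₀, t₀, r₀, η₀, X₀)) :=
    hx.prodMk_nhds (ht.prodMk_nhds (hr.prodMk_nhds (hη.prodMk_nhds hX)))
  refine Tendsto.comp (g := fun q : Space n × ℝ × ℝ × Space n × Matrix (Fin n) (Fin n) ℝ =>
      F q.1 q.2.1 q.2.2.1 q.2.2.2.1 q.2.2.2.2) h1 (tendsto_nhdsWithin_iff.2 ⟨h2, ?_⟩)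
  filter_upwards [(hx.prodMk_nhds ht).eventually (hO.eventually_mem h0),
    hr.eventually (eventually_gt_nhds hr0), hXs] with i h1 h2 h3
  exact ⟨h1, h2, h3⟩

/-- The inner product as a continuous bilinear form. -/
def innerCLM : Space n →L[ℝ] Space n →L[ℝ] ℝ := innerSL ℝ

theorem innerCLM_apply (x y : Space n) : innerCLM x y = inner ℝ x y := rfl

/-- A test function has to be `C²` and dominate `u` on all of `O`, whereas the quadratic polynomial
dominates only near `p`. A bump function glues the polynomial to a smooth global majorant, which
exists because `u` is upper semicontinuous up to the closure. -/
theorem IsViscositySubsolution.superjet_strict {O : Set (Space n × ℝ)}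
    {F : Operator n} {u : Space n × ℝ → ℝ} (hu : IsViscositySubsolution O F u)
    (husc : UpperSemicontinuousOn u (closure O)) {p : Space n × ℝ} (hp : p ∈ O)
    {θ : Space n} {a C : ℝ} {A : Matrix (Fin n) (Fin n) ℝ} (hA : A.IsSymm)
    (hle : ∀ᶠ z in 𝓝 (0 : Space n × ℝ), u (p + z) ≤ u p + inner ℝ θ z.1 + a * z.2 +
      1 / 2 * inner ℝ (matrixCLM A z.1) z.1 + C * z.2 ^ 2) :
    a + F p.1 p.2 (u p) θ A ≤ 0 := by
  set l : Space n × ℝ →L[ℝ] ℝ := (innerSL ℝ θ).comp (ContinuousLinearMap.fst ℝ (Space n) ℝ) +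
    a • ContinuousLinearMap.snd ℝ (Space n) ℝ with hl
  set B : Space n × ℝ →L[ℝ] Space n × ℝ →L[ℝ] ℝ :=
    ((innerCLM.comp (matrixCLM A)).bilinearComp (ContinuousLinearMap.fst ℝ (Space n) ℝ)
      (ContinuousLinearMap.fst ℝ (Space n) ℝ)) +
    (2 * C) • (ContinuousLinearMap.snd ℝ (Space n) ℝ).smulRight
      (ContinuousLinearMap.snd ℝ (Space n) ℝ) with hB
  have hlz : ∀ z, l z = inner ℝ θ z.1 + a * z.2 := fun z => by simp [hl]
  have hBz : ∀ z w, B z w = inner ℝ (matrixCLM A z.1) w.1 + 2 * C * (z.2 * w.2) := fun z w => by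
    simp [hB, innerCLM_apply]
  have hBs : ∀ z w, B z w = B w z := fun z w => by
    rw [hBz, hBz, inner_matrixCLM_comm hA, mul_comm z.2]
  set P : Space n × ℝ → ℝ := fun q => l (q - p) + 1 / 2 * B (q - p) (q - p) with hP
  have hPd : ∀ q, HasFDerivAt P (l + B (q - p)) q := by
    intro q
    have h1 : HasFDerivAt (fun q : Space n × ℝ => q - p) (ContinuousLinearMap.id ℝ _) q :=
      (hasFDerivAt_id q).sub_const p
    have h2 := (l.hasFDerivAt (x := q - p)).comp q h1
    have h3 := ((B.hasFDerivAt (x := q - p)).comp q h1).clm_apply h1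
    refine (h2.add (h3.const_mul (1 / 2))).congr_fderiv ?_
    refine ContinuousLinearMap.ext fun z => ?_
    have := hBs z (q - p)
    simp only [map_sub, sub_apply] at this
    simp
    linarith
  have hPd2 : HasFDerivAt (fun q => l + B (q - p)) B p := by
    have h1 : HasFDerivAt (fun q : Space n × ℝ => q - p) (ContinuousLinearMap.id ℝ _) p :=
      (hasFDerivAt_id p).sub_const p
    exact (HasFDerivAt.comp (g := B) p B.hasFDerivAt h1).const_add l
  have hPc : ContDiff ℝ 2 P := by
    have h1 : ContDiff ℝ 2 fun q : Space n × ℝ => q - p := contDiff_id.sub contDiff_const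
    exact (l.contDiff.comp h1).add (contDiff_const.mul ((B.contDiff.comp h1).clm_apply h1))
  have hPp : P p = 0 := by simp [hP]
  have hleP : ∀ᶠ q in 𝓝 p, u q ≤ u p + P q := by
    have hc : Tendsto (fun q : Space n × ℝ => q - p) (𝓝 p) (𝓝 0) := by
      have hc : Continuous fun q : Space n × ℝ => q - p := by fun_prop
      simpa using hc.tendsto p
    filter_upwards [hc.eventually hle] with q hq
    rw [add_sub_cancel] at hq
    simp only [hP, hlz, hBz]
    refine hq.trans (le_of_eq (by ring))
  obtain ⟨R, hR, hRP⟩ := Metric.eventually_nhds_iff_ball.1 hleP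
  obtain ⟨g, hgc, hgu⟩ := exists_contDiff_majorant isClosed_closure husc
  let χ : ContDiffBump p := ⟨R / 2, R, by positivity, by linarith⟩
  -- Equal to `P` near `p`, so the jet is the prescribed one. Elsewhere it is a convex combination
  -- in which each function with nonzero weight lies above `u - u p`.
  set φ : Space n × ℝ → ℝ := fun q => χ q * P q + (1 - χ q) * (g q - u p) with hφ
  have hχc : ContDiff ℝ 2 χ := χ.contDiff (n := 2)
  have hφc : ContDiff ℝ 2 φ :=
    (hχc.mul hPc).add ((contDiff_const.sub hχc).mul (hgc.sub contDiff_const))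
  have hφP : φ =ᶠ[𝓝 p] P := by
    filter_upwards [χ.eventuallyEq_one] with q hq
    simp [hφ, hq]
  have hmax : IsMaxOn (fun q => u q - φ q) O p := by
    intro q hq
    have h1 : u q - u p ≤ φ q := by
      have h2 : (1 - χ q) * (u q - u p) ≤ (1 - χ q) * (g q - u p) :=
        mul_le_mul_of_nonneg_left (by linarith [hgu q (subset_closure hq)])
          (by linarith [χ.le_one (x := q)])
      have h3 : χ q * (u q - u p) ≤ χ q * P q := by
        by_cases hqR : q ∈ Metric.ball p R
        · exact mul_le_mul_of_nonneg_left (by linarith [hRP q hqR]) χ.nonneg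
        · have : χ q = 0 := χ.zero_of_le_dist (by simpa using hqR)
          simp [this]
      simp only [hφ]
      linarith
    have h4 : φ p = 0 := hφP.self_of_nhds.trans hPp
    simp only [mem_ofPred_eq, h4]
    linarith
  have h1 : ∀ᶠ q in 𝓝 p, HasFDerivAt φ (l + B (q - p)) q :=
    hφP.eventuallyEq_nhds.mono fun q hq => (hPd q).congr_of_eventuallyEq hq
  obtain ⟨ht, hg, hH⟩ := jet_eq_of_hasFDerivAt h1 hPd2
  have hθ : spatialGradient φ p = θ := ext_inner_right ℝ fun h => by
    rw [hg]
    simp [hl]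
  have hAH : spatialHessian φ p = A := by
    ext i j
    rw [hH, hBz, real_inner_comm, inner_matrixCLM_single]
    simp [hA.apply]
  have hta : timeDeriv φ p = a := by
    rw [ht]
    simp [hl]
  have := hu.test φ hφc.contDiffOn p hp hmax
  rwa [hθ, hAH, hta] at this

/-- The viscosity inequality holds at every superjet. -/
theorem IsViscositySubsolution.superjet {O : Set (Space n × ℝ)} (hO : IsOpen O)
    {F : Operator n} (hF : IsContinuousOperator O F) {u : Space n × ℝ → ℝ}
    (hu : IsViscositySubsolution O F u)
    (husc : UpperSemicontinuousOn u (closure O)) {p : Space n × ℝ} (hp : p ∈ O) (hup : 0 < u p)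
    {θ : Space n} {a : ℝ} {M : Matrix (Fin n) (Fin n) ℝ} (hM : M.IsSymm)
    (hj : IsSuperjet u p θ a (matrixCLM M)) :
    a + F p.1 p.2 (u p) θ M ≤ 0 := by
  have hs : ∀ ε : ℝ, (M + (2 * ε) • (1 : Matrix (Fin n) (Fin n) ℝ)).IsSymm := fun ε =>
    hM.add (Matrix.isSymm_one.smul _)
  have h1 : ∀ ε : ℝ, 0 < ε →
      a + F p.1 p.2 (u p) θ (M + (2 * ε) • (1 : Matrix (Fin n) (Fin n) ℝ)) ≤ 0 := by
    intro ε hε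
    obtain ⟨C, hC⟩ := hj ε hε
    refine hu.superjet_strict husc hp (hs ε) (C := C) (hC.mono fun z hz => hz.trans (le_of_eq ?_))
    have : inner ℝ (matrixCLM (M + (2 * ε) • (1 : Matrix (Fin n) (Fin n) ℝ)) z.1) z.1 =
        inner ℝ (matrixCLM M z.1) z.1 + 2 * ε * ‖z.1‖ ^ 2 := by
      rw [matrixCLM, map_add, map_smul, map_one, add_apply, smul_apply, inner_add_left,
        real_inner_smul_left, one_apply_eq_self, real_inner_self_eq_norm_sq]
    rw [this]
    ring
  -- Absorbing the error `ε ‖z.1‖²` in the Hessian costs `2ε` times the identity, which disappears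
  -- by continuity of `F`.
  have h2 : Tendsto (fun ε : ℝ => a + F p.1 p.2 (u p) θ
      (M + (2 * ε) • (1 : Matrix (Fin n) (Fin n) ℝ))) (𝓝[>] 0) (𝓝 (a + F p.1 p.2 (u p) θ M)) := by
    refine tendsto_const_nhds.add (hF.tendsto hO hp hup hM tendsto_const_nhds tendsto_const_nhds
      tendsto_const_nhds tendsto_const_nhds ?_ (Eventually.of_forall hs))
    have hc : Continuous fun ε : ℝ => M + (2 * ε) • (1 : Matrix (Fin n) (Fin n) ℝ) := by fun_prop
    have h3 := hc.tendsto 0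
    rw [mul_zero, zero_smul, add_zero] at h3
    exact h3.mono_left nhdsWithin_le_nhds
  exact le_of_tendsto h2 (eventually_mem_nhdsWithin.mono fun ε hε => h1 ε hε)

end Jets

/-! ### The power transform and the transformed operator -/

section PowerTransform

/-- The increasing transformation turning power means into arithmetic means. -/
def powTransform (α u : ℝ) : ℝ :=
  open Classical in if α = 0 then Real.log u else u ^ α / α

/-- The range of `powTransform α` on the positive half-line. -/
def powRange (α : ℝ) : Set ℝ := {v | α ≠ 0 → v < 0}

/-- The inverse of `powTransform α`. -/
def powInverse (α v : ℝ) : ℝ :=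
  open Classical in if α = 0 then Real.exp v else (α * v) ^ (1 / α)

theorem isOpen_powRange (α : ℝ) : IsOpen (powRange α) := by
  by_cases h : α = 0
  · simp [powRange, h]
  · have : powRange α = Iio 0 := by
      ext v
      simp [powRange, h]
    exact this ▸ isOpen_Iio

theorem convex_powRange (α : ℝ) : Convex ℝ (powRange α) := by
  intro a ha b hb s t hs ht hst h
  have ha' := ha h
  have hb' := hb h
  simp only [smul_eq_mul]
  rcases hs.eq_or_lt with rfl | hs
  · simp only [zero_add] at hst
    simpa [hst] using hb'
  · nlinarith

variable {α : ℝ}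

theorem powTransform_mem (hα : α ≤ 0) {u : ℝ} (hu : 0 < u) : powTransform α u ∈ powRange α := by
  intro h
  rw [powTransform, if_neg h]
  exact div_neg_of_pos_of_neg (Real.rpow_pos_of_pos hu α) (lt_of_le_of_ne hα h)

theorem powInverse_pos (hα : α ≤ 0) {v : ℝ} (hv : v ∈ powRange α) : 0 < powInverse α v := by
  unfold powInverse
  split_ifs with h
  · exact Real.exp_pos v
  · exact Real.rpow_pos_of_pos (mul_pos_of_neg_of_neg (lt_of_le_of_ne hα h) (hv h)) _

theorem powInverse_powTransform {u : ℝ} (hu : 0 < u) :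
    powInverse α (powTransform α u) = u := by
  unfold powInverse powTransform
  split_ifs with h
  · exact Real.exp_log hu
  · rw [mul_div_cancel₀ _ h, ← Real.rpow_mul hu.le, mul_one_div_cancel h, Real.rpow_one]

theorem powTransform_powInverse (hα : α ≤ 0) {v : ℝ} (hv : v ∈ powRange α) :
    powTransform α (powInverse α v) = v := by
  unfold powInverse powTransform
  split_ifs with h
  · exact Real.log_exp v
  · rw [← Real.rpow_mul (mul_pos_of_neg_of_neg (lt_of_le_of_ne hα h) (hv h)).le,
      one_div_mul_cancel h, Real.rpow_one, mul_div_cancel_left₀ _ h]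

theorem hasDerivAt_powTransform {u : ℝ} (hu : 0 < u) :
    HasDerivAt (powTransform α) (u ^ (α - 1)) u := by
  unfold powTransform
  by_cases h : α = 0
  · simp only [h, if_true, zero_sub, Real.rpow_neg_one]
    exact Real.hasDerivAt_log hu.ne'
  · simp only [h, if_false]
    refine ((Real.hasDerivAt_rpow_const (Or.inl hu.ne')).div_const α).congr_deriv ?_
    rw [mul_div_cancel_left₀ _ h]

theorem hasDerivAt_powInverse (hα : α ≤ 0) {v : ℝ} (hv : v ∈ powRange α) :
    HasDerivAt (powInverse α) (powInverse α v ^ (1 - α)) v := by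
  unfold powInverse
  by_cases h : α = 0
  · simp only [h, if_true, sub_zero, Real.rpow_one]
    exact Real.hasDerivAt_exp v
  · simp only [h, if_false]
    have hpos := mul_pos_of_neg_of_neg (lt_of_le_of_ne hα h) (hv h)
    have h1 : HasDerivAt (fun v => α * v) α v := by simpa using (hasDerivAt_id v).const_mul α
    refine (h1.rpow_const (p := 1 / α) (Or.inl hpos.ne')).congr_deriv ?_
    rw [← Real.rpow_mul hpos.le, mul_one_div_cancel h, one_mul]
    congr 1
    field_simp

theorem hasDerivAt_powInverse_rpow (hα : α ≤ 0) {v : ℝ} (hv : v ∈ powRange α) :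
    HasDerivAt (fun v => powInverse α v ^ (1 - α)) ((1 - α) * powInverse α v ^ (1 - 2 * α)) v := by
  have hpos := powInverse_pos hα hv
  refine ((hasDerivAt_powInverse hα hv).rpow_const (p := 1 - α) (Or.inl hpos.ne')).congr_deriv ?_
  rw [mul_comm (powInverse α v ^ (1 - α)), mul_assoc, ← Real.rpow_add hpos]
  congr 2
  ring

theorem monotoneOn_powInverse (hα : α ≤ 0) : MonotoneOn (powInverse α) (powRange α) :=
  monotoneOn_of_deriv_nonneg (convex_powRange α)
    (fun v hv => (hasDerivAt_powInverse hα hv).continuousAt.continuousWithinAt)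
    (fun v hv => (hasDerivAt_powInverse hα (interior_subset hv)).differentiableAt.differentiableWithinAt)
    (fun v hv => by
      rw [(hasDerivAt_powInverse hα (interior_subset hv)).deriv]
      exact Real.rpow_nonneg (powInverse_pos hα (interior_subset hv)).le _)

theorem monotoneOn_powTransform : MonotoneOn (powTransform α) (Ioi 0) :=
  monotoneOn_of_deriv_nonneg (convex_Ioi 0)
    (fun v hv => (hasDerivAt_powTransform hv).continuousAt.continuousWithinAt)
    (fun v hv => (hasDerivAt_powTransform (interior_subset hv)).differentiableAt.differentiableWithinAt)
    (fun v hv => by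
      rw [(hasDerivAt_powTransform (interior_subset hv)).deriv]
      exact Real.rpow_nonneg (mem_Ioi.1 (interior_subset hv)).le _)

theorem hasDerivAt_rpow_sub_one {u : ℝ} (hu : 0 < u) :
    HasDerivAt (fun u => u ^ (α - 1)) ((α - 1) * u ^ (α - 2)) u :=
  (Real.hasDerivAt_rpow_const (Or.inl hu.ne')).congr_deriv (by ring_nf)

/-- The power mean is the arithmetic mean conjugated by `powTransform`; dividing by `α` there makes
the transform increasing also for `α < 0`. -/
theorem powerMean_eq {k : ℕ} {a w : Fin k → ℝ} (ha : ∀ i, 0 < a i) :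
    powerMean α a w = powInverse α (∑ i, w i * powTransform α (a i)) := by
  unfold powerMean powInverse powTransform
  rw [if_pos ha]
  split_ifs with h
  · rw [Real.exp_sum]
    refine Finset.prod_congr rfl fun i _ => ?_
    rw [Real.rpow_def_of_pos (ha i), mul_comm]
  · rw [Finset.mul_sum]
    congr 1
    refine Finset.sum_congr rfl fun i _ => ?_
    field_simp

theorem sum_mem_powRange {k : ℕ} {v w : Fin k → ℝ} (hw : ∀ i, 0 ≤ w i) (hsum : ∑ i, w i = 1)
    (hv : ∀ i, v i ∈ powRange α) : ∑ i, w i * v i ∈ powRange α :=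
  (convex_powRange α).sum_mem (fun i _ => hw i) hsum fun i _ => hv i

/-- The variable of the transformed operator belonging to the value `v` of `powTransform α`. -/
def radial (α v : ℝ) : ℝ := open Classical in if α = 0 then v else α * v

theorem radial_pos (hα : α ≤ 0) {v : ℝ} (hv : v ∈ powRange α) (h : α ≠ 0) : 0 < radial α v := by
  rw [radial, if_neg h]
  exact mul_pos_of_neg_of_neg (lt_of_le_of_ne hα h) (hv h)

theorem continuous_radial (α : ℝ) : Continuous (radial α) := by
  unfold radial
  by_cases h : α = 0
  · simp only [h, if_true]
    fun_prop
  · simp only [h, if_false]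
    fun_prop

theorem radial_sum {k : ℕ} (v w : Fin k → ℝ) :
    radial α (∑ i, w i * v i) = ∑ i, w i * radial α (v i) := by
  unfold radial
  split_ifs
  · rfl
  · rw [Finset.mul_sum]
    exact Finset.sum_congr rfl fun i _ => by ring

/-- The scaling of the Hessian in the transformed equation. -/
def jetScale (α r : ℝ) : ℝ := open Classical in if α = 0 then 1 else r

theorem jetScale_sum {k : ℕ} {r w : Fin k → ℝ} (hsum : ∑ i, w i = 1) :
    jetScale α (∑ i, w i * r i) = ∑ i, w i * jetScale α (r i) := by
  unfold jetScale
  split_ifs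
  · simp [hsum]
  · rfl

variable {n : ℕ}

/-- The matrix argument of the transformed operator at a second-order jet. -/
def jetMatrix (α r : ℝ) (B : Matrix (Fin n) (Fin n) ℝ) (θ : Space n) :
    Matrix (Fin n) (Fin n) ℝ :=
  jetScale α r ^ 2 • B + ((1 - α) * jetScale α r) • Matrix.vecMulVec θ.ofLp θ.ofLp

theorem isSymm_vecMulVec (θ : Fin n → ℝ) : (Matrix.vecMulVec θ θ).IsSymm := by
  ext i j
  simp [Matrix.vecMulVec_apply, mul_comm]

theorem isSymm_jetMatrix {r : ℝ} {B : Matrix (Fin n) (Fin n) ℝ} (hB : B.IsSymm) (θ : Space n) :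
    (jetMatrix α r B θ).IsSymm :=
  (hB.smul _).add ((isSymm_vecMulVec _).smul _)

theorem matrixCLM_vecMulVec (θ : Space n) :
    matrixCLM (Matrix.vecMulVec θ.ofLp θ.ofLp) = rankOne θ := by
  refine ContinuousLinearMap.ext fun x => ext_inner_left ℝ fun y => ?_
  rw [Matrix.inner_toEuclideanCLM, real_inner_comm, inner_rankOne, Matrix.vecMulVec_mulVec]
  simp [PiLp.inner_apply, dotProduct, mul_comm]
  rw [Finset.mul_sum]
  exact Finset.sum_congr rfl fun i _ => by ring

/-- With `m = powInverse α v`, the chain rule gives gradient `m ^ (1 - α) θ` and Hessian `m ^ (1 -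
α) B + (1 - α) m ^ (1 - 2α) θ ⊗ θ`. `jetMatrix` is the argument which the power `r ^ (1/α - 3)`, `r
= m ^ α`, rescales to this Hessian. -/
theorem transformedOperator_jetMatrix (hα : α ≤ 0) {F : Operator n} {v : ℝ}
    (hv : v ∈ powRange α) (θ : Space n) (t : ℝ) (x : Space n) (B : Matrix (Fin n) (Fin n) ℝ) :
    transformedOperator α F θ t x (radial α v) (jetMatrix α (radial α v) B θ) =
      powInverse α v ^ (α - 1) * F x t (powInverse α v) (powInverse α v ^ (1 - α) • θ)
        (powInverse α v ^ (1 - α) • B +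
          ((1 - α) * powInverse α v ^ (1 - 2 * α)) • Matrix.vecMulVec θ.ofLp θ.ofLp) := by
  unfold transformedOperator
  have hm := powInverse_pos hα hv
  have hmv := powTransform_powInverse hα hv
  set m := powInverse α v
  split_ifs with h
  · have hr : radial α v = Real.log m := by rw [radial, if_pos h, ← hmv, powTransform, if_pos h]
    have hs : jetScale α (radial α v) = 1 := if_pos h
    rw [jetMatrix, hs, hr, Real.exp_neg, Real.exp_log hm, h]
    simp [Real.rpow_neg_one]
  · have hr : radial α v = m ^ α := by
      rw [radial, if_neg h, ← hmv, powTransform, if_neg h, mul_div_cancel₀ _ h]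
    have hs : jetScale α (radial α v) = m ^ α := (if_neg h).trans hr
    have e1 : (m ^ α) ^ (1 - 1 / α) = m ^ (α - 1) := by
      rw [← Real.rpow_mul hm.le]
      congr 1
      field_simp
    have e2 : (m ^ α) ^ (1 / α) = m := by
      rw [← Real.rpow_mul hm.le, mul_one_div_cancel h, Real.rpow_one]
    have e3 : (m ^ α) ^ (1 / α - 1) = m ^ (1 - α) := by
      rw [← Real.rpow_mul hm.le]
      congr 1
      field_simp
    have e4 : (m ^ α) ^ (1 / α - 3) = m ^ (1 - 3 * α) := by
      rw [← Real.rpow_mul hm.le]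
      congr 1
      field_simp
    have e5 : m ^ (1 - 3 * α) * (m ^ α) ^ 2 = m ^ (1 - α) := by
      rw [← Real.rpow_natCast, ← Real.rpow_mul hm.le, ← Real.rpow_add hm]
      congr 1
      push_cast
      ring
    have e6 : m ^ (1 - 3 * α) * ((1 - α) * m ^ α) = (1 - α) * m ^ (1 - 2 * α) := by
      rw [mul_left_comm, ← Real.rpow_add hm]
      congr 2
      ring
    rw [jetMatrix, hs, hr, e1, e2, e3, e4, smul_add, smul_smul, smul_smul, e5, e6]

theorem tendsto_transformedOperator {O : Set (Space n × ℝ)} (hO : IsOpen O) {F : Operator n}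
    (hF : IsContinuousOperator O F) {ι : Type*} {l : Filter ι} {x : ι → Space n} {t r : ι → ℝ}
    {θ : ι → Space n} {A : ι → Matrix (Fin n) (Fin n) ℝ} {x₀ : Space n} {t₀ r₀ : ℝ}
    {θ₀ : Space n} {A₀ : Matrix (Fin n) (Fin n) ℝ} (h0 : (x₀, t₀) ∈ O)
    (hr0 : α ≠ 0 → 0 < r₀) (hA0 : A₀.IsSymm) (hx : Tendsto x l (𝓝 x₀)) (ht : Tendsto t l (𝓝 t₀))
    (hr : Tendsto r l (𝓝 r₀)) (hθ : Tendsto θ l (𝓝 θ₀)) (hA : Tendsto A l (𝓝 A₀))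
    (hAs : ∀ᶠ i in l, (A i).IsSymm) :
    Tendsto (fun i => transformedOperator α F (θ i) (t i) (x i) (r i) (A i)) l
      (𝓝 (transformedOperator α F θ₀ t₀ x₀ r₀ A₀)) := by
  unfold transformedOperator
  split_ifs with h
  · have he : Tendsto (fun i => Real.exp (r i)) l (𝓝 (Real.exp r₀)) := hr.rexp
    exact hr.neg.rexp.mul (hF.tendsto hO h0 (Real.exp_pos _) (hA0.smul _) hx ht he (he.smul hθ)
      (he.smul hA) (hAs.mono fun i hi => hi.smul _))
  · have hr0' := hr0 h
    have hp : ∀ e : ℝ, Tendsto (fun i => r i ^ e) l (𝓝 (r₀ ^ e)) := fun e =>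
      hr.rpow_const (Or.inl hr0'.ne')
    exact (hp _).mul (hF.tendsto hO h0 (Real.rpow_pos_of_pos hr0' _) (hA0.smul _) hx ht (hp _)
      ((hp _).smul hθ) ((hp _).smul hA) (hAs.mono fun i hi => hi.smul _))

theorem IsSuperjet.congr {S : Type*} [NormedAddCommGroup S] [InnerProductSpace ℝ S]
    {v v' : S × ℝ → ℝ} {p : S × ℝ} {θ : S} {a : ℝ} {X : S →L[ℝ] S} (hv : IsSuperjet v p θ a X)
    (h : v' =ᶠ[𝓝 p] v) : IsSuperjet v' p θ a X := by
  intro ε hε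
  obtain ⟨C, hC⟩ := hv ε hε
  have hpz : Tendsto (fun z : S × ℝ => p + z) (𝓝 0) (𝓝 p) := by
    have hc : Continuous fun z : S × ℝ => p + z := by fun_prop
    simpa using hc.tendsto 0
  refine ⟨C, ?_⟩
  filter_upwards [hC, hpz.eventually h] with z hz hz'
  rwa [hz', h.self_of_nhds]

/-- A positive viscosity subsolution solves the transformed equation in the sense of superjets. -/
theorem IsViscositySubsolution.superjet_powTransform (hα : α ≤ 0) {O : Set (Space n × ℝ)}
    (hO : IsOpen O) {F : Operator n} (hF : IsContinuousOperator O F) {u : Space n × ℝ → ℝ}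
    (hu : IsViscositySubsolution O F u) (husc : UpperSemicontinuousOn u (closure O))
    (hpos : ∀ p ∈ O, 0 < u p) {p : Space n × ℝ} (hp : p ∈ O)
    {θ : Space n} {a : ℝ} {M : Matrix (Fin n) (Fin n) ℝ} (hM : M.IsSymm)
    (hj : IsSuperjet (fun q => powTransform α (u q)) p θ a (matrixCLM M)) :
    a + transformedOperator α F θ p.2 p.1 (radial α (powTransform α (u p)))
      (jetMatrix α (radial α (powTransform α (u p))) M θ) ≤ 0 := by
  have hv := powTransform_mem hα (hpos p hp)
  have hnhds := (isOpen_powRange α).mem_nhds hv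
  have h1 := hj.comp (monotoneOn_powInverse hα) hnhds
    ((hO.eventually_mem hp).mono fun q hq => powTransform_mem hα (hpos q hq))
    (eventually_of_mem hnhds fun v hv => hasDerivAt_powInverse hα hv)
    (hasDerivAt_powInverse_rpow hα hv)
  have h2 := h1.congr (v' := u) ((hO.eventually_mem hp).mono fun q hq =>
    (powInverse_powTransform (hpos q hq)).symm)
  rw [transformedOperator_jetMatrix hα hv]
  rw [powInverse_powTransform (hpos p hp)] at h2 ⊢
  rw [← matrixCLM_vecMulVec, ← map_smul, ← map_smul, ← map_add] at h2
  have h3 := hu.superjet hO hF husc hp (hpos p hp)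
    ((hM.smul _).add ((isSymm_vecMulVec _).smul _)) h2
  -- The prefactor in the transformed operator is the inverse of the derivative of `powInverse`, so
  -- multiplying by it leaves the time derivative with coefficient one.
  have h4 : u p ^ (α - 1) * u p ^ (1 - α) = 1 := by
    rw [← Real.rpow_add (hpos p hp)]
    simp
  have h5 := mul_nonpos_of_nonneg_of_nonpos (Real.rpow_nonneg (hpos p hp).le (α - 1)) h3
  rwa [mul_add, ← mul_assoc, h4, one_mul] at h5

/-- The jet of the transformed function, and the equation it has to satisfy. -/
theorem exists_superjet_powTransform (hα : α ≤ 0) {F : Operator n} {U : Space n × ℝ → ℝ}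
    {p : Space n × ℝ} (hpos : ∀ᶠ q in 𝓝 p, 0 < U q) {g : Space n} {b : ℝ}
    {X : Matrix (Fin n) (Fin n) ℝ} (hX : X.IsSymm) (hj : IsSuperjet U p g b (matrixCLM X)) :
    ∃ θ a B, B.IsSymm ∧ IsSuperjet (fun q => powTransform α (U q)) p θ a (matrixCLM B) ∧
      (a + transformedOperator α F θ p.2 p.1 (radial α (powTransform α (U p)))
        (jetMatrix α (radial α (powTransform α (U p))) B θ) ≤ 0 → b + F p.1 p.2 (U p) g X ≤ 0) := by
  have hm := hpos.self_of_nhds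
  have h1 := hj.comp monotoneOn_powTransform (Ioi_mem_nhds hm) hpos
    (eventually_of_mem (Ioi_mem_nhds hm) fun u hu => hasDerivAt_powTransform (α := α) hu)
    (hasDerivAt_rpow_sub_one hm)
  rw [← matrixCLM_vecMulVec, ← map_smul, ← map_smul, ← map_add] at h1
  refine ⟨_, _, _, (hX.smul _).add ((isSymm_vecMulVec _).smul _), h1, fun h => ?_⟩
  rw [transformedOperator_jetMatrix hα (powTransform_mem hα hm), powInverse_powTransform hm] at h
  set m := U p
  have e1 : m ^ (1 - α) * m ^ (α - 1) = 1 := by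
    rw [← Real.rpow_add hm]
    simp
  have e2 : m ^ (1 - α) • m ^ (α - 1) • g = g := by rw [smul_smul, e1, one_smul]
  have e3 : Matrix.vecMulVec (m ^ (α - 1) • g).ofLp (m ^ (α - 1) • g).ofLp =
      (m ^ (2 * α - 2)) • Matrix.vecMulVec g.ofLp g.ofLp := by
    have : m ^ (2 * α - 2) = m ^ (α - 1) * m ^ (α - 1) := by
      rw [← Real.rpow_add hm]
      ring_nf
    rw [this]
    ext i j
    simp [Matrix.vecMulVec_apply]
    ring
  -- Transforming and transforming back returns the original Hessian: the two rank-one terms have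
  -- coefficients `(α - 1) / m` and `(1 - α) / m`.
  have e4 : m ^ (1 - α) • (m ^ (α - 1) • X + ((α - 1) * m ^ (α - 2)) •
      Matrix.vecMulVec g.ofLp g.ofLp) + ((1 - α) * m ^ (1 - 2 * α)) •
      Matrix.vecMulVec (m ^ (α - 1) • g).ofLp (m ^ (α - 1) • g).ofLp = X := by
    have e5 : m ^ (1 - α) * ((α - 1) * m ^ (α - 2)) = (α - 1) * m ^ (-1 : ℝ) := by
      rw [mul_left_comm, ← Real.rpow_add hm]
      ring_nf
    have e6 : (1 - α) * m ^ (1 - 2 * α) * m ^ (2 * α - 2) = (1 - α) * m ^ (-1 : ℝ) := by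
      rw [mul_assoc, ← Real.rpow_add hm]
      ring_nf
    rw [e3, smul_add, smul_smul, smul_smul, smul_smul, e1, e5, e6, one_smul, add_assoc,
      ← add_smul]
    have : (α - 1) * m ^ (-1 : ℝ) + (1 - α) * m ^ (-1 : ℝ) = 0 := by ring
    rw [this, zero_smul, add_zero]
  rw [e2, e4, ← mul_add] at h
  exact nonpos_of_mul_nonpos_right h (Real.rpow_pos_of_pos hm _)

end PowerTransform

theorem isOpen_timeInterval (T : EReal) : IsOpen (timeInterval T) :=
  (isOpen_lt continuous_const continuous_id).inter
    (isOpen_lt continuous_coe_real_ereal continuous_const)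

/-! ### Convergent sequences of superjets of the summands -/

section SumOfJets

variable {n k : ℕ}

/-- Polarisation and the parallelogram law turn the bound on the quadratic form into one on entries,
with the same constant. -/
theorem abs_entry_le {M : Matrix (Fin n) (Fin n) ℝ} {L : ℝ} (hM : M.IsSymm)
    (h : ∀ x, |inner ℝ (matrixCLM M x) x| ≤ L * ‖x‖ ^ 2) (i j : Fin n) : |M i j| ≤ L := by
  have h1 := abs_le.1 (h (EuclideanSpace.single i 1 + EuclideanSpace.single j 1))
  have h2 := abs_le.1 (h (EuclideanSpace.single i 1 - EuclideanSpace.single j 1))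
  have h3 := inner_matrixCLM_comm hM (EuclideanSpace.single i (1 : ℝ)) (EuclideanSpace.single j 1)
  have h4 := inner_matrixCLM_single M i j
  rw [real_inner_comm] at h4
  have h5 := parallelogram_law_with_norm ℝ (EuclideanSpace.single i (1 : ℝ))
    (EuclideanSpace.single j (1 : ℝ))
  simp only [PiLp.norm_single, norm_one] at h5
  simp only [map_add, map_sub, inner_add_left, inner_add_right, inner_sub_left,
    inner_sub_right] at h1 h2
  have h6 : L * ‖EuclideanSpace.single i (1 : ℝ) + EuclideanSpace.single j 1‖ ^ 2 +
      L * ‖EuclideanSpace.single i (1 : ℝ) - EuclideanSpace.single j 1‖ ^ 2 = 4 * L := by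
    rw [← mul_add, pow_two, pow_two]
    linear_combination L * h5
  rw [abs_le]
  constructor <;> linarith [h1.1, h1.2, h2.1, h2.2]

/-- Adding back an affine function shifts only the first-order part of the jet. -/
theorem isSuperjet_of_normalised {S : Type*} [NormedAddCommGroup S] [InnerProductSpace ℝ S]
    {v : S × ℝ → ℝ} {p q : S × ℝ} {c a a' : ℝ} {θ θ' : S} {X : S →L[ℝ] S}
    (h : IsSuperjet (fun z => v (p + z) - c - inner ℝ θ z.1 - a * z.2) q θ' a' X) :
    IsSuperjet v (p + q) (θ + θ') (a + a') X := by
  intro ε hε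
  obtain ⟨C, hC⟩ := h ε hε
  refine ⟨C, hC.mono fun z hz => ?_⟩
  simp only [← add_assoc, Prod.fst_add, Prod.snd_add, inner_add_right, inner_add_left] at hz ⊢
  linarith

theorem upperSemicontinuousOn_normalised {S : Type*} [NormedAddCommGroup S]
    [InnerProductSpace ℝ S] {v : S × ℝ → ℝ} {O K : Set (S × ℝ)} {p : S × ℝ} {c a : ℝ} {θ : S}
    (hv : UpperSemicontinuousOn v O) (hK : ∀ z ∈ K, p + z ∈ O) :
    UpperSemicontinuousOn (fun z => v (p + z) - c - inner ℝ θ z.1 - a * z.2) K := by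
  have h1 : UpperSemicontinuousOn (fun z => v (p + z)) K :=
    fun z hz y hy => (Continuous.continuousWithinAt (by fun_prop : Continuous fun z => p + z)).tendsto_nhdsWithin
      (fun z hz => hK z hz) |>.eventually (hv (p + z) (hK z hz) y hy)
  have h2 : ContinuousOn (fun z : S × ℝ => - c - inner ℝ θ z.1 - a * z.2) K := by fun_prop
  have h3 := h1.add h2.upperSemicontinuousOn
  have h4 : (fun z => v (p + z) - c - inner ℝ θ z.1 - a * z.2) =
      fun z => v (p + z) + (-c - inner ℝ θ z.1 - a * z.2) := by
    ext z
    ring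
  exact h4 ▸ h3

/-- Sequences of superjets of the summands, with converging Hessians, at points where a weighted
sum of upper semicontinuous functions is touched from above by a quadratic function. -/
theorem exists_superjet_sequences {w : Fin k → ℝ} (hw : ∀ i, 0 < w i) (hsum : ∑ i, w i = 1)
    {v : Fin k → Space n × ℝ → ℝ} {p : Fin k → Space n × ℝ} {O : Fin k → Set (Space n × ℝ)}
    (hO : ∀ i, O i ∈ 𝓝 (p i)) (hv : ∀ i, UpperSemicontinuousOn (v i) (O i))
    {θ : Space n} {a C : ℝ} {B : Matrix (Fin n) (Fin n) ℝ} (hB : B.IsSymm)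
    (hle : ∀ᶠ z in 𝓝 (0 : (Fin k → Space n) × ℝ), ∑ i, w i * v i (p i + (z.1 i, z.2)) ≤
      ∑ i, w i * v i (p i) + inner ℝ θ (∑ i, w i • z.1 i) + a * z.2 +
        1 / 2 * inner ℝ (matrixCLM B (∑ i, w i • z.1 i)) (∑ i, w i • z.1 i) + C * z.2 ^ 2)
    {η : ℝ} (hη : 0 < η) :
    ∃ (M : Fin k → Matrix (Fin n) (Fin n) ℝ) (q : ℕ → Fin k → Space n × ℝ)
      (g : ℕ → Fin k → Space n) (b : ℕ → Fin k → ℝ) (X : ℕ → Fin k → Matrix (Fin n) (Fin n) ℝ),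
      (∀ h : Fin k → Space n, ∑ i, w i * inner ℝ (matrixCLM (M i) (h i)) (h i) ≤
        inner ℝ (matrixCLM B (∑ i, w i • h i)) (∑ i, w i • h i) + η * ∑ i, ‖h i‖ ^ 2) ∧
      (∀ i, Tendsto (fun j => q j i) atTop (𝓝 (p i))) ∧
      (∀ i, Tendsto (fun j => v i (q j i)) atTop (𝓝 (v i (p i)))) ∧
      (∀ i, Tendsto (fun j => g j i) atTop (𝓝 θ)) ∧
      Tendsto (fun j => ∑ i, w i * b j i) atTop (𝓝 a) ∧
      (∀ i, Tendsto (fun j => X j i) atTop (𝓝 (M i))) ∧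
      (∀ j i, (X j i).IsSymm) ∧
      ∀ j i, IsSuperjet (v i) (q j i) (g j i) (b j i) (matrixCLM (X j i)) := by
  obtain ⟨r, hr, hrle, hrO⟩ : ∃ r : ℝ, 0 < r ∧
      (∀ z ∈ Metric.closedBall (0 : (Fin k → Space n) × ℝ) r,
        ∑ i, w i * v i (p i + (z.1 i, z.2)) ≤
        ∑ i, w i * v i (p i) + inner ℝ θ (∑ i, w i • z.1 i) + a * z.2 +
          1 / 2 * inner ℝ (matrixCLM B (∑ i, w i • z.1 i)) (∑ i, w i • z.1 i) + C * z.2 ^ 2) ∧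
      ∀ i, Metric.closedBall (p i) r ⊆ O i := by
    obtain ⟨r₀, hr₀, h₀⟩ := Metric.nhds_basis_closedBall.eventually_iff.1 hle
    have h1 : ∀ᶠ r in 𝓝[>] (0 : ℝ), ∀ i, Metric.closedBall (p i) r ⊆ O i :=
      eventually_all.2 fun i => by
        obtain ⟨s, hs, hsO⟩ := Metric.nhds_basis_closedBall.mem_iff.1 (hO i)
        filter_upwards [Ioo_mem_nhdsGT hs] with r hr
        exact (Metric.closedBall_subset_closedBall hr.2.le).trans hsO
    obtain ⟨r, hr1, hr2⟩ := (h1.and (Ioo_mem_nhdsGT hr₀)).exists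
    exact ⟨r, hr2.1, fun z hz => h₀ (Metric.closedBall_subset_closedBall hr2.2.le hz), hr1⟩
  have hmem : ∀ {h : Space n} {s : ℝ} i, ‖h‖ ≤ r → |s| ≤ r → p i + (h, s) ∈ O i := by
    intro h s i hh hs
    refine hrO i ?_
    rw [mem_closedBall_iff_norm, add_sub_cancel_left, Prod.norm_def]
    exact max_le hh hs
  set v' : Fin k → Space n × ℝ → ℝ := fun i z =>
    v i (p i + z) - v i (p i) - inner ℝ θ z.1 - a * z.2 with hv'
  obtain ⟨L, hL⟩ := exists_superjets_common_time hw hsum (B := matrixCLM B)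
    (fun x y => by rw [inner_matrixCLM_comm hB, real_inner_comm]) (abs_nonneg C) hr hη (v := v')
    (fun i => upperSemicontinuousOn_normalised (hv i) fun z hz => by
      rw [mem_prod, mem_closedBall_zero_iff, mem_Icc, ← abs_le] at hz
      exact hmem i hz.1 hz.2)
    (fun i => by simp [hv']) (fun h s hh hs => by
      have h1 := hrle (h, s) (by
        rw [mem_closedBall_zero_iff, Prod.norm_def]
        exact max_le ((pi_norm_le_iff_of_nonneg hr.le).2 hh) hs)
      have h2 : ∑ i, w i * v' i (h i, s) = ∑ i, w i * v i (p i + (h i, s)) -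
          ∑ i, w i * v i (p i) - inner ℝ θ (∑ i, w i • h i) - a * s := by
        simp only [hv', mul_sub, Finset.sum_sub_distrib, inner_sum, real_inner_smul_right]
        rw [← Finset.sum_mul, hsum, one_mul]
      rw [h2]
      have h3 := mul_le_mul_of_nonneg_right (le_abs_self C) (sq_nonneg s)
      simp only at h1
      linarith)
  have hj : ∀ j : ℕ, (0 : ℝ) < 1 / (j + 1) := fun j => Nat.one_div_pos_of_nat
  choose q g b X h1 h2 h3 h4 h5 h6 using fun j : ℕ => hL (1 / (j + 1)) (hj j)
  set Y : ℕ → Fin k → Matrix (Fin n) (Fin n) ℝ := fun j i =>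
    (Matrix.toEuclideanCLM (n := Fin n) (𝕜 := ℝ)).symm (X j i) with hY
  have hXY : ∀ j i, matrixCLM (Y j i) = X j i := fun j i =>
    (Matrix.toEuclideanCLM (n := Fin n) (𝕜 := ℝ)).apply_symm_apply (X j i)
  have hYs : ∀ j i, (Y j i).IsSymm := by
    refine fun j i => Matrix.IsSymm.ext fun a b => ?_
    rw [← inner_matrixCLM_single (Y j i) b a, ← inner_matrixCLM_single (Y j i) a b, hXY,
      real_inner_comm, h3, real_inner_comm]
  have hYL : ∀ j i a b, |Y j i a b| ≤ L := fun j i =>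
    abs_entry_le (hYs j i) fun x => by rw [hXY]; exact h4 j i x
  -- The Hessians are bounded uniformly in `j`, so a subsequence converges. The individual time
  -- derivatives need not converge; only their weighted sum does.
  obtain ⟨M, ψ, hψ, hM⟩ : ∃ (M : Fin k → Matrix (Fin n) (Fin n) ℝ) (ψ : ℕ → ℕ),
      StrictMono ψ ∧ Tendsto (fun j => Y (ψ j)) atTop (𝓝 M) := by
    let Z : ℕ → Fin k → Fin n → Fin n → ℝ := fun j i a b => Y j i a b
    obtain ⟨M, -, ψ, hψ, hM⟩ := (isCompact_univ_pi fun _ : Fin k => isCompact_univ_pi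
      fun _ : Fin n => isCompact_univ_pi fun _ : Fin n => isCompact_Icc (a := -L) (b := L)).tendsto_subseq
      (x := Z) (fun j i _ a _ b _ => abs_le.1 (hYL j i a b))
    exact ⟨M, ψ, hψ, hM⟩
  have hlim : Tendsto (fun j : ℕ => (1 : ℝ) / ((ψ j : ℝ) + 1)) atTop (𝓝 0) :=
    tendsto_one_div_add_atTop_nhds_zero_nat.comp hψ.tendsto_atTop
  have hsq : ∀ {f : ℕ → ℝ}, (∀ j, |f (ψ j)| < 1 / (ψ j + 1)) →
      Tendsto (fun j => f (ψ j)) atTop (𝓝 0) := fun hf =>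
    squeeze_zero_norm (fun j => (hf j).le) hlim
  have hq1 : ∀ i, Tendsto (fun j => q (ψ j) i) atTop (𝓝 0) := fun i =>
    squeeze_zero_norm (fun j => by
      rw [Prod.norm_def]
      exact max_le (h1 (ψ j) i).1.le (h1 (ψ j) i).2.1.le) hlim
  have hM' : ∀ i, Tendsto (fun j => Y (ψ j) i) atTop (𝓝 (M i)) := fun i =>
    (continuous_apply i).continuousAt.tendsto.comp hM
  refine ⟨M, fun j i => p i + q (ψ j) i, fun j i => θ + g (ψ j) i, fun j i => a + b (ψ j) i,
    fun j i => Y (ψ j) i, ?_, ?_, ?_, ?_, ?_, hM', fun j i => hYs _ i, ?_⟩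
  · intro h
    have hcont : Tendsto (fun j => ∑ i, w i * inner ℝ (matrixCLM (Y (ψ j) i) (h i)) (h i)) atTop
        (𝓝 (∑ i, w i * inner ℝ (matrixCLM (M i) (h i)) (h i))) := by
      refine tendsto_finsetSum _ fun i _ => Tendsto.const_mul _ ?_
      have hc : Continuous fun A : Matrix (Fin n) (Fin n) ℝ => inner ℝ (matrixCLM A (h i)) (h i) := by
        simp only [real_inner_comm, Matrix.inner_toEuclideanCLM]
        exact Continuous.dotProduct continuous_const (continuous_id.matrix_mulVec continuous_const)
      exact (hc.tendsto _).comp (hM' i)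
    refine le_of_tendsto hcont (Eventually.of_forall fun j => ?_)
    simp only [hXY]
    exact h5 (ψ j) h
  · intro i
    simpa using (hq1 i).const_add (p i)
  · intro i
    have h7 := hsq (f := fun j => v' i (q j i)) fun j => (h1 (ψ j) i).2.2.1
    have h8 : Tendsto (fun j => inner ℝ θ (q (ψ j) i).1 + a * (q (ψ j) i).2) atTop (𝓝 0) := by
      have hc : Continuous fun z : Space n × ℝ => inner ℝ θ z.1 + a * z.2 := by fun_prop
      have h0 := hc.tendsto 0
      simp only [Prod.fst_zero, Prod.snd_zero, inner_zero_right, mul_zero, add_zero] at h0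
      exact h0.comp (hq1 i)
    have h9 := (h7.add h8).const_add (v i (p i))
    simp only [add_zero] at h9
    refine h9.congr fun j => ?_
    simp only [hv']
    ring
  · intro i
    have := squeeze_zero_norm (fun j => (h1 (ψ j) i).2.2.2.le) hlim
    simpa using this.const_add θ
  · have := (hsq (f := fun j => ∑ i, w i * b j i) fun j => h2 (ψ j)).const_add a
    rw [add_zero] at this
    refine this.congr fun j => ?_
    simp only [mul_add, Finset.sum_add_distrib]
    rw [← Finset.sum_mul, hsum, one_mul]
  · intro j i
    rw [hXY]
    exact isSuperjet_of_normalised (h6 (ψ j) i)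

end SumOfJets

/-! ### The viscosity inequality at an attained point -/

section Convolution

variable {n k : ℕ} {α : ℝ}

theorem posSemidef_of_inner_matrixCLM {M : Matrix (Fin n) (Fin n) ℝ} (hM : M.IsSymm)
    (h : ∀ x, 0 ≤ inner ℝ (matrixCLM M x) x) : M.PosSemidef := by
  refine Matrix.PosSemidef.of_dotProduct_mulVec_nonneg ?_ fun x => ?_
  · rw [Matrix.IsHermitian, Matrix.conjTranspose_eq_transpose_of_trivial, hM]
  · have := h (WithLp.toLp 2 x)
    rw [real_inner_comm, Matrix.inner_toEuclideanCLM] at this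
    simpa using this

theorem inner_jetMatrix (r : ℝ) (B : Matrix (Fin n) (Fin n) ℝ) (θ x : Space n) :
    inner ℝ (matrixCLM (jetMatrix α r B θ) x) x =
      jetScale α r ^ 2 * inner ℝ (matrixCLM B x) x +
        (1 - α) * jetScale α r * inner ℝ θ x ^ 2 := by
  rw [jetMatrix, matrixCLM, map_add, map_smul, map_smul]
  rw [show Matrix.toEuclideanCLM (n := Fin n) (𝕜 := ℝ) (Matrix.vecMulVec θ.ofLp θ.ofLp) =
    rankOne θ from matrixCLM_vecMulVec θ, add_apply, smul_apply, smul_apply, inner_add_left,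
    real_inner_smul_left, real_inner_smul_left, inner_rankOne]
  ring

theorem tendsto_jetMatrix {ι : Type*} {l : Filter ι} {r : ι → ℝ}
    {B : ι → Matrix (Fin n) (Fin n) ℝ} {θ : ι → Space n} {r₀ : ℝ} {B₀ : Matrix (Fin n) (Fin n) ℝ}
    {θ₀ : Space n} (hr : Tendsto r l (𝓝 r₀)) (hB : Tendsto B l (𝓝 B₀))
    (hθ : Tendsto θ l (𝓝 θ₀)) :
    Tendsto (fun i => jetMatrix α (r i) (B i) (θ i)) l (𝓝 (jetMatrix α r₀ B₀ θ₀)) := by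
  have h1 : Tendsto (fun i => jetScale α (r i)) l (𝓝 (jetScale α r₀)) := by
    unfold jetScale
    split_ifs
    · exact tendsto_const_nhds
    · exact hr
  have hc : Continuous fun x : Space n => Matrix.vecMulVec x.ofLp x.ofLp := by
    have h2 : Continuous fun x : Space n => x.ofLp := by fun_prop
    exact h2.matrix_vecMulVec h2
  exact ((h1.pow 2).smul hB).add ((tendsto_const_nhds.mul h1).smul ((hc.tendsto _).comp hθ))

theorem IsElliptic.transformedOperator_le {O : Set (Space n × ℝ)} {F : Operator n}
    (hF : IsElliptic O F) {θ x : Space n} {t r : ℝ} (hx : (x, t) ∈ O) (hr : α ≠ 0 → 0 < r)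
    {X Y : Matrix (Fin n) (Fin n) ℝ} (hX : X.IsSymm) (hY : Y.IsSymm) (h : (X - Y).PosSemidef) :
    transformedOperator α F θ t x r X ≤ transformedOperator α F θ t x r Y := by
  have key : ∀ c : ℝ, 0 ≤ c → (c • X - c • Y).PosSemidef := fun c hc => by
    rw [← smul_sub]
    exact h.smul hc
  unfold transformedOperator
  split_ifs with h0
  · exact mul_le_mul_of_nonneg_left (hF _ _ _ _ _ _ hx (Real.exp_pos _) (hX.smul _) (hY.smul _)
      (key _ (Real.exp_pos _).le)) (Real.exp_pos _).le
  · have hr' := hr h0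
    exact mul_le_mul_of_nonneg_left (hF _ _ _ _ _ _ hx (Real.rpow_pos_of_pos hr' _) (hX.smul _)
      (hY.smul _) (key _ (Real.rpow_nonneg hr'.le _))) (Real.rpow_nonneg hr'.le _)

/-- Since the weights sum to one, translating every `yᵢ` by the same vector translates the
combination by it. -/
theorem isOpen_minkowskiCombination {w : Fin k → ℝ} (hsum : ∑ i, w i = 1)
    {Ω : Fin k → Set (Space n)} (hΩ : ∀ i, IsOpen (Ω i)) : IsOpen (minkowskiCombination w Ω) := by
  rw [isOpen_iff_mem_nhds]
  rintro x ⟨y, hy, rfl⟩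
  have h1 : ∀ᶠ z in 𝓝 (∑ i, w i • y i), ∀ i, y i + (z - ∑ i, w i • y i) ∈ Ω i :=
    eventually_all.2 fun i => by
      have hc : Continuous fun z => y i + (z - ∑ i, w i • y i) := by fun_prop
      exact hc.continuousAt.eventually_mem ((hΩ i).mem_nhds (by simpa using hy i))
  filter_upwards [h1] with z hz
  refine ⟨_, hz, ?_⟩
  simp only [smul_add, Finset.sum_add_distrib]
  rw [← Finset.sum_smul, hsum, one_smul, add_sub_cancel]

theorem isOpen_cylinder {Ω : Set (Space n)} (hΩ : IsOpen Ω) (T : EReal) : IsOpen (cylinder Ω T) :=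
  hΩ.prod (isOpen_timeInterval T)

/-- The term `θ ⊗ θ` enters with a coefficient affine in `jetScale`, so it averages exactly. The
Hessian term is quadratic in `jetScale`, and the joint inequality handles it. -/
theorem jetMatrix_sum_le {w : Fin k → ℝ} (hsum : ∑ i, w i = 1)
    {B : Matrix (Fin n) (Fin n) ℝ} {M : Fin k → Matrix (Fin n) (Fin n) ℝ} {ε : ℝ}
    (hB : B.IsSymm) (hMs : ∀ i, (M i).IsSymm)
    (hM : ∀ h : Fin k → Space n, ∑ i, w i * inner ℝ (matrixCLM (M i) (h i)) (h i) ≤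
      inner ℝ (matrixCLM (B + (2 * ε) • (1 : Matrix (Fin n) (Fin n) ℝ)) (∑ i, w i • h i))
        (∑ i, w i • h i) + ε * ∑ i, ‖h i‖ ^ 2) (r : Fin k → ℝ) (θ : Space n) :
    (jetMatrix α (∑ i, w i * r i) B θ +
      (ε * (2 * jetScale α (∑ i, w i * r i) ^ 2 + ∑ i, jetScale α (r i) ^ 2)) •
        (1 : Matrix (Fin n) (Fin n) ℝ) - ∑ i, w i • jetMatrix α (r i) (M i) θ).PosSemidef := by
  have hs : (∑ i, w i • jetMatrix α (r i) (M i) θ).IsSymm := by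
    rw [Matrix.IsSymm, Matrix.transpose_sum]
    exact Finset.sum_congr rfl fun i _ => ((isSymm_jetMatrix (hMs i) θ).smul _)
  refine posSemidef_of_inner_matrixCLM (((isSymm_jetMatrix hB θ).add
    (Matrix.isSymm_one.smul _)).sub hs) fun x => ?_
  -- This scaled choice produces `jetScale α (r i) ^ 2` on the left, while its mean is `jetScale α
  -- (∑ wᵢ rᵢ) • x`. The two error terms in `ε` become the coefficient in the statement.
  have h1 := hM fun i => jetScale α (r i) • x
  have h2 : ∑ i, w i • jetScale α (r i) • x = jetScale α (∑ i, w i * r i) • x := by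
    rw [jetScale_sum hsum, Finset.sum_smul]
    exact Finset.sum_congr rfl fun i _ => smul_smul _ _ _
  have h3 : ∀ i, w i * inner ℝ (matrixCLM (M i) (jetScale α (r i) • x)) (jetScale α (r i) • x) =
      w i * (jetScale α (r i) ^ 2 * inner ℝ (matrixCLM (M i) x) x) := fun i => by
    rw [map_smul, real_inner_smul_left, real_inner_smul_right]
    ring
  have h4 : ∑ i, ‖jetScale α (r i) • x‖ ^ 2 = (∑ i, jetScale α (r i) ^ 2) * ‖x‖ ^ 2 := by
    rw [Finset.sum_mul]
    refine Finset.sum_congr rfl fun i _ => ?_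
    rw [norm_smul, mul_pow, Real.norm_eq_abs, sq_abs]
  have h5 : inner ℝ (matrixCLM (∑ i, w i • jetMatrix α (r i) (M i) θ) x) x =
      ∑ i, w i * (jetScale α (r i) ^ 2 * inner ℝ (matrixCLM (M i) x) x) +
        (1 - α) * jetScale α (∑ i, w i * r i) * inner ℝ θ x ^ 2 := by
    have h6 : inner ℝ (matrixCLM (∑ i, w i • jetMatrix α (r i) (M i) θ) x) x =
        ∑ i, w i * inner ℝ (matrixCLM (jetMatrix α (r i) (M i) θ) x) x := by
      simp only [matrixCLM, map_sum, map_smul, sum_apply, smul_apply, sum_inner,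
        real_inner_smul_left]
    rw [h6, jetScale_sum hsum, Finset.mul_sum, Finset.sum_mul, ← Finset.sum_add_distrib]
    refine Finset.sum_congr rfl fun i _ => ?_
    rw [inner_jetMatrix]
    ring
  simp only [h3, h2, h4] at h1
  have h7 : ∀ (A : Matrix (Fin n) (Fin n) ℝ) (c : ℝ) (y : Space n),
      inner ℝ (matrixCLM (A + c • (1 : Matrix (Fin n) (Fin n) ℝ)) y) y =
        inner ℝ (matrixCLM A y) y + c * ‖y‖ ^ 2 := fun A c y => by
    rw [matrixCLM, map_add, map_smul, map_one, add_apply, inner_add_left, smul_apply,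
      real_inner_smul_left, one_apply_eq_self, real_inner_self_eq_norm_sq]
  have h8 : ∀ (A A' : Matrix (Fin n) (Fin n) ℝ), inner ℝ (matrixCLM (A - A') x) x =
      inner ℝ (matrixCLM A x) x - inner ℝ (matrixCLM A' x) x := fun A A' => by
    rw [matrixCLM, map_sub, sub_apply, inner_sub_left]
  rw [h7, map_smul, real_inner_smul_left, real_inner_smul_right, norm_smul, mul_pow,
    Real.norm_eq_abs, sq_abs] at h1
  rw [h8, h7, h5, inner_jetMatrix]
  nlinarith

set_option maxHeartbeats 400000 in
/-- The viscosity inequality for a function dominating the power means of subsolutions, at a point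
where it is attained by interior points. -/
theorem viscosity_le_of_attained {w : Fin k → ℝ} (hw : ∀ i, 0 < w i) (hsum : ∑ i, w i = 1)
    {T : EReal} {Ω : Fin k → Set (Space n)} (hΩ : ∀ i, IsOpen (Ω i))
    {F : Fin k → Operator n} {Fl : Operator n}
    (hF_cont : ∀ i, IsContinuousOperator (cylinder (Ω i) T) (F i))
    (hFl_cont : IsContinuousOperator (cylinder (minkowskiCombination w Ω) T) Fl)
    (hFl_ell : IsElliptic (cylinder (minkowskiCombination w Ω) T) Fl)
    {u : Fin k → Space n × ℝ → ℝ}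
    (hu_usc : ∀ i, UpperSemicontinuousOn (u i) (closure (cylinder (Ω i) T)))
    (hu_pos : ∀ i, ∀ p ∈ cylinder (Ω i) T, 0 < u i p)
    (hu_sub : ∀ i, IsViscositySubsolution (cylinder (Ω i) T) (F i) (u i))
    (hα : α ≤ 0) (hstr : StructureCondition α w Ω T F Fl) {U : Space n × ℝ → ℝ}
    (hU : ∀ (z : Fin k → Space n) (t : ℝ), (∀ i, z i ∈ Ω i) → t ∈ timeInterval T →
      powerMean α (fun i => u i (z i, t)) w ≤ U (∑ i, w i • z i, t))
    (hU_pos : ∀ q ∈ cylinder (minkowskiCombination w Ω) T, 0 < U q)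
    {y : Fin k → Space n} {t : ℝ} (hy : ∀ i, y i ∈ Ω i) (ht : t ∈ timeInterval T)
    (hatt : U (∑ i, w i • y i, t) = powerMean α (fun i => u i (y i, t)) w)
    {φ : Space n × ℝ → ℝ} (hφ : ContDiffAt ℝ 2 φ (∑ i, w i • y i, t))
    (hmax : ∀ᶠ q in 𝓝 (∑ i, w i • y i, t),
      U q - φ q ≤ U (∑ i, w i • y i, t) - φ (∑ i, w i • y i, t)) :
    timeDeriv φ (∑ i, w i • y i, t) + Fl (∑ i, w i • y i) t (U (∑ i, w i • y i, t))
      (spatialGradient φ (∑ i, w i • y i, t)) (spatialHessian φ (∑ i, w i • y i, t)) ≤ 0 := by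
  have hO := isOpen_cylinder (isOpen_minkowskiCombination hsum hΩ) T
  set p : Space n × ℝ := (∑ i, w i • y i, t) with hp
  have hpO : p ∈ cylinder (minkowskiCombination w Ω) T := ⟨⟨y, hy, rfl⟩, ht⟩
  have hOi := fun i => isOpen_cylinder (hΩ i) T
  have hyO : ∀ i, (y i, t) ∈ cylinder (Ω i) T := fun i => ⟨hy i, ht⟩
  obtain ⟨θ, a, B, hB, hj, hconcl⟩ := exists_superjet_powTransform (F := Fl) hα
    ((hO.eventually_mem hpO).mono hU_pos) (spatialHessian_isSymm hφ) (isSuperjet_of_test hφ hmax)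
  refine hconcl ?_
  set v : Fin k → Space n × ℝ → ℝ := fun i q => powTransform α (u i q) with hv
  have hvr : ∀ i, ∀ q ∈ cylinder (Ω i) T, v i q ∈ powRange α := fun i q hq =>
    powTransform_mem hα (hu_pos i q hq)
  have hvusc : ∀ i, UpperSemicontinuousOn (v i) (cylinder (Ω i) T) := by
    intro i q hq c hc
    have hpos := hu_pos i q hq
    obtain ⟨m, hm, hmc⟩ : ∃ m, u i q < m ∧ powTransform α m < c := by
      have h1 := (hasDerivAt_powTransform (α := α) hpos).continuousAt.tendsto.eventually
        (eventually_lt_nhds hc)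
      exact ((eventually_mem_nhdsWithin (s := Ioi (u i q))).and
        (h1.filter_mono nhdsWithin_le_nhds)).exists
    filter_upwards [(hu_usc i).mono subset_closure q hq m hm, self_mem_nhdsWithin] with z hz hzO
    exact (monotoneOn_powTransform (hu_pos i z hzO) (hpos.trans hm) hz.le).trans_lt hmc
  have hVp : powTransform α (U p) = ∑ i, w i * v i (y i, t) := by
    rw [hatt, powerMean_eq fun i => hu_pos i _ (hyO i), powTransform_powInverse hα]
    exact sum_mem_powRange (fun i => (hw i).le) hsum fun i => hvr i _ (hyO i)
  have hVge : ∀ (z : Fin k → Space n) (s : ℝ), (∀ i, z i ∈ Ω i) → s ∈ timeInterval T →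
      ∑ i, w i * v i (z i, s) ≤ powTransform α (U (∑ i, w i • z i, s)) := by
    intro z s hz hs
    have hzO : ∀ i, 0 < u i (z i, s) := fun i => hu_pos i _ ⟨hz i, hs⟩
    have hmem := sum_mem_powRange (α := α) (v := fun i => v i (z i, s)) (fun i => (hw i).le) hsum
      fun i => hvr i _ ⟨hz i, hs⟩
    have h1 := hU z s hz hs
    rw [powerMean_eq hzO] at h1
    have h2 := monotoneOn_powTransform (α := α) (powInverse_pos hα hmem)
      (hU_pos (∑ i, w i • z i, s) ⟨⟨z, hz, rfl⟩, hs⟩) h1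
    rwa [powTransform_powInverse hα hmem] at h2
  set r : Fin k → ℝ := fun i => radial α (v i (y i, t)) with hr
  have hr0 : α ≠ 0 → ∀ i, 0 < r i := fun h i => radial_pos hα (hvr i _ (hyO i)) h
  have hrsum : radial α (powTransform α (U p)) = ∑ i, w i * r i := by rw [hVp, radial_sum]
  have hr0' : α ≠ 0 → 0 < ∑ i, w i * r i := fun h => by
    rw [← hrsum]
    exact radial_pos hα (powTransform_mem hα (hU_pos p hpO)) h
  rw [hrsum]
  set κ := 2 * jetScale α (∑ i, w i * r i) ^ 2 + ∑ i, jetScale α (r i) ^ 2 with hκ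
  have hs1 : ∀ c : ℝ, (jetMatrix α (∑ i, w i * r i) B θ +
      c • (1 : Matrix (Fin n) (Fin n) ℝ)).IsSymm := fun c =>
    (isSymm_jetMatrix hB θ).add (Matrix.isSymm_one.smul _)
  -- The same `ε` serves as the superjet error and as the Hessian slack in the theorem on sums;
  -- together they perturb the matrix by `ε κ` times the identity.
  have key : ∀ ε : ℝ, 0 < ε → a + transformedOperator α Fl θ t (∑ i, w i • y i) (∑ i, w i * r i)
      (jetMatrix α (∑ i, w i * r i) B θ + (ε * κ) • (1 : Matrix (Fin n) (Fin n) ℝ)) ≤ 0 := by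
    intro ε hε
    obtain ⟨C, hC⟩ := hj ε hε
    have hle : ∀ᶠ z in 𝓝 (0 : (Fin k → Space n) × ℝ),
        ∑ i, w i * v i ((y i, t) + (z.1 i, z.2)) ≤
        ∑ i, w i * v i (y i, t) + inner ℝ θ (∑ i, w i • z.1 i) + a * z.2 +
          1 / 2 * inner ℝ (matrixCLM (B + (2 * ε) • (1 : Matrix (Fin n) (Fin n) ℝ))
            (∑ i, w i • z.1 i)) (∑ i, w i • z.1 i) + C * z.2 ^ 2 := by
      have h1 : Tendsto (fun z : (Fin k → Space n) × ℝ => (∑ i, w i • z.1 i, z.2)) (𝓝 0) (𝓝 0) := by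
        have hc : Continuous fun z : (Fin k → Space n) × ℝ => (∑ i, w i • z.1 i, z.2) := by fun_prop
        have h0 := hc.tendsto 0
        simp only [Prod.fst_zero, Prod.snd_zero, Pi.zero_apply, smul_zero,
          Finset.sum_const_zero] at h0
        exact h0
      have h2 : ∀ᶠ z in 𝓝 (0 : (Fin k → Space n) × ℝ), ∀ i, (y i, t) + (z.1 i, z.2) ∈
          cylinder (Ω i) T := eventually_all.2 fun i => by
        have hc : Continuous fun z : (Fin k → Space n) × ℝ => (y i, t) + (z.1 i, z.2) := by fun_prop
        exact hc.continuousAt.eventually_mem ((hOi i).mem_nhds (by simpa using hyO i))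
      have h3 : ∀ᶠ z in 𝓝 (0 : (Fin k → Space n) × ℝ), t + z.2 ∈ timeInterval T := by
        have hc : Continuous fun z : (Fin k → Space n) × ℝ => t + z.2 := by fun_prop
        exact hc.continuousAt.eventually_mem ((isOpen_timeInterval T).mem_nhds (by simpa using ht))
      filter_upwards [h1.eventually hC, h2, h3] with z hz1 hz2 hz3
      have h4 := hVge (fun i => y i + z.1 i) (t + z.2) (fun i => (hz2 i).1) hz3
      have h5 : (∑ i, w i • (y i + z.1 i), t + z.2) = p + (∑ i, w i • z.1 i, z.2) := by
        simp only [hp, smul_add, Finset.sum_add_distrib, Prod.mk_add_mk]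
      rw [h5] at h4
      have h6 : inner ℝ (matrixCLM (B + (2 * ε) • (1 : Matrix (Fin n) (Fin n) ℝ))
          (∑ i, w i • z.1 i)) (∑ i, w i • z.1 i) =
          inner ℝ (matrixCLM B (∑ i, w i • z.1 i)) (∑ i, w i • z.1 i) +
            2 * ε * ‖∑ i, w i • z.1 i‖ ^ 2 := by
        rw [matrixCLM, map_add, map_smul, map_one, add_apply, inner_add_left, smul_apply,
          real_inner_smul_left, one_apply_eq_self, real_inner_self_eq_norm_sq]
      rw [hVp] at hz1
      simp only [Prod.mk_add_mk]
      rw [h6]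
      linarith
    obtain ⟨M, q, g, b, X, hM, hq, hvq, hg, hb, hX, hXs, hjet⟩ :=
      exists_superjet_sequences hw hsum (fun i => (hOi i).mem_nhds (hyO i)) hvusc
        (hB.add (Matrix.isSymm_one.smul _)) hle hε
    have hMs : ∀ i, (M i).IsSymm := fun i => by
      have hc : Continuous fun A : Matrix (Fin n) (Fin n) ℝ => A.transpose := by fun_prop
      refine tendsto_nhds_unique (((hc.tendsto _).comp (hX i)).congr fun j => ?_) (hX i)
      exact hXs j i
    have hqO : ∀ᶠ j in atTop, ∀ i, q j i ∈ cylinder (Ω i) T := eventually_all.2 fun i =>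
      (hq i).eventually ((hOi i).eventually_mem (hyO i))
    have hlim : ∀ i, Tendsto (fun j => transformedOperator α (F i) (g j i) (q j i).2 (q j i).1
        (radial α (v i (q j i))) (jetMatrix α (radial α (v i (q j i))) (X j i) (g j i))) atTop
        (𝓝 (transformedOperator α (F i) θ t (y i) (r i) (jetMatrix α (r i) (M i) θ))) := by
      intro i
      have h1 : Tendsto (fun j => radial α (v i (q j i))) atTop (𝓝 (r i)) :=
        ((continuous_radial α).tendsto _).comp (hvq i)
      refine tendsto_transformedOperator (hOi i) (hF_cont i) (hyO i) (fun h => hr0 h i)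
        (isSymm_jetMatrix (hMs i) θ) (hq i).fst_nhds (hq i).snd_nhds h1 (hg i)
        (tendsto_jetMatrix h1 (hX i) (hg i))
        (Eventually.of_forall fun j => isSymm_jetMatrix (hXs j i) _)
    have hlim' := hb.add (tendsto_finsetSum Finset.univ fun i _ => (hlim i).const_mul (w i))
    have hvisc : ∀ j i, q j i ∈ cylinder (Ω i) T → b j i + transformedOperator α (F i) (g j i)
        (q j i).2 (q j i).1 (radial α (v i (q j i)))
        (jetMatrix α (radial α (v i (q j i))) (X j i) (g j i)) ≤ 0 := fun j i hji =>
      (hu_sub i).superjet_powTransform hα (hOi i) (hF_cont i) (hu_usc i) (hu_pos i) hji (hXs j i)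
        (hjet j i)
    have hle0 : a + ∑ i, w i * transformedOperator α (F i) θ t (y i) (r i)
        (jetMatrix α (r i) (M i) θ) ≤ 0 := by
      refine le_of_tendsto hlim' (hqO.mono fun j hj => ?_)
      rw [← Finset.sum_add_distrib]
      refine Finset.sum_nonpos fun i _ => ?_
      rw [← mul_add]
      exact mul_nonpos_of_nonneg_of_nonpos (hw i).le (hvisc j i (hj i))
    -- All gradients converge to the common `θ` and the time is common, as the structure condition
    -- requires. Ellipticity then replaces the averaged matrix by the larger one coming from `V`.
    have h7 := hstr θ t ht y r (fun i => jetMatrix α (r i) (M i) θ) hy hr0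
      fun i => isSymm_jetMatrix (hMs i) θ
    have h8 : (∑ i, w i • jetMatrix α (r i) (M i) θ).IsSymm := by
      rw [Matrix.IsSymm, Matrix.transpose_sum]
      exact Finset.sum_congr rfl fun i _ => ((isSymm_jetMatrix (hMs i) θ).smul _)
    have h9 := hFl_ell.transformedOperator_le (α := α) (θ := θ) hpO hr0' (hs1 _) h8
      (jetMatrix_sum_le hsum hB hMs hM r θ)
    linarith
  have hlim : Tendsto (fun ε : ℝ => a + transformedOperator α Fl θ t (∑ i, w i • y i)
      (∑ i, w i * r i) (jetMatrix α (∑ i, w i * r i) B θ +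
        (ε * κ) • (1 : Matrix (Fin n) (Fin n) ℝ))) (𝓝[>] 0)
      (𝓝 (a + transformedOperator α Fl θ t (∑ i, w i • y i) (∑ i, w i * r i)
        (jetMatrix α (∑ i, w i * r i) B θ))) := by
    refine tendsto_const_nhds.add (tendsto_transformedOperator hO hFl_cont hpO hr0'
      (isSymm_jetMatrix hB θ) tendsto_const_nhds tendsto_const_nhds tendsto_const_nhds
      tendsto_const_nhds ?_ (Eventually.of_forall fun ε => hs1 _))
    have hc : Continuous fun ε : ℝ => jetMatrix α (∑ i, w i * r i) B θ +
        (ε * κ) • (1 : Matrix (Fin n) (Fin n) ℝ) := by fun_prop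
    have h3 := hc.tendsto 0
    rw [zero_mul, zero_smul, add_zero] at h3
    exact h3.mono_left nhdsWithin_le_nhds
  exact le_of_tendsto hlim (eventually_mem_nhdsWithin.mono fun ε hε => key ε hε)

end Convolution

/-! ### Monotonicity and continuity of power means -/

section PowerMean

variable {k : ℕ} {α : ℝ}

theorem powerMean_pos (hα : α ≤ 0) {a w : Fin k → ℝ} (hw : ∀ i, 0 ≤ w i) (hsum : ∑ i, w i = 1)
    (ha : ∀ i, 0 < a i) : 0 < powerMean α a w := by
  rw [powerMean_eq ha]
  exact powInverse_pos hα (sum_mem_powRange hw hsum fun i => powTransform_mem hα (ha i))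

theorem powerMean_of_not_pos {a w : Fin k → ℝ} (ha : ¬ ∀ i, 0 < a i) : powerMean α a w = 0 :=
  if_neg ha

theorem powerMean_nonneg (hα : α ≤ 0) {a w : Fin k → ℝ} (hw : ∀ i, 0 ≤ w i)
    (hsum : ∑ i, w i = 1) : 0 ≤ powerMean α a w := by
  by_cases ha : ∀ i, 0 < a i
  · exact (powerMean_pos hα hw hsum ha).le
  · exact (powerMean_of_not_pos ha).ge

theorem powerMean_mono (hα : α ≤ 0) {a b w : Fin k → ℝ} (hw : ∀ i, 0 ≤ w i)
    (hsum : ∑ i, w i = 1) (hab : ∀ i, a i ≤ b i) : powerMean α a w ≤ powerMean α b w := by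
  by_cases ha : ∀ i, 0 < a i
  · have hb : ∀ i, 0 < b i := fun i => (ha i).trans_le (hab i)
    rw [powerMean_eq ha, powerMean_eq hb]
    refine monotoneOn_powInverse hα
      (sum_mem_powRange hw hsum fun i => powTransform_mem hα (ha i))
      (sum_mem_powRange hw hsum fun i => powTransform_mem hα (hb i)) ?_
    exact Finset.sum_le_sum fun i _ => mul_le_mul_of_nonneg_left
      (monotoneOn_powTransform (ha i) (hb i) (hab i)) (hw i)
  · rw [powerMean_of_not_pos ha]
    exact powerMean_nonneg hα hw hsum

/-- The weighted arithmetic-geometric inequality for the numbers `aᵢ ^ α`; the exponent `1 / α`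
reverses it when `α < 0`. -/
theorem powerMean_le_prod (hα : α ≤ 0) {a w : Fin k → ℝ} (hw : ∀ i, 0 ≤ w i)
    (hsum : ∑ i, w i = 1) (ha : ∀ i, 0 ≤ a i) : powerMean α a w ≤ ∏ i, a i ^ w i := by
  by_cases ha' : ∀ i, 0 < a i
  · unfold powerMean
    rw [if_pos ha']
    split_ifs with h
    · exact le_rfl
    · have h1 := Real.geom_mean_le_arith_mean_weighted Finset.univ w (fun i => a i ^ α)
        (fun i _ => hw i) hsum (fun i _ => Real.rpow_nonneg (ha i) α)
      have h2 : ∏ i, (a i ^ α) ^ w i = (∏ i, a i ^ w i) ^ α := by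
        rw [← Real.finsetProd_rpow _ _ fun i _ => Real.rpow_nonneg (ha i) _]
        refine Finset.prod_congr rfl fun i _ => ?_
        rw [← Real.rpow_mul (ha i), ← Real.rpow_mul (ha i), mul_comm]
      have hP : 0 < ∏ i, a i ^ w i := Finset.prod_pos fun i _ => Real.rpow_pos_of_pos (ha' i) _
      rw [h2] at h1
      refine (Real.rpow_le_rpow_of_nonpos (Real.rpow_pos_of_pos hP α) h1
        (one_div_nonpos.2 hα)).trans (le_of_eq ?_)
      rw [← Real.rpow_mul hP.le, mul_one_div_cancel h, Real.rpow_one]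
  · rw [powerMean_of_not_pos ha']
    exact Finset.prod_nonneg fun i _ => Real.rpow_nonneg (ha i) _

/-- Power means with nonpositive exponent are continuous from the right at nonnegative vectors. -/
theorem exists_powerMean_add_lt (hα : α ≤ 0) {b w : Fin k → ℝ} (hw : ∀ i, 0 < w i)
    (hsum : ∑ i, w i = 1) (hb : ∀ i, 0 ≤ b i) {c : ℝ} (hc : powerMean α b w < c) :
    ∃ δ, 0 < δ ∧ powerMean α (fun i => b i + δ) w < c := by
  have hadd : ∀ i, Tendsto (fun δ : ℝ => b i + δ) (𝓝[>] 0) (𝓝 (b i)) := fun i => by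
    have : Tendsto (fun δ : ℝ => b i + δ) (𝓝 0) (𝓝 (b i + 0)) :=
      (continuous_const.add continuous_id).tendsto 0
    rw [add_zero] at this
    exact this.mono_left nhdsWithin_le_nhds
  suffices h : ∀ᶠ δ in 𝓝[>] (0 : ℝ), powerMean α (fun i => b i + δ) w < c by
    obtain ⟨δ, h1, h2⟩ := (h.and eventually_mem_nhdsWithin).exists
    exact ⟨δ, h2, h1⟩
  by_cases hb' : ∀ i, 0 < b i
  · have h1 : Tendsto (fun δ : ℝ => powInverse α (∑ i, w i * powTransform α (b i + δ))) (𝓝[>] 0)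
        (𝓝 (powInverse α (∑ i, w i * powTransform α (b i)))) := by
      refine ((hasDerivAt_powInverse hα (sum_mem_powRange (fun i => (hw i).le) hsum fun i =>
        powTransform_mem hα (hb' i))).continuousAt.tendsto).comp ?_
      exact tendsto_finsetSum _ fun i _ => ((hasDerivAt_powTransform
        (hb' i)).continuousAt.tendsto.comp (hadd i)).const_mul _
    rw [← powerMean_eq hb'] at h1
    filter_upwards [h1.eventually (eventually_lt_nhds hc), self_mem_nhdsWithin] with δ h2 h3
    rwa [powerMean_eq fun i => add_pos (hb' i) h3]
  -- Some entry vanishes and its weight is positive, so the dominating geometric mean tends to zero.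
  · rw [powerMean_of_not_pos hb'] at hc
    push Not at hb'
    obtain ⟨j, hj⟩ := hb'
    have hj0 : b j = 0 := le_antisymm hj (hb j)
    have h1 : Tendsto (fun δ : ℝ => ∏ i, (b i + δ) ^ w i) (𝓝[>] 0) (𝓝 (∏ i, b i ^ w i)) :=
      tendsto_finsetProd _ fun i _ => (hadd i).rpow_const (Or.inr (hw i).le)
    have h2 : ∏ i, b i ^ w i = 0 :=
      Finset.prod_eq_zero (Finset.mem_univ j) (by rw [hj0, Real.zero_rpow (hw j).ne'])
    rw [h2] at h1
    filter_upwards [h1.eventually (eventually_lt_nhds hc), self_mem_nhdsWithin] with δ h3 h4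
    exact (powerMean_le_prod hα (fun i => (hw i).le) hsum fun i =>
      add_nonneg (hb i) (mem_Ioi.1 h4).le).trans_lt h3

end PowerMean

/-! ### Attainment, semicontinuity and boundary values for positive weights -/

section Convolution

variable {n k : ℕ} {α : ℝ} {w : Fin k → ℝ} {T : EReal} {Ω : Fin k → Set (Space n)}
  {u : Fin k → Space n × ℝ → ℝ}

theorem nonneg_of_boundary (hu_pos : ∀ i, ∀ p ∈ cylinder (Ω i) T, 0 < u i p)
    (hu_bdry : ∀ i, ∀ x ∈ frontier (Ω i), ∀ t ∈ timeInterval T, u i (x, t) = 0)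
    {i : Fin k} {x : Space n} {t : ℝ} (hx : x ∈ closure (Ω i)) (ht : t ∈ timeInterval T) :
    0 ≤ u i (x, t) := by
  rw [closure_eq_self_union_frontier] at hx
  rcases hx with hx | hx
  · exact (hu_pos i _ ⟨hx, ht⟩).le
  · exact (hu_bdry i x hx t ht).ge

theorem mem_of_pos (hu_bdry : ∀ i, ∀ x ∈ frontier (Ω i), ∀ t ∈ timeInterval T, u i (x, t) = 0)
    {i : Fin k} {x : Space n} {t : ℝ} (hx : x ∈ closure (Ω i)) (ht : t ∈ timeInterval T)
    (h : 0 < u i (x, t)) : x ∈ Ω i := by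
  rw [closure_eq_self_union_frontier] at hx
  rcases hx with hx | hx
  · exact hx
  · exact absurd (hu_bdry i x hx t ht) h.ne'

/-- Joint upper semicontinuity of the power mean of the functions. -/
theorem eventually_powerMean_lt (hα : α ≤ 0) (hw : ∀ i, 0 < w i) (hsum : ∑ i, w i = 1)
    (hu_usc : ∀ i, UpperSemicontinuousOn (u i) (closure (cylinder (Ω i) T)))
    (hu_pos : ∀ i, ∀ p ∈ cylinder (Ω i) T, 0 < u i p)
    (hu_bdry : ∀ i, ∀ x ∈ frontier (Ω i), ∀ t ∈ timeInterval T, u i (x, t) = 0)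
    {y : Fin k → Space n} {t c : ℝ} (hy : ∀ i, y i ∈ closure (Ω i)) (ht : t ∈ timeInterval T)
    (hc : powerMean α (fun i => u i (y i, t)) w < c) :
    ∀ᶠ z in 𝓝 t ×ˢ 𝓝 y, z.1 ∈ timeInterval T → (∀ i, z.2 i ∈ closure (Ω i)) →
      powerMean α (fun i => u i (z.2 i, z.1)) w < c := by
  obtain ⟨δ, hδ, hδc⟩ := exists_powerMean_add_lt hα hw hsum
    (fun i => nonneg_of_boundary hu_pos hu_bdry (hy i) ht) hc
  have hsub : ∀ i (x : Space n) (s : ℝ), x ∈ closure (Ω i) → s ∈ timeInterval T →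
      (x, s) ∈ closure (cylinder (Ω i) T) := fun i x s hx hs => by
    rw [cylinder, closure_prod_eq]
    exact ⟨hx, subset_closure hs⟩
  have h1 : ∀ᶠ z in 𝓝 t ×ˢ 𝓝 y, ∀ i, z.1 ∈ timeInterval T → z.2 i ∈ closure (Ω i) →
      u i (z.2 i, z.1) < u i (y i, t) + δ := eventually_all.2 fun i => by
    have h2 := hu_usc i _ (hsub i _ _ (hy i) ht) (u i (y i, t) + δ) (by linarith)
    rw [eventually_nhdsWithin_iff] at h2
    have hc : Continuous fun z : ℝ × (Fin k → Space n) => (z.2 i, z.1) := by fun_prop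
    rw [← nhds_prod_eq]
    filter_upwards [(hc.tendsto (t, y)).eventually h2] with z hz hz1 hz2
    exact hz (hsub i _ _ hz2 hz1)
  filter_upwards [h1] with z hz hz1 hz2
  exact (powerMean_mono hα (fun i => (hw i).le) hsum fun i => (hz i hz1 (hz2 i)).le).trans_lt hδc

theorem isCompact_pi_closure (hΩb : ∀ i, Bornology.IsBounded (Ω i)) :
    IsCompact {y : Fin k → Space n | ∀ i, y i ∈ closure (Ω i)} := by
  have := isCompact_univ_pi fun i => (hΩb i).isCompact_closure
  simpa [Set.pi] using this

/-- The image of the compact product of closures is closed and contains the combination. -/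
theorem closure_minkowskiCombination_subset (hΩb : ∀ i, Bornology.IsBounded (Ω i)) {x : Space n}
    (hx : x ∈ closure (minkowskiCombination w Ω)) :
    ∃ y : Fin k → Space n, (∀ i, y i ∈ closure (Ω i)) ∧ x = ∑ i, w i • y i := by
  have hc : Continuous fun y : Fin k → Space n => ∑ i, w i • y i := by fun_prop
  have h1 := ((isCompact_pi_closure hΩb).image hc).isClosed
  have h2 : minkowskiCombination w Ω ⊆
      (fun y : Fin k → Space n => ∑ i, w i • y i) '' {y | ∀ i, y i ∈ closure (Ω i)} := by
    rintro x ⟨y, hy, rfl⟩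
    exact ⟨y, fun i => subset_closure (hy i), rfl⟩
  obtain ⟨y, hy, hxy⟩ := closure_minimal h2 h1 hx
  exact ⟨y, hy, hxy.symm⟩

/-- The supremum defining the convolution is a maximum. -/
theorem exists_minkowskiConvolution_eq (hα : α ≤ 0) (hw : ∀ i, 0 < w i) (hsum : ∑ i, w i = 1)
    (hΩb : ∀ i, Bornology.IsBounded (Ω i))
    (hu_usc : ∀ i, UpperSemicontinuousOn (u i) (closure (cylinder (Ω i) T)))
    (hu_pos : ∀ i, ∀ p ∈ cylinder (Ω i) T, 0 < u i p)
    (hu_bdry : ∀ i, ∀ x ∈ frontier (Ω i), ∀ t ∈ timeInterval T, u i (x, t) = 0)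
    {y₀ : Fin k → Space n} (hy₀ : ∀ i, y₀ i ∈ closure (Ω i)) {t : ℝ} (ht : t ∈ timeInterval T) :
    ∃ y : Fin k → Space n, (∀ i, y i ∈ closure (Ω i)) ∧ ∑ i, w i • y₀ i = ∑ i, w i • y i ∧
      minkowskiConvolution α w Ω u (∑ i, w i • y₀ i, t) = powerMean α (fun i => u i (y i, t)) w ∧
      ∀ z : Fin k → Space n, (∀ i, z i ∈ closure (Ω i)) → ∑ i, w i • y₀ i = ∑ i, w i • z i →
        powerMean α (fun i => u i (z i, t)) w ≤ powerMean α (fun i => u i (y i, t)) w := by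
  set K := {y : Fin k → Space n | ∀ i, y i ∈ closure (Ω i)} ∩
    {y | ∑ i, w i • y₀ i = ∑ i, w i • y i} with hK
  have hKc : IsCompact K := (isCompact_pi_closure hΩb).inter_right
    (isClosed_eq continuous_const (by fun_prop))
  have husc : UpperSemicontinuousOn (fun y : Fin k → Space n =>
      powerMean α (fun i => u i (y i, t)) w) K := by
    intro y hy c hc
    have h1 := eventually_powerMean_lt hα hw hsum hu_usc hu_pos hu_bdry hy.1 ht hc
    rw [eventually_nhdsWithin_iff]
    have h2 : Tendsto (fun z : Fin k → Space n => (t, z)) (𝓝 y) (𝓝 t ×ˢ 𝓝 y) :=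
      tendsto_const_nhds.prodMk tendsto_id
    filter_upwards [h2.eventually h1] with z hz hzK
    exact hz ht hzK.1
  obtain ⟨y, hyK, hy⟩ := UpperSemicontinuousOn.exists_isMaxOn (⟨y₀, hy₀, rfl⟩ : K.Nonempty) hKc husc
  have hmax : ∀ z : Fin k → Space n, (∀ i, z i ∈ closure (Ω i)) →
      ∑ i, w i • y₀ i = ∑ i, w i • z i →
      powerMean α (fun i => u i (z i, t)) w ≤ powerMean α (fun i => u i (y i, t)) w :=
    fun z hz1 hz2 => hy ⟨hz1, hz2⟩
  refine ⟨y, hyK.1, hyK.2, ?_, hmax⟩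
  refine IsGreatest.csSup_eq ⟨⟨y, hyK.1, hyK.2, rfl⟩, ?_⟩
  rintro m ⟨z, hz1, hz2, rfl⟩
  exact hmax z hz1 hz2

/-- The conclusions of the theorem for positive weights. -/
theorem minkowskiConvolution_of_pos (hw : ∀ i, 0 < w i) (hsum : ∑ i, w i = 1)
    (hΩ : ∀ i, IsOpen (Ω i)) (hΩb : ∀ i, Bornology.IsBounded (Ω i))
    {F : Fin k → Operator n} {Fl : Operator n}
    (hF_cont : ∀ i, IsContinuousOperator (cylinder (Ω i) T) (F i))
    (hFl_cont : IsContinuousOperator (cylinder (minkowskiCombination w Ω) T) Fl)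
    (hFl_ell : IsElliptic (cylinder (minkowskiCombination w Ω) T) Fl)
    (hu_usc : ∀ i, UpperSemicontinuousOn (u i) (closure (cylinder (Ω i) T)))
    (hu_pos : ∀ i, ∀ p ∈ cylinder (Ω i) T, 0 < u i p)
    (hu_sub : ∀ i, IsViscositySubsolution (cylinder (Ω i) T) (F i) (u i))
    (hu_bdry : ∀ i, ∀ x ∈ frontier (Ω i), ∀ t ∈ timeInterval T, u i (x, t) = 0)
    (hα : α ≤ 0) (hstr : StructureCondition α w Ω T F Fl) :
    IsViscositySubsolution (cylinder (minkowskiCombination w Ω) T) Fl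
      (minkowskiConvolution α w Ω u) ∧
    (∀ p ∈ cylinder (minkowskiCombination w Ω) T, 0 < minkowskiConvolution α w Ω u p) ∧
    UpperSemicontinuousOn (minkowskiConvolution α w Ω u)
      (cylinder (closure (minkowskiCombination w Ω)) T) ∧
    (∀ x ∈ frontier (minkowskiCombination w Ω), ∀ t ∈ timeInterval T,
      minkowskiConvolution α w Ω u (x, t) = 0) := by
  set U := minkowskiConvolution α w Ω u with hUdef
  have hw0 : ∀ i, 0 ≤ w i := fun i => (hw i).le
  have hOl := isOpen_minkowskiCombination hsum hΩ
  have hO := isOpen_cylinder hOl T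
  have hatt : ∀ x ∈ closure (minkowskiCombination w Ω), ∀ t ∈ timeInterval T,
      ∃ y : Fin k → Space n, (∀ i, y i ∈ closure (Ω i)) ∧ x = ∑ i, w i • y i ∧
        U (x, t) = powerMean α (fun i => u i (y i, t)) w := by
    intro x hx t ht
    obtain ⟨y₀, hy₀, rfl⟩ := closure_minkowskiCombination_subset hΩb hx
    obtain ⟨y, hy1, hy2, hy3, -⟩ := exists_minkowskiConvolution_eq hα hw hsum hΩb hu_usc hu_pos
      hu_bdry hy₀ ht
    exact ⟨y, hy1, hy2, hy3⟩
  have hge : ∀ (z : Fin k → Space n) (t : ℝ), (∀ i, z i ∈ closure (Ω i)) → t ∈ timeInterval T →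
      powerMean α (fun i => u i (z i, t)) w ≤ U (∑ i, w i • z i, t) := by
    intro z t hz ht
    obtain ⟨y, -, -, hy3, hy4⟩ := exists_minkowskiConvolution_eq hα hw hsum hΩb hu_usc hu_pos
      hu_bdry hz ht
    rw [hUdef, hy3]
    exact hy4 z hz rfl
  have hpos : ∀ p ∈ cylinder (minkowskiCombination w Ω) T, 0 < U p := by
    rintro ⟨x, t⟩ ⟨⟨y, hy, hx⟩, ht⟩
    have hx' : x = ∑ i, w i • y i := hx
    rw [hx']
    exact (powerMean_pos hα hw0 hsum fun i => hu_pos i (y i, t) ⟨hy i, ht⟩).trans_le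
      (hge y t (fun i => subset_closure (hy i)) ht)
  have hmem : ∀ {y : Fin k → Space n} {t : ℝ}, (∀ i, y i ∈ closure (Ω i)) → t ∈ timeInterval T →
      powerMean α (fun i => u i (y i, t)) w ≠ 0 → ∀ i, y i ∈ Ω i := by
    intro y t hy ht h i
    have h1 : ∀ i, 0 < u i (y i, t) := by
      by_contra h2
      exact h (powerMean_of_not_pos h2)
    exact mem_of_pos hu_bdry (hy i) ht (h1 i)
  have husc : UpperSemicontinuousOn U (cylinder (closure (minkowskiCombination w Ω)) T) := by
    rintro ⟨x₀, t₀⟩ ⟨hx₀, ht₀⟩ c hc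
    have h1 : ∀ᶠ q in 𝓝 (x₀, t₀), ∀ y ∈ {y : Fin k → Space n | ∀ i, y i ∈ closure (Ω i)},
        q.2 ∈ timeInterval T → (∀ i, y i ∈ closure (Ω i)) → q.1 = ∑ i, w i • y i →
          powerMean α (fun i => u i (y i, q.2)) w < c := by
      -- By compactness it suffices to work near each tuple `y`. If `y` represents `x₀`, joint
      -- semicontinuity of the mean applies. Otherwise tuples near `y` do not represent points near
      -- `x₀`, and the condition is void.
      refine (isCompact_pi_closure hΩb).eventually_forall_of_forall_eventually fun y hy => ?_
      by_cases hxy : x₀ = ∑ i, w i • y i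
      · subst hxy
        have h2 := eventually_powerMean_lt hα hw hsum hu_usc hu_pos hu_bdry hy ht₀
          ((hge y t₀ hy ht₀).trans_lt hc)
        rw [← nhds_prod_eq] at h2
        have hcont : Continuous fun z : (Space n × ℝ) × (Fin k → Space n) => (z.1.2, z.2) := by
          fun_prop
        filter_upwards [(hcont.tendsto ((∑ i, w i • y i, t₀), y)).eventually h2] with z hz h3 h4 _
        exact hz h3 h4
      · have hcont : Continuous fun z : (Space n × ℝ) × (Fin k → Space n) =>
            z.1.1 - ∑ i, w i • z.2 i := by fun_prop
        have h2 := hcont.continuousAt (x := ((x₀, t₀), y)).eventually_ne (y := 0)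
          (sub_ne_zero.2 hxy)
        filter_upwards [h2] with z hz _ _ h3
        exact absurd (sub_eq_zero.2 h3) hz
    filter_upwards [h1.filter_mono nhdsWithin_le_nhds, self_mem_nhdsWithin] with q hq hqO
    obtain ⟨y, hy1, hy2, hy3⟩ := hatt q.1 hqO.1 q.2 hqO.2
    exact hy3.trans_lt (hq y hy1 hqO.2 hy1 hy2)
  have hcyl : cylinder (minkowskiCombination w Ω) T ⊆
      cylinder (closure (minkowskiCombination w Ω)) T := prod_mono subset_closure le_rfl
  refine ⟨⟨husc.mono hcyl, ?_, ?_⟩, hpos, husc, ?_⟩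
  · intro p hp
    refine ⟨U p + 1, ?_⟩
    filter_upwards [husc.mono hcyl p hp (U p + 1) (by linarith), self_mem_nhdsWithin] with q hq hqO
    rw [abs_of_pos (hpos q hqO)]
    exact hq.le
  · rintro φ hφ ⟨x, t⟩ hp hmax
    obtain ⟨y, hy1, hy2, hy3⟩ := hatt x (subset_closure hp.1) t hp.2
    have hy2' : x = ∑ i, w i • y i := hy2
    subst hy2'
    -- Positivity of the maximum forces every `u i (y i, t)` to be positive, hence `y i` off the
    -- boundary.
    have hyΩ := hmem hy1 hp.2 (hy3 ▸ (hpos _ hp).ne')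
    exact viscosity_le_of_attained hw hsum hΩ hF_cont hFl_cont hFl_ell hu_usc hu_pos hu_sub hα hstr
      (fun z s hz hs => hge z s (fun i => subset_closure (hz i)) hs) hpos hyΩ hp.2 hy3
      (hφ.contDiffAt (hO.mem_nhds hp)) ((hO.eventually_mem hp).mono fun q hq => hmax hq)
  -- A nonzero value would place an optimal decomposition in the open sets `Ω i`, and so `x` in the
  -- open combination, away from its frontier.
  · intro x hx t ht
    obtain ⟨y, hy1, hy2, hy3⟩ := hatt x (frontier_subset_closure hx) t ht
    by_contra h
    rw [hy3] at h
    rw [hOl.frontier_eq] at hx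
    exact hx.2 ⟨y, hmem hy1 ht h, hy2⟩

end Convolution

theorem upperSemicontinuousOn_of_eqOn {X : Type*} [TopologicalSpace X] {u v : X → ℝ} {s : Set X}
    (hu : UpperSemicontinuousOn u s) (h : ∀ p ∈ s, v p = u p) : UpperSemicontinuousOn v s := by
  intro p hp c hc
  have hc' : u p < c := (h p hp).symm.trans_lt hc
  filter_upwards [hu p hp c hc', self_mem_nhdsWithin] with q hq hqs
  exact (h q hqs).trans_lt hq

theorem IsViscositySubsolution.congr {n : ℕ} {O : Set (Space n × ℝ)} {F : Operator n}
    {u v : Space n × ℝ → ℝ} (hu : IsViscositySubsolution O F u) (h : ∀ p ∈ O, v p = u p) :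
    IsViscositySubsolution O F v where
  upperSemicontinuousOn := upperSemicontinuousOn_of_eqOn hu.upperSemicontinuousOn h
  locallyBounded := fun p hp => by
    obtain ⟨C, hC⟩ := hu.locallyBounded p hp
    refine ⟨C, ?_⟩
    filter_upwards [hC, self_mem_nhdsWithin] with q hq hqO
    rwa [h q hqO]
  test := fun φ hφ p hp hmax => by
    rw [h p hp]
    refine hu.test φ hφ p hp fun q hq => ?_
    have := hmax hq
    simp only [mem_ofPred_eq, h p hp, h q hq] at this
    exact this

/-! ### Removal of zero weights -/

section Reindexing

variable {k : ℕ}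

/-- The number of positive weights. -/
def positiveCount (w : Fin k → ℝ) : ℕ := Nat.card {i // 0 < w i}

/-- Enumeration of the positive weights. -/
def positiveEquiv (w : Fin k → ℝ) : Fin (positiveCount w) ≃ {i // 0 < w i} :=
  (Finite.equivFin _).symm

/-- The positive weights, as indices. -/
def positiveIndex (w : Fin k → ℝ) (j : Fin (positiveCount w)) : Fin k := positiveEquiv w j

theorem positiveIndex_pos (w : Fin k → ℝ) (j : Fin (positiveCount w)) :
    0 < w (positiveIndex w j) := (positiveEquiv w j).2

/-- Extension of a family over the positive weights by default values. -/
def extendPositive {E : Type*} (w : Fin k → ℝ) (f : Fin (positiveCount w) → E) (d : Fin k → E)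
    (i : Fin k) : E :=
  open Classical in if h : 0 < w i then f ((positiveEquiv w).symm ⟨i, h⟩) else d i

theorem extendPositive_positiveIndex {E : Type*} (w : Fin k → ℝ) (f : Fin (positiveCount w) → E)
    (d : Fin k → E) (j : Fin (positiveCount w)) :
    extendPositive w f d (positiveIndex w j) = f j := by
  rw [extendPositive, dif_pos (positiveIndex_pos w j)]
  congr 1
  exact (positiveEquiv w).symm_apply_apply j

theorem extendPositive_induction {E : Type*} {w : Fin k → ℝ} {f : Fin (positiveCount w) → E}
    {d : Fin k → E} {P : Fin k → E → Prop} (hf : ∀ j, P (positiveIndex w j) (f j))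
    (hd : ∀ i, P i (d i)) (i : Fin k) : P i (extendPositive w f d i) := by
  unfold extendPositive
  split_ifs with h
  · have := hf ((positiveEquiv w).symm ⟨i, h⟩)
    rwa [positiveIndex, Equiv.apply_symm_apply] at this
  · exact hd i

theorem prod_positiveIndex {M : Type*} [CommMonoid M] {w : Fin k → ℝ} (hw : ∀ i, 0 ≤ w i)
    {f : Fin k → M} (hf : ∀ i, w i = 0 → f i = 1) :
    ∏ i, f i = ∏ j, f (positiveIndex w j) := by
  classical
  have h1 : ∏ i, f i = ∏ i ∈ Finset.univ.filter fun i => 0 < w i, f i := by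
    refine (Finset.prod_subset (Finset.filter_subset _ _) fun i _ hi => hf i ?_).symm
    rw [Finset.mem_filter, not_and] at hi
    exact le_antisymm (not_lt.1 (hi (Finset.mem_univ i))) (hw i)
  rw [h1, Finset.prod_subtype (p := fun i => 0 < w i) _ (by simp)]
  exact (Fintype.prod_equiv (positiveEquiv w) _ _ fun j => rfl).symm

theorem sum_positiveIndex {M : Type*} [AddCommMonoid M] {w : Fin k → ℝ} (hw : ∀ i, 0 ≤ w i)
    {f : Fin k → M} (hf : ∀ i, w i = 0 → f i = 0) :
    ∑ i, f i = ∑ j, f (positiveIndex w j) :=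
  prod_positiveIndex (M := Multiplicative M) hw hf

theorem sum_smul_positiveIndex {E : Type*} [AddCommMonoid E] [Module ℝ E] {w : Fin k → ℝ}
    (hw : ∀ i, 0 ≤ w i) (f : Fin k → E) :
    ∑ i, w i • f i = ∑ j, w (positiveIndex w j) • f (positiveIndex w j) :=
  sum_positiveIndex hw fun i hi => by rw [hi, zero_smul]

theorem sum_smul_extendPositive {E : Type*} [AddCommMonoid E] [Module ℝ E] {w : Fin k → ℝ}
    (hw : ∀ i, 0 ≤ w i) (f : Fin (positiveCount w) → E) (d : Fin k → E) :
    ∑ i, w i • extendPositive w f d i = ∑ j, w (positiveIndex w j) • f j := by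
  rw [sum_smul_positiveIndex hw]
  simp only [extendPositive_positiveIndex]

theorem powerMean_positiveIndex {α : ℝ} {a w : Fin k → ℝ} (hw : ∀ i, 0 ≤ w i)
    (ha : ∀ i, 0 < a i) : powerMean α a w =
      powerMean α (fun j => a (positiveIndex w j)) (fun j => w (positiveIndex w j)) := by
  unfold powerMean
  rw [if_pos ha, if_pos fun j => ha _]
  split_ifs
  · exact prod_positiveIndex hw fun i hi => by rw [hi, Real.rpow_zero]
  · rw [sum_positiveIndex hw fun i hi => by rw [hi, zero_mul]]

variable {n : ℕ} {α : ℝ} {T : EReal} {w : Fin k → ℝ} {Ω : Fin k → Set (Space n)}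

theorem minkowskiCombination_positiveIndex (hw : ∀ i, 0 ≤ w i) (hne : ∀ i, (Ω i).Nonempty) :
    minkowskiCombination w Ω =
      minkowskiCombination (fun j => w (positiveIndex w j)) (fun j => Ω (positiveIndex w j)) := by
  choose b hb using hne
  ext x
  constructor
  · rintro ⟨y, hy, rfl⟩
    exact ⟨_, fun j => hy _, sum_smul_positiveIndex hw y⟩
  · rintro ⟨y, hy, rfl⟩
    exact ⟨extendPositive w y b, extendPositive_induction (P := fun i z => z ∈ Ω i) hy hb,
      (sum_smul_extendPositive hw y b).symm⟩

/-- The two sets of competing values dominate each other. A slot of zero weight does not affect the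
constraint, but a vanishing entry there would annihilate the mean; such slots are therefore filled
with interior points, where `u i` is positive at times in `(0, T)`. -/
theorem minkowskiConvolution_positiveIndex (hα : α ≤ 0) (hw : ∀ i, 0 ≤ w i) (hsum : ∑ i, w i = 1)
    (hne : ∀ i, (Ω i).Nonempty) {u : Fin k → Space n × ℝ → ℝ}
    (hu_pos : ∀ i, ∀ p ∈ cylinder (Ω i) T, 0 < u i p) {p : Space n × ℝ}
    (hp : p.2 ∈ timeInterval T) :
    minkowskiConvolution α w Ω u p =
      minkowskiConvolution α (fun j => w (positiveIndex w j)) (fun j => Ω (positiveIndex w j))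
        (fun j => u (positiveIndex w j)) p := by
  choose b hb using hne
  have hsum' : ∑ j, w (positiveIndex w j) = 1 := by
    rw [← hsum]
    exact (sum_positiveIndex hw fun i hi => hi).symm
  have hw' : ∀ j, 0 ≤ w (positiveIndex w j) := fun j => hw _
  refine csSup_eq_csSup_of_forall_exists_le ?_ ?_
  · rintro m ⟨y, hy, hpy, rfl⟩
    refine ⟨_, ⟨fun j => y (positiveIndex w j), fun j => hy _, ?_, rfl⟩, ?_⟩
    · rw [hpy]
      exact sum_smul_positiveIndex hw y
    · by_cases h : ∀ i, 0 < u i (y i, p.2)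
      · exact (powerMean_positiveIndex hw h).le
      · rw [powerMean_of_not_pos h]
        exact powerMean_nonneg hα hw' hsum'
  · rintro m ⟨y, hy, hpy, rfl⟩
    refine ⟨_, ⟨extendPositive w y b, ?_, ?_, rfl⟩, ?_⟩
    · exact extendPositive_induction (P := fun i z => z ∈ closure (Ω i)) hy
        fun i => subset_closure (hb i)
    · rw [hpy]
      exact (sum_smul_extendPositive hw y b).symm
    · by_cases h : ∀ j, 0 < u (positiveIndex w j) (y j, p.2)
      · have h' : ∀ i, 0 < u i (extendPositive w y b i, p.2) :=
          extendPositive_induction (P := fun i z => 0 < u i (z, p.2)) h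
            fun i => hu_pos i _ ⟨hb i, hp⟩
        rw [powerMean_positiveIndex hw h']
        simp only [extendPositive_positiveIndex]
        exact le_rfl
      · rw [powerMean_of_not_pos h]
        exact powerMean_nonneg hα hw hsum

theorem StructureCondition.positiveIndex (hw : ∀ i, 0 ≤ w i) (hne : ∀ i, (Ω i).Nonempty)
    {F : Fin k → Operator n} {Fl : Operator n} (h : StructureCondition α w Ω T F Fl) :
    StructureCondition α (fun j => w (positiveIndex w j)) (fun j => Ω (positiveIndex w j)) T
      (fun j => F (positiveIndex w j)) Fl := by
  choose b hb using hne
  intro θ t ht x r A hx hr hA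
  -- Any admissible values will do in the slots of zero weight: an interior point, the positive
  -- number `1`, and the symmetric matrix `0`.
  have h1 := h θ t ht (extendPositive w x b) (extendPositive w r fun _ => 1)
    (extendPositive w A fun _ => 0)
    (extendPositive_induction (P := fun i z => z ∈ Ω i) hx hb)
    (fun hα => extendPositive_induction (P := fun _ r => 0 < r) (hr hα) fun _ => one_pos)
    (extendPositive_induction (P := fun _ (A : Matrix (Fin n) (Fin n) ℝ) => A.IsSymm) hA
      fun _ => Matrix.isSymm_zero)
  have h2 := sum_smul_extendPositive hw r fun _ => 1
  simp only [smul_eq_mul] at h2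
  rw [sum_smul_extendPositive hw, sum_smul_extendPositive hw, h2,
    sum_positiveIndex hw fun i hi => by rw [hi, zero_mul]] at h1
  simpa only [extendPositive_positiveIndex] using h1

end Reindexing

end

end ParabolicMinkowski

/-! ### Assembly -/

theorem theorem2p2 (n k : ℕ) (hn : 1 ≤ n) (hk : 2 ≤ k)
    (w : Fin k → ℝ) (hw : w ∈ stdSimplex ℝ (Fin k))
    (T : EReal) (hT : 0 < T)
    (Ω : Fin k → Set (ParabolicMinkowski.Space n))
    (hΩ : ∀ i, ParabolicMinkowski.IsBoundedSmoothDomain (Ω i))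
    (F : Fin k → ParabolicMinkowski.Operator n) (Fl : ParabolicMinkowski.Operator n)
    (hF_cont : ∀ i, ParabolicMinkowski.IsContinuousOperator
      (ParabolicMinkowski.cylinder (Ω i) T) (F i))
    (hF_ell : ∀ i, ParabolicMinkowski.IsElliptic (ParabolicMinkowski.cylinder (Ω i) T) (F i))
    (hFl_cont : ParabolicMinkowski.IsContinuousOperator
      (ParabolicMinkowski.cylinder (ParabolicMinkowski.minkowskiCombination w Ω) T) Fl)
    (hFl_ell : ParabolicMinkowski.IsElliptic
      (ParabolicMinkowski.cylinder (ParabolicMinkowski.minkowskiCombination w Ω) T) Fl)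
    (u : Fin k → ParabolicMinkowski.Space n × ℝ → ℝ)
    (hu_usc : ∀ i, UpperSemicontinuousOn (u i)
      (closure (ParabolicMinkowski.cylinder (Ω i) T)))
    (hu_pos : ∀ i, ∀ p ∈ ParabolicMinkowski.cylinder (Ω i) T, 0 < u i p)
    (hu_sub : ∀ i, ParabolicMinkowski.IsViscositySubsolution
      (ParabolicMinkowski.cylinder (Ω i) T) (F i) (u i))
    (hu_bdry : ∀ i, ∀ x ∈ frontier (Ω i), ∀ t ∈ ParabolicMinkowski.timeInterval T,
      u i (x, t) = 0)
    (α : ℝ) (hα : α ≤ 0)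
    (hstr : ParabolicMinkowski.StructureCondition α w Ω T F Fl) :
    ParabolicMinkowski.IsViscositySubsolution
      (ParabolicMinkowski.cylinder (ParabolicMinkowski.minkowskiCombination w Ω) T) Fl
      (ParabolicMinkowski.minkowskiConvolution α w Ω u) ∧
    (∀ p ∈ ParabolicMinkowski.cylinder (ParabolicMinkowski.minkowskiCombination w Ω) T,
      0 < ParabolicMinkowski.minkowskiConvolution α w Ω u p) ∧
    UpperSemicontinuousOn (ParabolicMinkowski.minkowskiConvolution α w Ω u)
      (ParabolicMinkowski.cylinder
        (closure (ParabolicMinkowski.minkowskiCombination w Ω)) T) ∧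
    (∀ x ∈ frontier (ParabolicMinkowski.minkowskiCombination w Ω),
      ∀ t ∈ ParabolicMinkowski.timeInterval T,
        ParabolicMinkowski.minkowskiConvolution α w Ω u (x, t) = 0) := by
  have hw0 : ∀ i, 0 ≤ w i := hw.1
  have hne : ∀ i, (Ω i).Nonempty := fun i => (hΩ i).isConnected.nonempty
  have hsum : ∑ j, w (ParabolicMinkowski.positiveIndex w j) = 1 := by
    rw [← hw.2]
    exact (ParabolicMinkowski.sum_positiveIndex hw0 fun i hi => hi).symm
  have hcomb := ParabolicMinkowski.minkowskiCombination_positiveIndex hw0 hne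
  rw [hcomb] at hFl_cont hFl_ell ⊢
  -- The two convolutions are identified only at times in `(0, T)`, so the conclusions are
  -- transferred by agreement on the relevant cylinders.
  have hconv : ∀ p : ParabolicMinkowski.Space n × ℝ, p.2 ∈ ParabolicMinkowski.timeInterval T →
      ParabolicMinkowski.minkowskiConvolution α w Ω u p = _ := fun p hp =>
    ParabolicMinkowski.minkowskiConvolution_positiveIndex hα hw0 hw.2 hne hu_pos hp
  obtain ⟨h1, h2, h3, h4⟩ := ParabolicMinkowski.minkowskiConvolution_of_pos
    (ParabolicMinkowski.positiveIndex_pos w) hsum (fun j => (hΩ _).isOpen)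
    (fun j => (hΩ _).isBounded) (fun j => hF_cont _) hFl_cont hFl_ell (fun j => hu_usc _)
    (fun j => hu_pos _) (fun j => hu_sub _) (fun j => hu_bdry _) hα
    (ParabolicMinkowski.StructureCondition.positiveIndex hw0 hne hstr)
  refine ⟨h1.congr fun p hp => hconv p hp.2, fun p hp => ?_,
    ParabolicMinkowski.upperSemicontinuousOn_of_eqOn h3 fun p hp => hconv p hp.2,
    fun x hx t ht => ?_⟩
  · rw [hconv p hp.2]
    exact h2 p hp
  · rw [hconv (x, t) ht]
    exact h4 x hx t ht
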